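/- \textbf{Setting.} Let $T>0$, $n,m\ge 0$ integers, and let $A,Q,G$ be $\mathbb R^{n\times n}$-valued, $B$ be $\mathbb R^{n\times m}$-valued, $S$ be $\mathbb R^{m\times n}$-valued and $M$ be $\mathbb R^{m\times m}$-valued functions ($A,B,G$ on $[0,T]$; $Q,S,M$ on $[0,T]^2$) such that (H1) $A\in L^1(0,T)$ and $B\in L^\infty(0,T)$; (H2) $M\in C^1([0,T]^2)$ has symmetric positive definite values; (H3) $Q\in C^1([0,T]^2)$ and $G\in C^1([0,T])$ have symmetric positive semi-definite values; (H4) $S\in C^1([0,T]^2)$; (H5) for all $0\le t\le s\le T$ the matrices $Q_t(t,s)$, $M_t(t,s)$, $\dot G(t)$ (also at $t=T$), $Q(t,s)-S^\top(t,s)M^{-1}(t,s)S(t,s)$ and $Q_t(t,s)-S_t^\top(t,s)M_t^{-1}(t,s)S_t(t,s)$ are positive semi-definite; here, if $M_t(t,s)$ is singular, $M_t^{-1}S_t$ denotes any solution $K$ of $M_t(t,s)K=S_t(t,s)$, which is required to exist (the product $S_t^\top K$ does not depend on the choice of $K$). Here the subscript $t$ denotes the partial derivative in the first variable. \textbf{The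 problem.} For $(t,x)\in[0,T)\times\mathbb R^n$ a feedback $u:[0,T]\times\mathbb R^n\to\mathbb R^m$ drives the state $\dot X(s)=A(s)X(s)+B(s)u(s,X(s))$ on $[t,T]$, $X(t)=x$ (in integrated form, with $X$ continuous and $u(\cdot,X(\cdot))\in L^2(t,T)$). Writing $u(s)=u(s,X(s))$, its cost is $$J(t,x;u)=\int_t^T\big[\langle Q(t,s)X(s),X(s)\rangle+2\langle S(t,s)X(s),u(s)\rangle+\langle M(t,s)u(s),u(s)\rangle\big]ds+\langle G(t)X(T),X(T)\rangle .$$ A (Lebesgue) measurable feedback $\bar u$ that has exactly one such closed-loop trajectory from every $(t,x)\in[0,T)\times\mathbb R^n$ is an \emph{equilibrium control} if $$\liminf_{\varepsilon\searrow0}\frac{J(t,x;u^{\varepsilon,v})-J(t,x;\bar u)}{\varepsilon}\ge 0\qquad\text{for all }(t,x)\in[0,T)\times\mathbb R^n,\ v\in\mathbb R^m,$$ where $u^{\varepsilon,v}(s,y)=v$ for $s\in[t,t+\varepsilon]$ and $u^{\varepsilon,v}(s,y)=\bar u(s,y)$ for $s\in(t+\varepsilon,T]$. It is a \emph{linear equilibrium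 control} if moreover $\bar u(t,x)=\tilde u(t)x$ on $[0,T]\times\mathbb R^n$ for some $\tilde u\in L^2((0,T);\mathbb R^{m\times n})$. \textbf{The equilibrium Riccati equation.} A symmetric-matrix-valued $P\in C([0,T];\mathbb R^{n\times n})$ is a solution if, for all $t\in[0,T]$, $$P(t)=G(T)+\int_t^T\Big(A^\top P+PA+\bar Q(s,s)-[PB+S^\top(s,s)]M^{-1}(s,s)[B^\top P+S(s,s)]\Big)ds ,$$ with $A,B,P$ evaluated at $s$, where, with $\Upsilon(s)=M^{-1}(s,s)(B^\top(s)P(s)+S(s,s))$ and $\Phi(s,t)$ the state-transition matrix of $A-B\Upsilon$ (that is, $\partial_s\Phi(s,t)=(A(s)-B(s)\Upsilon(s))\Phi(s,t)$, $\Phi(t,t)=I$), $$\bar Q(t,t)=Q(t,t)-\Phi^\top(T,t)\dot G(t)\Phi(T,t)-\int_t^T\Phi^\top(s,t)\big[Q_t(t,s)+\Upsilon^\top(s)M_t(t,s)\Upsilon(s)-\Upsilon^\top(s)S_t(t,s)-S_t^\top(t,s)\Upsilon(s)\big]\Phi(s,t)\,ds .$$ \textbf{Theorem.} Assume (H1)--(H5).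 The equilibrium Riccati equation has exactly one symmetric solution $P\in C([0,T];\mathbb R^{n\times n})$, and $$\bar u(t,x)=-M^{-1}(t,t)\big(B^\top(t)P(t)+S(t,t)\big)x$$ is a linear equilibrium control. It is the only one, up to null sets of times: if $u$ is any linear equilibrium control, then for almost every $t\in[0,T]$ one has $u(t,x)=\bar u(t,x)$ for all $x\in\mathbb R^n$. Moreover $J(t,x;u)=\langle P(t)x,x\rangle$ for every linear equilibrium control $u$ and all $(t,x)\in[0,T)\times\mathbb R^n$; that is, the matrix of the cost of any linear equilibrium is the symmetric solution of the Riccati equation. -/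

import Mathlib

open MeasureTheory Set Filter Topology Matrix

noncomputable section

/-- Entrywise integral of a matrix-valued function over the interval from `a` to `b`. -/
def matIntegral {k l : ℕ} (a b : ℝ) (F : ℝ → Matrix (Fin k) (Fin l) ℝ) :
    Matrix (Fin k) (Fin l) ℝ :=
  Matrix.of fun i j => ∫ s in a..b, F s i j

/-- Entrywise derivative on `[0,T]` (one-sided at the two end points). -/
def matDeriv {k l : ℕ} (T : ℝ) (F : ℝ → Matrix (Fin k) (Fin l) ℝ) (t : ℝ) :
    Matrix (Fin k) (Fin l) ℝ :=
  Matrix.of fun i j => derivWithin (fun r => F r i j) (Icc 0 T) t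

/-- Entrywise partial derivative with respect to the first variable, on `[0,T] × [0,T]`. -/
def matDeriv₁ {k l : ℕ} (T : ℝ) (F : ℝ → ℝ → Matrix (Fin k) (Fin l) ℝ) (t s : ℝ) :
    Matrix (Fin k) (Fin l) ℝ :=
  matDeriv T (fun r => F r s) t

/-- `F` is of class `C¹` on `[0,T]`. -/
def MatC1 {k l : ℕ} (T : ℝ) (F : ℝ → Matrix (Fin k) (Fin l) ℝ) : Prop :=
  ∀ i j, ContDiffOn ℝ 1 (fun t => F t i j) (Icc 0 T)

/-- `F` is of class `C¹` on `[0,T] × [0,T]`. -/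
def MatC1₂ {k l : ℕ} (T : ℝ) (F : ℝ → ℝ → Matrix (Fin k) (Fin l) ℝ) : Prop :=
  ∀ i j, ContDiffOn ℝ 1 (fun q : ℝ × ℝ => F q.1 q.2 i j) (Icc 0 T ×ˢ Icc 0 T)

/-- The data of a deterministic linear-quadratic control problem on `[0,T]` with state in `ℝⁿ` and
control in `ℝᵐ`. All functions only matter on `[0,T]`, respectively `[0,T] × [0,T]`. -/
structure LQProblem (n m : ℕ) where
  /-- the time horizon -/
  T : ℝ
  /-- the drift coefficient of the state -/
  A : ℝ → Matrix (Fin n) (Fin n) ℝ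
  /-- the coefficient of the control in the dynamics -/
  B : ℝ → Matrix (Fin n) (Fin m) ℝ
  /-- the running weight on the state -/
  Q : ℝ → ℝ → Matrix (Fin n) (Fin n) ℝ
  /-- the running cross weight -/
  S : ℝ → ℝ → Matrix (Fin m) (Fin n) ℝ
  /-- the running weight on the control -/
  M : ℝ → ℝ → Matrix (Fin m) (Fin m) ℝ
  /-- the terminal weight -/
  G : ℝ → Matrix (Fin n) (Fin n) ℝ

namespace LQProblem

variable {n m : ℕ} (p : LQProblem n m)

/-- `A` is integrable and `B` is essentially bounded on `[0,T]`. -/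
def H1 : Prop :=
  (∀ i j, IntegrableOn (fun t => p.A t i j) (Icc 0 p.T)) ∧
  (∀ i j, MemLp (fun t => p.B t i j) ⊤ (volume.restrict (Icc 0 p.T)))

/-- `M` is `C¹` with symmetric positive definite values. -/
def H2 : Prop :=
  MatC1₂ p.T p.M ∧ ∀ t ∈ Icc 0 p.T, ∀ s ∈ Icc 0 p.T, (p.M t s).PosDef

/-- `Q` and `G` are `C¹` with symmetric positive semi-definite values. -/
def H3 : Prop :=
  MatC1₂ p.T p.Q ∧ (∀ t ∈ Icc 0 p.T, ∀ s ∈ Icc 0 p.T, (p.Q t s).PosSemidef) ∧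
  MatC1 p.T p.G ∧ ∀ t ∈ Icc 0 p.T, (p.G t).PosSemidef

/-- `S` is `C¹`. -/
def H4 : Prop := MatC1₂ p.T p.S

/-- The monotonicity assumption. In the last clause `K` stands for `M_t(t,s)⁻¹ S_t(t,s)`: the
clause says that `Q_t - S_tᵀ M_t⁻¹ S_t` is positive semi-definite. If `M_t(t,s)` is invertible,
then `K` is unique; if it is singular, then the clause asks that `M_t K = S_t` be solvable, and
`S_tᵀ K = Kᵀ M_t K` does not depend on the solution `K`. -/
def H5 : Prop :=
  (∀ t ∈ Icc 0 p.T, (matDeriv p.T p.G t).PosSemidef) ∧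
  ∀ t s : ℝ, 0 ≤ t → t ≤ s → s ≤ p.T →
    (matDeriv₁ p.T p.Q t s).PosSemidef ∧
    (matDeriv₁ p.T p.M t s).PosSemidef ∧
    (p.Q t s - (p.S t s)ᵀ * (p.M t s)⁻¹ * p.S t s).PosSemidef ∧
    ∃ K : Matrix (Fin m) (Fin n) ℝ,
      matDeriv₁ p.T p.M t s * K = matDeriv₁ p.T p.S t s ∧
      (matDeriv₁ p.T p.Q t s - (matDeriv₁ p.T p.S t s)ᵀ * K).PosSemidef

/-- `X` is the state process on `[t,T]` driven by the square-integrable control `u` from the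
initial pair `(t,x)`, i.e. the (Caratheodory) solution of `X' = A X + B u`, `X(t) = x`. -/
def IsState (t : ℝ) (x : Fin n → ℝ) (u : ℝ → Fin m → ℝ) (X : ℝ → Fin n → ℝ) : Prop :=
  MemLp u 2 (volume.restrict (Icc t p.T)) ∧
  ContinuousOn X (Icc t p.T) ∧
  ∀ s ∈ Icc t p.T, X s = x + ∫ τ in t..s, (p.A τ *ᵥ X τ + p.B τ *ᵥ u τ)

/-- The cost, evaluated with the preferences of time `t`, of the control `u` and the state `X`. -/
def cost (t : ℝ) (X : ℝ → Fin n → ℝ) (u : ℝ → Fin m → ℝ) : ℝ :=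
  (∫ s in t..p.T, (X s ⬝ᵥ (p.Q t s *ᵥ X s) + 2 * (u s ⬝ᵥ (p.S t s *ᵥ X s))
      + u s ⬝ᵥ (p.M t s *ᵥ u s)))
    + X p.T ⬝ᵥ (p.G t *ᵥ X p.T)

/-- `X` is a closed-loop trajectory from `(t,x)` under the feedback `u`. -/
def IsTrajectory (u : ℝ → (Fin n → ℝ) → Fin m → ℝ) (t : ℝ) (x : Fin n → ℝ)
    (X : ℝ → Fin n → ℝ) : Prop :=
  p.IsState t x (fun s => u s (X s)) X

/-- The closed-loop trajectory from `(t,x)` under the feedback `u`, if there is one. -/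
def trajectory (u : ℝ → (Fin n → ℝ) → Fin m → ℝ) (t : ℝ) (x : Fin n → ℝ) : ℝ → Fin n → ℝ :=
  Classical.epsilon (p.IsTrajectory u t x)

/-- The cost functional `J(t,x;u)` of a feedback `u`. -/
def J (t : ℝ) (x : Fin n → ℝ) (u : ℝ → (Fin n → ℝ) → Fin m → ℝ) : ℝ :=
  p.cost t (p.trajectory u t x) (fun s => u s (p.trajectory u t x s))

/-- Admissible feedbacks: (Lebesgue) measurable on `[0,T] × ℝⁿ`, and from every initial pair there
is exactly one closed-loop trajectory with a square-integrable control. -/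
def IsAdmissible (u : ℝ → (Fin n → ℝ) → Fin m → ℝ) : Prop :=
  AEMeasurable (fun q : ℝ × (Fin n → ℝ) => u q.1 q.2)
    (volume.restrict (Icc 0 p.T ×ˢ (univ : Set (Fin n → ℝ)))) ∧
  ∀ t ∈ Ico 0 p.T, ∀ x : Fin n → ℝ,
    (∃ X, p.IsTrajectory u t x X) ∧
    ∀ X Y, p.IsTrajectory u t x X → p.IsTrajectory u t x Y → EqOn X Y (Icc t p.T)

/-- The perturbation of the feedback `u` which uses the constant control `v` on `[t,t+ε]`. (It is
only used from time `t` on.) -/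
def perturb (u : ℝ → (Fin n → ℝ) → Fin m → ℝ) (t ε : ℝ) (v : Fin m → ℝ) :
    ℝ → (Fin n → ℝ) → Fin m → ℝ :=
  fun s y => if s ≤ t + ε then v else u s y

/-- Equilibrium controls. The lower limit is taken in the extended reals. -/
def IsEquilibrium (u : ℝ → (Fin n → ℝ) → Fin m → ℝ) : Prop :=
  p.IsAdmissible u ∧
  ∀ t ∈ Ico 0 p.T, ∀ (x : Fin n → ℝ) (v : Fin m → ℝ),
    0 ≤ liminf (fun ε : ℝ => (((p.J t x (perturb u t ε v) - p.J t x u) / ε : ℝ) : EReal))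
      (𝓝[>] 0)

/-- Linear feedbacks `u(t,x) = ũ(t) x` with square-integrable gain `ũ`. -/
def IsLinearFeedback (u : ℝ → (Fin n → ℝ) → Fin m → ℝ) : Prop :=
  ∃ k : ℝ → Matrix (Fin m) (Fin n) ℝ,
    (∀ i j, MemLp (fun t => k t i j) 2 (volume.restrict (Icc 0 p.T))) ∧
    ∀ t ∈ Icc 0 p.T, ∀ x, u t x = k t *ᵥ x

/-- Linear equilibrium controls. -/
def IsLinearEquilibrium (u : ℝ → (Fin n → ℝ) → Fin m → ℝ) : Prop :=
  p.IsEquilibrium u ∧ p.IsLinearFeedback u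

/-- `Υ(s) = M(s,s)⁻¹ (B(s)ᵀ P(s) + S(s,s))`. -/
def Upsilon (P : ℝ → Matrix (Fin n) (Fin n) ℝ) (s : ℝ) : Matrix (Fin m) (Fin n) ℝ :=
  (p.M s s)⁻¹ * ((p.B s)ᵀ * P s + p.S s s)

/-- `Φ` is the state-transition matrix of the system `X' = F X` on `[0,T]`: `Φ(s,t)` solves
`∂Φ/∂s = F(s) Φ`, `Φ(t,t) = I`. -/
def IsTransition (F : ℝ → Matrix (Fin n) (Fin n) ℝ)
    (Φ : ℝ → ℝ → Matrix (Fin n) (Fin n) ℝ) : Prop :=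
  ∀ t ∈ Icc 0 p.T, ContinuousOn (fun s => Φ s t) (Icc 0 p.T) ∧
    ∀ s ∈ Icc 0 p.T, Φ s t = 1 + matIntegral t s (fun τ => F τ * Φ τ t)

/-- The nonlocal term `Q̄(t,t)` of the equilibrium Riccati equation. -/
def Qbar (P : ℝ → Matrix (Fin n) (Fin n) ℝ) (Φ : ℝ → ℝ → Matrix (Fin n) (Fin n) ℝ) (t : ℝ) :
    Matrix (Fin n) (Fin n) ℝ :=
  p.Q t t - (Φ p.T t)ᵀ * matDeriv p.T p.G t * Φ p.T t
    - matIntegral t p.T (fun s => (Φ s t)ᵀ * matDeriv₁ p.T p.Q t s * Φ s t)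
    - matIntegral t p.T (fun s => (Φ s t)ᵀ *
        ((p.Upsilon P s)ᵀ * matDeriv₁ p.T p.M t s * p.Upsilon P s
          - (p.Upsilon P s)ᵀ * matDeriv₁ p.T p.S t s
          - (matDeriv₁ p.T p.S t s)ᵀ * p.Upsilon P s) * Φ s t)

/-- `P` is a continuous symmetric solution on `[0,T]` of the equilibrium Riccati equation
`P' + Aᵀ P + P A + Q̄(t,t) - (P B + Sᵀ) M⁻¹ (Bᵀ P + S) = 0`, `P(T) = G(T)`, in integrated form. -/
def IsRiccatiSolution (P : ℝ → Matrix (Fin n) (Fin n) ℝ) : Prop :=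
  ContinuousOn P (Icc 0 p.T) ∧
  (∀ t ∈ Icc 0 p.T, (P t).IsSymm) ∧
  ∃ Φ : ℝ → ℝ → Matrix (Fin n) (Fin n) ℝ,
    p.IsTransition (fun τ => p.A τ - p.B τ * p.Upsilon P τ) Φ ∧
    ∀ t ∈ Icc 0 p.T,
      P t = p.G p.T + matIntegral t p.T (fun s =>
        (p.A s)ᵀ * P s + P s * p.A s + p.Qbar P Φ s
          - (P s * p.B s + (p.S s s)ᵀ) * (p.M s s)⁻¹ * ((p.B s)ᵀ * P s + p.S s s))

/-- The linear feedback `-M(t,t)⁻¹ (B(t)ᵀ P(t) + S(t,t)) x`. -/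
def riccatiFeedback (P : ℝ → Matrix (Fin n) (Fin n) ℝ) : ℝ → (Fin n → ℝ) → Fin m → ℝ :=
  fun t x => -(((p.M t t)⁻¹ * ((p.B t)ᵀ * P t + p.S t t)) *ᵥ x)

end LQProblem

end

/-! The cost of the linear feedback with gain `k`, from time `t` on and judged with the preferences
of time `r`, is a quadratic form with a matrix `C(r,t)`. The closed-loop transition matrix factors
as `Φ(s,t) = Z(s) W(t)` with `Z(T) = W(T) = 1`, so `C(r,t)` is a matrix conjugated by `W(t)` in
which `t` enters only as a limit of integration and `r` only as a parameter (`costMat`). For fixed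
`r` it solves a Lyapunov equation in `t`. On the diagonal `r = t` the equation acquires one more
term, `costDrift`, from differentiating the preferences (`costMat_diag_primitive`).

Riccati equation. For the gain `k = -Υ(P)` and `C(t,t) = P(t)` the diagonal equation is exactly the
equilibrium Riccati equation. Since Lyapunov equations have unique solutions for given terminal
values, the continuous symmetric Riccati solutions are precisely the continuous `P` that are the
cost matrix of their own feedback (`HasCost`, `hasCost_of_isRiccatiSolution`,
`isRiccatiSolution_of_hasCost`). The cost matrix at `t` depends only on the gain after `t`, in a
Lipschitz way on bounded gains (`exists_costMat_lipschitz`). With a truncated gain the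
self-consistency problem is therefore a Volterra equation, with exactly one solution. The truncation
is removed by an a priori bound (`exists_apriori_bound`): (H5) makes the weights and their time
derivatives nonnegative as quadratic forms, so `P ≥ 0`, and along the uncontrolled flow `P` is
bounded above by `G(T)` plus the integral of `Q(s,s)`.

Equilibria. Completing the square (`cost_eq`) shows that the cost of any control exceeds that of the
feedback by the integral of `costGap`, which is `⟨M w, w⟩` plus a term linear in the deviation `w`,
with coefficient `2 (M k + S + Bᵀ C) X`. For the Riccati feedback this coefficient vanishes as `s`
tends to `t`, for every `t`, and `M` is positive; so the feedback is an equilibrium. Conversely, at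
almost every `t` the difference quotients of a linear equilibrium converge to the gap at `s = t`
(`hasRightMean_costGap`). This limit is nonnegative for all `w`, so its linear part is zero, that
is, `k = -Υ(C)` almost everywhere (`ae_eq_upsilon`). The diagonal cost matrix is then
self-consistent as well, and uniqueness identifies it with `P`. -/

noncomputable section

/-! ### Calculus of absolutely continuous functions on an interval. -/

/-- `f` is absolutely continuous on `[a,b]`, with derivative `f'` almost everywhere. -/
structure IsPrimitiveOn (f f' : ℝ → ℝ) (a b : ℝ) : Prop where
  integrableOn : IntegrableOn f' (Icc a b)
  eq_add : ∀ s ∈ Icc a b, f s = f a + ∫ τ in a..s, f' τ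

theorem MeasureTheory.IntegrableOn.intervalIntegrable_of_mem {E : Type*}
    [NormedAddCommGroup E] {f : ℝ → E} {a b : ℝ}
    (hf : IntegrableOn f (Icc a b)) {s t : ℝ} (hs : s ∈ Icc a b) (ht : t ∈ Icc a b) :
    IntervalIntegrable f volume s t := by
  refine IntegrableOn.intervalIntegrable (hf.mono_set ?_)
  exact uIcc_subset_Icc hs ht

/-- Increments grow by a factor at most `K`. It is applied to the exponential, which is Lipschitz on
the bounded range of an absolutely continuous function. -/
theorem AbsolutelyContinuousOnInterval.lipschitz_comp {f g : ℝ → ℝ} {a b : ℝ} {K : NNReal}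
    {s : Set ℝ}
    (hf : AbsolutelyContinuousOnInterval f a b) (hg : LipschitzOnWith K g s)
    (hs : ∀ x ∈ uIcc a b, f x ∈ s) : AbsolutelyContinuousOnInterval (fun x => g (f x)) a b := by
  have h0 := (hf.const_mul (K : ℝ))
  unfold AbsolutelyContinuousOnInterval at h0 ⊢
  refine squeeze_zero' (Eventually.of_forall fun E => Finset.sum_nonneg fun _ _ => dist_nonneg)
    ?_ h0
  filter_upwards [mem_inf_of_right (mem_principal_self _)] with E hE
  refine Finset.sum_le_sum fun i hi => ?_
  have h1 := hE.1 i hi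
  have := hg.dist_le_mul _ (hs _ h1.1) _ (hs _ h1.2)
  refine this.trans (le_of_eq ?_)
  rw [Real.dist_eq, Real.dist_eq, ← mul_sub, abs_mul, NNReal.abs_eq]

namespace IsPrimitiveOn

variable {f f' g g' : ℝ → ℝ} {a b : ℝ}

theorem sub_eq (hf : IsPrimitiveOn f f' a b) {s t : ℝ} (hs : s ∈ Icc a b) (ht : t ∈ Icc a b) :
    ∫ τ in s..t, f' τ = f t - f s := by
  have ha : a ∈ Icc a b := ⟨le_rfl, hs.1.trans hs.2⟩
  rw [hf.eq_add s hs, hf.eq_add t ht,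
    ← intervalIntegral.integral_add_adjacent_intervals
      (hf.integrableOn.intervalIntegrable_of_mem ha hs)
      (hf.integrableOn.intervalIntegrable_of_mem hs ht)]
  ring

theorem of_sub (hf : IntegrableOn f' (Icc a b)) {c : ℝ} (hc : c ∈ Icc a b)
    (h : ∀ s ∈ Icc a b, f s = f c + ∫ τ in c..s, f' τ) : IsPrimitiveOn f f' a b := by
  have ha : a ∈ Icc a b := ⟨le_rfl, hc.1.trans hc.2⟩
  refine ⟨hf, fun s hs => ?_⟩
  rw [h s hs, h a ha, ← intervalIntegral.integral_add_adjacent_intervals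
      (hf.intervalIntegrable_of_mem hc ha) (hf.intervalIntegrable_of_mem ha hs)]
  ring

theorem of_backward (hf : IntegrableOn f' (Icc a b)) (hab : a ≤ b)
    (h : ∀ s ∈ Icc a b, f s = f b - ∫ τ in s..b, f' τ) : IsPrimitiveOn f f' a b :=
  of_sub hf (right_mem_Icc.2 hab) fun s hs => by
    rw [h s hs, intervalIntegral.integral_symm s b]; ring

theorem mono (hf : IsPrimitiveOn f f' a b) {s t : ℝ} (hs : s ∈ Icc a b) (ht : t ∈ Icc a b) :
    IsPrimitiveOn f f' s t :=
  ⟨hf.integrableOn.mono_set (Icc_subset_Icc hs.1 ht.2), fun r hr => by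
    rw [hf.sub_eq hs ⟨hs.1.trans hr.1, hr.2.trans ht.2⟩]; ring⟩

theorem absolutelyContinuous (hf : IsPrimitiveOn f f' a b) (hab : a ≤ b) :
    AbsolutelyContinuousOnInterval f a b := by
  have h1 := (hf.integrableOn.intervalIntegrable_of_mem (left_mem_Icc.2 hab)
    (right_mem_Icc.2 hab)).absolutelyContinuousOnInterval_intervalIntegral
      (c := a) left_mem_uIcc
  have h2 : AbsolutelyContinuousOnInterval (fun _ : ℝ => f a) a b := by
    simp [AbsolutelyContinuousOnInterval, tendsto_const_nhds]
  have h3 := h2.add h1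
  unfold AbsolutelyContinuousOnInterval at h3 ⊢
  refine h3.congr' ?_
  filter_upwards [mem_inf_of_right (mem_principal_self _)] with E hE
  refine Finset.sum_congr rfl fun i hi => ?_
  have h1 := hE.1 i hi
  rw [uIcc_of_le hab] at h1
  rw [hf.eq_add _ h1.1, hf.eq_add _ h1.2]
  rfl

theorem continuousOn (hf : IsPrimitiveOn f f' a b) : ContinuousOn f (Icc a b) := by
  rcases le_or_gt a b with hab | hab
  · simpa [uIcc_of_le hab] using (hf.absolutelyContinuous hab).continuousOn
  · simp [Icc_eq_empty_of_lt hab]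

theorem ae_hasDerivAt (hf : IsPrimitiveOn f f' a b) (hab : a ≤ b) :
    ∀ᵐ x, x ∈ Ioo a b → HasDerivAt f (f' x) x := by
  filter_upwards [(hf.integrableOn.intervalIntegrable_of_mem (left_mem_Icc.2 hab)
    (right_mem_Icc.2 hab)).ae_hasDerivAt_integral] with x hx hxab
  rw [uIcc_of_le hab] at hx
  have := (hx (Ioo_subset_Icc_self hxab) a (left_mem_Icc.2 hab)).const_add (f a)
  refine this.congr_of_eventuallyEq ?_
  filter_upwards [Ioo_mem_nhds hxab.1 hxab.2] with y hy
  exact hf.eq_add y (Ioo_subset_Icc_self hy)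

/-- By the fundamental theorem of calculus for absolutely continuous functions, a differentiation
rule that holds almost everywhere is enough. The product and exponential rules rest on this. -/
theorem of_absolutelyContinuous (hab : a ≤ b) (hf : AbsolutelyContinuousOnInterval f a b)
    (hd : ∀ᵐ x, x ∈ Ioo a b → HasDerivAt f (f' x) x) : IsPrimitiveOn f f' a b := by
  have hd' : ∀ᵐ x, x ∈ uIoc a b → deriv f x = f' x := by
    have h₂ : ∀ᵐ x : ℝ, x ≠ b := by simp [ae_iff, measure_singleton]
    filter_upwards [hd, h₂] with x hx hxb hxab
    rw [uIoc_of_le hab] at hxab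
    exact (hx ⟨hxab.1, lt_of_le_of_ne hxab.2 hxb⟩).deriv
  have hint := hf.intervalIntegrable_deriv.congr_ae ((ae_restrict_iff' measurableSet_uIoc).2 hd')
  refine ⟨(intervalIntegrable_iff_integrableOn_Icc_of_le hab).1 hint, fun s hs => ?_⟩
  have hs' : uIcc a s ⊆ uIcc a b := by
    rw [uIcc_of_le hab, uIcc_of_le hs.1]; exact Icc_subset_Icc_right hs.2
  have := (hf.mono hs').integral_deriv_eq_sub
  rw [← intervalIntegral.integral_congr_ae (f := deriv f), this]
  · ring
  · filter_upwards [hd'] with x hx hxs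
    rw [uIoc_of_le hs.1] at hxs
    rw [uIoc_of_le hab] at hx
    exact hx ⟨hxs.1, hxs.2.trans hs.2⟩

theorem congr (hf : IsPrimitiveOn f f' a b) (hfg : EqOn f g (Icc a b))
    (h' : ∀ᵐ x ∂volume.restrict (Icc a b), f' x = g' x) : IsPrimitiveOn g g' a b := by
  refine ⟨hf.integrableOn.congr h', fun s hs => ?_⟩
  rw [← hfg hs, ← hfg ⟨le_rfl, hs.1.trans hs.2⟩, hf.eq_add s hs]
  congr 1
  refine intervalIntegral.integral_congr_ae ?_
  filter_upwards [(ae_restrict_iff' measurableSet_Icc).1 h'] with x hx hxs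
  rw [uIoc_of_le hs.1] at hxs
  exact hx ⟨hxs.1.le, hxs.2.trans hs.2⟩

theorem const (c : ℝ) : IsPrimitiveOn (fun _ => c) (fun _ => 0) a b :=
  ⟨integrableOn_zero, fun s _ => by simp⟩

theorem add (hf : IsPrimitiveOn f f' a b) (hg : IsPrimitiveOn g g' a b) :
    IsPrimitiveOn (fun s => f s + g s) (fun s => f' s + g' s) a b := by
  refine ⟨hf.integrableOn.add hg.integrableOn, fun s hs => ?_⟩
  have ha : a ∈ Icc a b := ⟨le_rfl, hs.1.trans hs.2⟩
  rw [intervalIntegral.integral_add (hf.integrableOn.intervalIntegrable_of_mem ha hs)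
    (hg.integrableOn.intervalIntegrable_of_mem ha hs), hf.eq_add s hs, hg.eq_add s hs]
  ring

theorem const_mul (hf : IsPrimitiveOn f f' a b) (c : ℝ) :
    IsPrimitiveOn (fun s => c * f s) (fun s => c * f' s) a b := by
  refine ⟨hf.integrableOn.const_mul c, fun s hs => ?_⟩
  rw [intervalIntegral.integral_const_mul, hf.eq_add s hs]
  ring

theorem neg (hf : IsPrimitiveOn f f' a b) : IsPrimitiveOn (fun s => -f s) (fun s => -f' s) a b := by
  simpa using hf.const_mul (-1)

theorem sub (hf : IsPrimitiveOn f f' a b) (hg : IsPrimitiveOn g g' a b) :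
    IsPrimitiveOn (fun s => f s - g s) (fun s => f' s - g' s) a b := by
  simpa [sub_eq_add_neg] using hf.add hg.neg

theorem sum {ι : Type*} {F F' : ι → ℝ → ℝ} (u : Finset ι)
    (h : ∀ i ∈ u, IsPrimitiveOn (F i) (F' i) a b) :
    IsPrimitiveOn (fun s => ∑ i ∈ u, F i s) (fun s => ∑ i ∈ u, F' i s) a b := by
  classical
  induction u using Finset.induction_on with
  | empty => simpa using IsPrimitiveOn.const 0
  | insert i u hi ih =>
    simp only [Finset.sum_insert hi]
    exact (h i (by simp)).add (ih fun j hj => h j (by simp [hj]))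

theorem mul (hf : IsPrimitiveOn f f' a b) (hg : IsPrimitiveOn g g' a b) :
    IsPrimitiveOn (fun s => f s * g s) (fun s => f' s * g s + f s * g' s) a b := by
  rcases le_or_gt a b with hab | hab
  · refine of_absolutelyContinuous hab
      ((hf.absolutelyContinuous hab).mul (hg.absolutelyContinuous hab)) ?_
    filter_upwards [hf.ae_hasDerivAt hab, hg.ae_hasDerivAt hab] with x h1 h2 hx
    exact (h1 hx).mul (h2 hx)
  · exact ⟨by simp [Icc_eq_empty_of_lt hab], by simp [Icc_eq_empty_of_lt hab]⟩

theorem exp (hf : IsPrimitiveOn f f' a b) :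
    IsPrimitiveOn (fun s => Real.exp (f s)) (fun s => Real.exp (f s) * f' s) a b := by
  rcases le_or_gt a b with hab | hab
  · obtain ⟨C, hC⟩ := (hf.absolutelyContinuous hab).exists_bound
    obtain ⟨K, hK⟩ := (Real.contDiff_exp (n := 1)).contDiffOn.exists_lipschitzOnWith one_ne_zero
      (convex_Icc (-C) C) isCompact_Icc
    refine of_absolutelyContinuous hab
      ((hf.absolutelyContinuous hab).lipschitz_comp hK fun x hx => abs_le.1 (hC x hx)) ?_
    filter_upwards [hf.ae_hasDerivAt hab] with x h1 hx
    exact (h1 hx).exp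
  · exact ⟨by simp [Icc_eq_empty_of_lt hab], by simp [Icc_eq_empty_of_lt hab]⟩

theorem le_of_nonneg (hf : IsPrimitiveOn f f' a b) (hab : a ≤ b)
    (h' : ∀ᵐ x ∂volume.restrict (Icc a b), 0 ≤ f' x) : f a ≤ f b := by
  rw [hf.eq_add b (right_mem_Icc.2 hab)]
  linarith [intervalIntegral.integral_nonneg_of_ae_restrict hab h']

theorem of_integral (hf : IntegrableOn f' (Icc a b)) :
    IsPrimitiveOn (fun s => ∫ τ in a..s, f' τ) f' a b :=
  ⟨hf, fun s _ => by simp⟩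

theorem of_integral_right (hf : IntegrableOn f' (Icc a b)) (hab : a ≤ b) :
    IsPrimitiveOn (fun s => ∫ τ in s..b, f' τ) (fun s => -f' s) a b := by
  refine of_backward hf.neg hab fun s _ => by simp

end IsPrimitiveOn

/-! ### Gronwall's inequality and backward Volterra equations with integrable rates. -/

/-- Gronwall's inequality, backward in time and with an integrable rate. -/
theorem gronwall_backward {φ h : ℝ → ℝ} {a b c : ℝ} (hφ : ContinuousOn φ (Icc a b))
    (hh : IntegrableOn h (Icc a b)) (h0 : ∀ᵐ x ∂volume.restrict (Icc a b), 0 ≤ h x)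
    (hle : ∀ t ∈ Icc a b, φ t ≤ c + ∫ s in t..b, h s * φ s) :
    ∀ t ∈ Icc a b, φ t ≤ c * Real.exp (∫ s in t..b, h s) := by
  intro t ht
  have htb : t ≤ b := ht.2
  have hab : a ≤ b := ht.1.trans htb
  have hint : IntegrableOn (fun s => h s * φ s) (Icc a b) :=
    hh.mul_continuousOn hφ isCompact_Icc
  have hy := (IsPrimitiveOn.const (a := a) (b := b) c).add
    (IsPrimitiveOn.of_integral_right hint hab)
  -- With `y(t) = c + ∫ₜᵇ h φ` and `E(t) = exp(-∫ₜᵇ h)`, one has `(y E)' = h (y - φ) E ≥ 0`, so `y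
  -- E` is at most its value `c` at `b`.
  have hE := (IsPrimitiveOn.of_integral_right hh hab).neg.exp
  have hp := (hy.mul hE).mono ht (right_mem_Icc.2 hab)
  have hsub : Icc t b ⊆ Icc a b := Icc_subset_Icc_left ht.1
  have := hp.le_of_nonneg htb (by
    filter_upwards [ae_restrict_of_ae_restrict_of_subset hsub h0,
      ae_restrict_mem measurableSet_Icc] with s hs hs'
    have h1 := hle s (hsub hs')
    have h2 := mul_nonneg hs (sub_nonneg.2 h1)
    have h3 := mul_nonneg h2 (Real.exp_nonneg (-∫ τ in s..b, h τ))
    linarith)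
  simp only [intervalIntegral.integral_same, add_zero, neg_zero, Real.exp_zero, mul_one] at this
  rw [Real.exp_neg, ← div_eq_mul_inv, div_le_iff₀ (Real.exp_pos _)] at this
  exact (hle t ht).trans this

/-- Fixed points of backward Volterra operators with an integrable Lipschitz rate. -/
theorem exists_volterra_fixedPoint {E : Type*} [NormedAddCommGroup E] [NormedSpace ℝ E]
    [CompleteSpace E] {a b : ℝ} (hab : a ≤ b) {h : ℝ → ℝ} (hh : IntegrableOn h (Icc a b))
    (h0 : ∀ᵐ x ∂volume.restrict (Icc a b), 0 ≤ h x) (K : (ℝ → E) → ℝ → E)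
    (hc : ∀ f, ContinuousOn f (Icc a b) → ContinuousOn (K f) (Icc a b))
    (hK : ∀ f g, ContinuousOn f (Icc a b) → ContinuousOn g (Icc a b) → ∀ t ∈ Icc a b,
      ‖K f t - K g t‖ ≤ ∫ s in t..b, h s * ‖f s - g s‖) :
    ∃ f, ContinuousOn f (Icc a b) ∧ ∀ t ∈ Icc a b, K f t = f t := by
  have hI := IsPrimitiveOn.of_integral_right hh hab
  -- Since `w' = -2 h w`, the integral of `h w` over `[t,b]` is `(w t - w b) / 2 ≤ w t / 2`. In the
  -- supremum norm weighted by `1/w` the operator is thus a contraction with constant `1/2`, however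
  -- large `h` or the interval may be.
  set w : ℝ → ℝ := fun t => Real.exp (2 * ∫ s in t..b, h s) with hw
  have hwp : IsPrimitiveOn w (fun s => w s * (2 * -h s)) a b := (hI.const_mul 2).exp
  have hwpos : ∀ t, 0 < w t := fun t => Real.exp_pos _
  have hwc := hwp.continuousOn
  have hwi : ∀ t ∈ Icc a b, ∫ s in t..b, h s * w s ≤ 1 / 2 * w t := by
    intro t ht
    have h1 := hwp.sub_eq ht (right_mem_Icc.2 hab)
    have h2 : ∫ s in t..b, w s * (2 * -h s) = (-2) * ∫ s in t..b, h s * w s := by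
      rw [← intervalIntegral.integral_const_mul]
      congr 1; ext s; ring
    have h3 := hwpos b
    rw [h2] at h1
    linarith
  -- The unknown is divided by `w`, so that the plain supremum norm of `g` is the weighted norm of
  -- `ext g`.
  let ext : C(Icc a b, E) → ℝ → E := fun g t => w t • IccExtend hab g t
  have hext : ∀ g, ContinuousOn (ext g) (Icc a b) := fun g =>
    hwc.smul (g.continuous.Icc_extend' (h := hab)).continuousOn
  let Φ : C(Icc a b, E) → C(Icc a b, E) := fun g =>
    ⟨fun t => (w t)⁻¹ • K (ext g) t, by
      have := (hwc.inv₀ fun t _ => (hwpos t).ne').smul (hc _ (hext g))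
      exact continuousOn_iff_continuous_domRestrict.1 this⟩
  have hΦ : ContractingWith (1 / 2) Φ := by
    refine ⟨by norm_num, LipschitzWith.of_dist_le_mul fun f g => ?_⟩
    rw [ContinuousMap.dist_le (by positivity)]
    rintro ⟨t, ht⟩
    change dist ((w t)⁻¹ • K (ext f) t) ((w t)⁻¹ • K (ext g) t) ≤ _
    rw [dist_eq_norm, ← smul_sub, norm_smul, norm_inv, Real.norm_of_nonneg (hwpos t).le,
      inv_mul_le_iff₀ (hwpos t)]
    have hsub : Icc t b ⊆ Icc a b := Icc_subset_Icc_left ht.1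
    calc ‖K (ext f) t - K (ext g) t‖ ≤ ∫ s in t..b, h s * ‖ext f s - ext g s‖ :=
          hK _ _ (hext f) (hext g) t ht
      _ ≤ ∫ s in t..b, dist f g * (h s * w s) := by
          refine intervalIntegral.integral_mono_ae_restrict ht.2 ?_ ?_ ?_
          · exact (hh.mul_continuousOn ((hext f).sub (hext g)).norm
              isCompact_Icc).intervalIntegrable_of_mem ht (right_mem_Icc.2 hab)
          · exact ((hh.mul_continuousOn hwc isCompact_Icc).intervalIntegrable_of_mem ht
              (right_mem_Icc.2 hab)).const_mul _
          · filter_upwards [ae_restrict_of_ae_restrict_of_subset hsub h0,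
              ae_restrict_mem measurableSet_Icc] with s hs hs'
            have : ‖ext f s - ext g s‖ ≤ w s * dist f g := by
              change ‖w s • _ - w s • _‖ ≤ _
              rw [← smul_sub, norm_smul, Real.norm_of_nonneg (hwpos s).le]
              refine mul_le_mul_of_nonneg_left ?_ (hwpos s).le
              rw [← dist_eq_norm, IccExtend_of_mem _ _ (hsub hs'), IccExtend_of_mem _ _ (hsub hs')]
              exact ContinuousMap.dist_apply_le_dist _
            calc _ ≤ h s * (w s * dist f g) := mul_le_mul_of_nonneg_left this hs
              _ = _ := by ring
      _ = dist f g * ∫ s in t..b, h s * w s := intervalIntegral.integral_const_mul _ _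
      _ ≤ dist f g * (1 / 2 * w t) := mul_le_mul_of_nonneg_left (hwi t ht) dist_nonneg
      _ = _ := by simp only [NNReal.coe_div, NNReal.coe_one, NNReal.coe_ofNat]; ring
  have hfix := hΦ.fixedPoint_isFixedPt
  set g := ContractingWith.fixedPoint Φ hΦ
  refine ⟨ext g, hext g, fun t ht => ?_⟩
  have h1 : Φ g ⟨t, ht⟩ = g ⟨t, ht⟩ := by rw [hfix]
  change (w t)⁻¹ • K (ext g) t = _ at h1
  change _ = w t • _
  rw [IccExtend_of_mem _ _ ht, ← h1, smul_inv_smul₀ (hwpos t).ne']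

/-! ### The entrywise sum norm of matrices, which is submultiplicative. -/

/-- The sum of the absolute values of the entries of a matrix. -/
def Matrix.absSum {ι κ : Type*} [Fintype ι] [Fintype κ] (A : Matrix ι κ ℝ) : ℝ :=
  ∑ i, ∑ j, |A i j|

namespace Matrix

variable {ι κ l : Type*} [Fintype ι] [Fintype κ] [Fintype l]

theorem absSum_nonneg (A : Matrix ι κ ℝ) : 0 ≤ A.absSum :=
  Finset.sum_nonneg fun _ _ => Finset.sum_nonneg fun _ _ => abs_nonneg _

theorem abs_le_absSum (A : Matrix ι κ ℝ) (i : ι) (j : κ) : |A i j| ≤ A.absSum :=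
  (Finset.single_le_sum (f := fun j => |A i j|) (fun _ _ => abs_nonneg _) (Finset.mem_univ j)).trans
    (Finset.single_le_sum (f := fun i => ∑ j, |A i j|)
      (fun _ _ => Finset.sum_nonneg fun _ _ => abs_nonneg _) (Finset.mem_univ i))

theorem absSum_le {A : Matrix ι κ ℝ} {c : ℝ} (h : ∀ i j, |A i j| ≤ c) :
    A.absSum ≤ Fintype.card ι * (Fintype.card κ * c) := by
  refine (Finset.sum_le_sum fun i _ => Finset.sum_le_sum fun j _ => h i j).trans ?_
  simp

@[simp] theorem absSum_zero : (0 : Matrix ι κ ℝ).absSum = 0 := by simp [absSum]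

theorem eq_zero_of_absSum_le {A : Matrix ι κ ℝ} (h : A.absSum ≤ 0) : A = 0 := by
  ext i j
  simpa using (A.abs_le_absSum i j).trans h

@[simp] theorem absSum_neg (A : Matrix ι κ ℝ) : (-A).absSum = A.absSum := by simp [absSum]

@[simp] theorem absSum_transpose (A : Matrix ι κ ℝ) : Aᵀ.absSum = A.absSum := by
  simp only [absSum, transpose_apply]; exact Finset.sum_comm

theorem absSum_add_le (A B : Matrix ι κ ℝ) : (A + B).absSum ≤ A.absSum + B.absSum := by
  simp only [absSum, ← Finset.sum_add_distrib]
  exact Finset.sum_le_sum fun i _ => Finset.sum_le_sum fun j _ => abs_add_le _ _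

theorem absSum_sub_le (A B : Matrix ι κ ℝ) : (A - B).absSum ≤ A.absSum + B.absSum := by
  simpa [sub_eq_add_neg] using absSum_add_le A (-B)

theorem absSum_sub_comm (A B : Matrix ι κ ℝ) : (A - B).absSum = (B - A).absSum := by
  rw [← absSum_neg, neg_sub]

theorem absSum_smul (c : ℝ) (A : Matrix ι κ ℝ) : (c • A).absSum = |c| * A.absSum := by
  simp [absSum, abs_mul, Finset.mul_sum]

theorem absSum_mul_le (A : Matrix ι κ ℝ) (B : Matrix κ l ℝ) :
    (A * B).absSum ≤ A.absSum * B.absSum := by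
  calc (A * B).absSum ≤ ∑ i, ∑ j, ∑ k, |A i k| * |B k j| :=
        Finset.sum_le_sum fun i _ => Finset.sum_le_sum fun j _ => by
          rw [mul_apply]
          refine (Finset.abs_sum_le_sum_abs _ _).trans (le_of_eq ?_)
          simp [abs_mul]
    _ = ∑ i, ∑ k, |A i k| * ∑ j, |B k j| := by
        refine Finset.sum_congr rfl fun i _ => ?_
        rw [Finset.sum_comm]
        simp [Finset.mul_sum]
    _ ≤ ∑ i, ∑ k, |A i k| * B.absSum := by
        refine Finset.sum_le_sum fun i _ => Finset.sum_le_sum fun k _ => ?_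
        refine mul_le_mul_of_nonneg_left ?_ (abs_nonneg _)
        exact Finset.single_le_sum (f := fun k => ∑ j, |B k j|)
          (fun _ _ => Finset.sum_nonneg fun _ _ => abs_nonneg _) (Finset.mem_univ k)
    _ = _ := by simp only [absSum, Finset.sum_mul]

theorem absSum_one [DecidableEq ι] : (1 : Matrix ι ι ℝ).absSum = Fintype.card ι := by
  simp [absSum, one_apply, apply_ite abs]

theorem abs_dotProduct_mulVec_le (A : Matrix ι κ ℝ) (x : ι → ℝ) (y : κ → ℝ) :
    |x ⬝ᵥ (A *ᵥ y)| ≤ A.absSum * (‖x‖ * ‖y‖) := by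
  simp only [dotProduct, mulVec, absSum, Finset.sum_mul, Finset.mul_sum]
  refine (Finset.abs_sum_le_sum_abs _ _).trans (Finset.sum_le_sum fun i _ => ?_)
  refine (Finset.abs_sum_le_sum_abs _ _).trans (Finset.sum_le_sum fun j _ => ?_)
  have h1 := norm_le_pi_norm x i
  have h2 := norm_le_pi_norm y j
  rw [Real.norm_eq_abs] at h1 h2
  rw [abs_mul, abs_mul, mul_left_comm]
  gcongr

theorem absSum_sandwich_sub_le (U U' : Matrix κ ι ℝ) (R : Matrix κ κ ℝ) :
    (Uᵀ * R * U - U'ᵀ * R * U').absSum ≤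
      R.absSum * (U.absSum + U'.absSum) * (U - U').absSum := by
  have h : Uᵀ * R * U - U'ᵀ * R * U' = (U - U')ᵀ * R * U + U'ᵀ * R * (U - U') := by
    rw [transpose_sub]
    simp only [Matrix.sub_mul, Matrix.mul_sub]
    abel
  rw [h]
  have h1 := absSum_mul_le ((U - U')ᵀ * R) U
  have h2 := absSum_mul_le (U'ᵀ * R) (U - U')
  have h3 := mul_le_mul_of_nonneg_right (absSum_mul_le (U - U')ᵀ R) U.absSum_nonneg
  have h4 := mul_le_mul_of_nonneg_right (absSum_mul_le U'ᵀ R) (U - U').absSum_nonneg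
  rw [absSum_transpose] at h3 h4
  have := absSum_add_le ((U - U')ᵀ * R * U) (U'ᵀ * R * (U - U'))
  linarith

end Matrix

theorem ContinuousOn.matrix_absSum {ι κ : Type*} [Fintype ι] [Fintype κ] {X : Type*}
    [TopologicalSpace X] {F : X → Matrix ι κ ℝ} {u : Set X} (h : ContinuousOn F u) :
    ContinuousOn (fun s => (F s).absSum) u := by
  refine continuousOn_finsetSum _ fun i _ => continuousOn_finsetSum _ fun j _ => ?_
  exact (((continuous_id.matrix_elem i j).comp_continuousOn h)).abs

theorem matrix_integrableOn_absSum {ι κ : Type*} [Fintype ι] [Fintype κ]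
    {F : ℝ → Matrix ι κ ℝ} {u : Set ℝ} (h : ∀ i j, IntegrableOn (fun s => F s i j) u) :
    IntegrableOn (fun s => (F s).absSum) u :=
  integrable_finsetSum _ fun i _ => integrable_finsetSum _ fun j _ => (h i j).abs

theorem absSum_integral_le {ι κ : Type*} [Fintype ι] [Fintype κ] {F : ℝ → Matrix ι κ ℝ} {a b : ℝ}
    (hab : a ≤ b) (hF : ∀ i j, IntervalIntegrable (fun s => F s i j) volume a b) :
    (Matrix.of fun i j => ∫ s in a..b, F s i j).absSum ≤ ∫ s in a..b, (F s).absSum :=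
  calc _ ≤ ∑ i, ∑ j, ∫ s in a..b, |F s i j| :=
        Finset.sum_le_sum fun i _ => Finset.sum_le_sum fun j _ =>
          intervalIntegral.abs_integral_le_integral_abs hab
    _ = ∫ s in a..b, (F s).absSum := by
        simp only [absSum]
        rw [intervalIntegral.integral_finsetSum fun i _ => ?_]
        · refine Finset.sum_congr rfl fun i _ => ?_
          rw [intervalIntegral.integral_finsetSum fun j _ => (hF i j).abs]
        · have := IntervalIntegrable.sum Finset.univ fun j _ => (hF i j).abs
          simpa [Finset.sum_fn] using this

/-! ### Absolutely continuous matrix and vector functions. -/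

/-- Entrywise version of `IsPrimitiveOn` for matrices. -/
def MatPrimitiveOn {ι κ : Type*} (F F' : ℝ → Matrix ι κ ℝ) (a b : ℝ) : Prop :=
  ∀ i j, IsPrimitiveOn (fun s => F s i j) (fun s => F' s i j) a b

/-- Entrywise version of `IsPrimitiveOn` for vectors. -/
def VecPrimitiveOn {ι : Type*} (X X' : ℝ → ι → ℝ) (a b : ℝ) : Prop :=
  ∀ i, IsPrimitiveOn (fun s => X s i) (fun s => X' s i) a b

section Primitives

variable {ι κ l : Type*} {a b : ℝ}

namespace MatPrimitiveOn

variable {F F' H H' : ℝ → Matrix ι κ ℝ}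

theorem mono (h : MatPrimitiveOn F F' a b) {s t : ℝ} (hs : s ∈ Icc a b) (ht : t ∈ Icc a b) :
    MatPrimitiveOn F F' s t := fun i j => (h i j).mono hs ht

theorem continuousOn (h : MatPrimitiveOn F F' a b) : ContinuousOn F (Icc a b) :=
  continuousOn_pi.2 fun i => continuousOn_pi.2 fun j => (h i j).continuousOn

theorem congr (h : MatPrimitiveOn F F' a b) (h1 : EqOn F H (Icc a b))
    (h2 : ∀ᵐ x ∂volume.restrict (Icc a b), F' x = H' x) : MatPrimitiveOn H H' a b :=
  fun i j => (h i j).congr (fun s hs => by simp only [h1 hs]) (h2.mono fun s hs => by rw [hs])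

theorem add (h : MatPrimitiveOn F F' a b) (h' : MatPrimitiveOn H H' a b) :
    MatPrimitiveOn (fun s => F s + H s) (fun s => F' s + H' s) a b :=
  fun i j => (h i j).add (h' i j)

theorem sub (h : MatPrimitiveOn F F' a b) (h' : MatPrimitiveOn H H' a b) :
    MatPrimitiveOn (fun s => F s - H s) (fun s => F' s - H' s) a b :=
  fun i j => (h i j).sub (h' i j)

theorem transpose (h : MatPrimitiveOn F F' a b) :
    MatPrimitiveOn (fun s => (F s)ᵀ) (fun s => (F' s)ᵀ) a b :=
  fun i j => h j i

theorem const (C : Matrix ι κ ℝ) : MatPrimitiveOn (fun _ => C) (fun _ => 0) a b :=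
  fun i j => IsPrimitiveOn.const (C i j)

theorem mul [Fintype κ] {K K' : ℝ → Matrix κ l ℝ} (h : MatPrimitiveOn F F' a b)
    (h' : MatPrimitiveOn K K' a b) :
    MatPrimitiveOn (fun s => F s * K s) (fun s => F' s * K s + F s * K' s) a b := by
  intro i j
  have := IsPrimitiveOn.sum Finset.univ fun k _ => (h i k).mul (h' k j)
  refine this.congr (fun s _ => (mul_apply ..).symm) (Eventually.of_forall fun s => ?_)
  simp [mul_apply, Finset.sum_add_distrib]

theorem eq_of_zero (h : MatPrimitiveOn F F' a b)
    (h0 : ∀ᵐ x ∂volume.restrict (Icc a b), F' x = 0) {s t : ℝ} (hs : s ∈ Icc a b)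
    (ht : t ∈ Icc a b) : F s = F t := by
  ext i j
  have := (h.congr (fun _ _ => rfl) (H' := fun _ => 0) h0 i j).sub_eq hs ht
  simp only [Matrix.zero_apply, intervalIntegral.integral_zero] at this
  linarith

theorem mulVec [Fintype κ] {X X' : ℝ → κ → ℝ} (h : MatPrimitiveOn F F' a b)
    (h' : VecPrimitiveOn X X' a b) :
    VecPrimitiveOn (fun s => F s *ᵥ X s) (fun s => F' s *ᵥ X s + F s *ᵥ X' s) a b := by
  intro i
  have := IsPrimitiveOn.sum Finset.univ fun k _ => (h i k).mul (h' k)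
  refine this.congr (fun s _ => rfl) (Eventually.of_forall fun s => ?_)
  simp [Matrix.mulVec, dotProduct, Finset.sum_add_distrib]

/-- Gronwall estimate for linear matrix differential equations with integrable coefficients. -/
theorem absSum_le [Fintype ι] [Fintype κ] {F : ℝ → Matrix ι ι ℝ}
    {Z H : ℝ → Matrix ι κ ℝ} {h : ℝ → ℝ}
    (hZ : MatPrimitiveOn Z (fun s => F s * Z s + H s) a b) (hh : IntegrableOn h (Icc a b))
    (hF : ∀ᵐ s ∂volume.restrict (Icc a b), (F s).absSum ≤ h s)
    (hH : ∀ i j, IntegrableOn (fun s => H s i j) (Icc a b)) :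
    ∀ t ∈ Icc a b, (Z t).absSum ≤
      ((Z b).absSum + ∫ s in t..b, (H s).absSum) * Real.exp (∫ s in t..b, h s) := by
  intro t ht
  have hb : b ∈ Icc a b := ⟨ht.1.trans ht.2, le_rfl⟩
  have hsub : Icc t b ⊆ Icc a b := Icc_subset_Icc_left ht.1
  have hHi := matrix_integrableOn_absSum hH
  have hZc := hZ.continuousOn
  refine gronwall_backward (φ := fun t => (Z t).absSum) (hZc.mono hsub).matrix_absSum
    (hh.mono_set hsub) ?_ ?_ t ⟨le_rfl, ht.2⟩
  · filter_upwards [ae_restrict_of_ae_restrict_of_subset hsub hF] with s hs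
    exact (absSum_nonneg _).trans hs
  intro r hr
  have hr' := hsub hr
  have hsub2 : Icc r b ⊆ Icc a b := Icc_subset_Icc_left hr'.1
  have hhZ := (hh.mul_continuousOn hZc.matrix_absSum isCompact_Icc).intervalIntegrable_of_mem hr' hb
  have h1 : (Z r).absSum ≤ (Z b).absSum + ∫ s in r..b, (h s * (Z s).absSum + (H s).absSum) := by
    have hd : Z r = Z b - (Matrix.of fun i j => ∫ s in r..b, (F s * Z s + H s) i j) := by
      ext i j
      have := (hZ i j).sub_eq hr' hb
      simp only [Matrix.sub_apply, of_apply, this]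
      ring
    rw [hd]
    refine (absSum_sub_le _ _).trans (add_le_add_right ?_ _)
    calc _ ≤ ∫ s in r..b, (F s * Z s + H s).absSum := absSum_integral_le hr.2 fun i j =>
          (hZ i j).integrableOn.intervalIntegrable_of_mem hr' hb
      _ ≤ _ := by
          refine intervalIntegral.integral_mono_ae_restrict hr.2
            ((matrix_integrableOn_absSum fun i j => (hZ i j).integrableOn).intervalIntegrable_of_mem
              hr' hb) (hhZ.add (hHi.intervalIntegrable_of_mem hr' hb)) ?_
          filter_upwards [ae_restrict_of_ae_restrict_of_subset hsub2 hF] with s hs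
          refine (absSum_add_le _ _).trans (add_le_add_left ((absSum_mul_le _ _).trans ?_) _)
          exact mul_le_mul_of_nonneg_right hs (absSum_nonneg _)
  rw [intervalIntegral.integral_add hhZ (hHi.intervalIntegrable_of_mem hr' hb)] at h1
  have h2 : ∫ s in r..b, (H s).absSum ≤ ∫ s in t..b, (H s).absSum := by
    rw [← intervalIntegral.integral_add_adjacent_intervals
      (hHi.intervalIntegrable_of_mem ht hr') (hHi.intervalIntegrable_of_mem hr' hb)]
    have := intervalIntegral.integral_nonneg (μ := volume) (f := fun s => (H s).absSum) hr.1
      fun s _ => absSum_nonneg _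
    linarith
  linarith

end MatPrimitiveOn

namespace VecPrimitiveOn

variable {X X' Y Y' : ℝ → ι → ℝ}

theorem mono (h : VecPrimitiveOn X X' a b) {s t : ℝ} (hs : s ∈ Icc a b) (ht : t ∈ Icc a b) :
    VecPrimitiveOn X X' s t := fun i => (h i).mono hs ht

theorem continuousOn (h : VecPrimitiveOn X X' a b) : ContinuousOn X (Icc a b) :=
  continuousOn_pi.2 fun i => (h i).continuousOn

theorem congr (h : VecPrimitiveOn X X' a b) (h1 : EqOn X Y (Icc a b))
    (h2 : ∀ᵐ x ∂volume.restrict (Icc a b), X' x = Y' x) : VecPrimitiveOn Y Y' a b :=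
  fun i => (h i).congr (fun s hs => by simp only [h1 hs]) (h2.mono fun s hs => by rw [hs])

theorem add (h : VecPrimitiveOn X X' a b) (h' : VecPrimitiveOn Y Y' a b) :
    VecPrimitiveOn (fun s => X s + Y s) (fun s => X' s + Y' s) a b :=
  fun i => (h i).add (h' i)

theorem sub (h : VecPrimitiveOn X X' a b) (h' : VecPrimitiveOn Y Y' a b) :
    VecPrimitiveOn (fun s => X s - Y s) (fun s => X' s - Y' s) a b :=
  fun i => (h i).sub (h' i)

theorem const (x : ι → ℝ) : VecPrimitiveOn (fun _ => x) (fun _ => 0) a b :=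
  fun i => IsPrimitiveOn.const (x i)

theorem dotProduct [Fintype ι] (h : VecPrimitiveOn X X' a b) (h' : VecPrimitiveOn Y Y' a b) :
    IsPrimitiveOn (fun s => X s ⬝ᵥ Y s) (fun s => X' s ⬝ᵥ Y s + X s ⬝ᵥ Y' s) a b := by
  have := IsPrimitiveOn.sum Finset.univ fun k _ => (h k).mul (h' k)
  refine this.congr (fun s _ => rfl) (Eventually.of_forall fun s => ?_)
  simp [_root_.dotProduct, Finset.sum_add_distrib]

theorem eq_of_zero (h : VecPrimitiveOn X X' a b)
    (h0 : ∀ᵐ x ∂volume.restrict (Icc a b), X' x = 0) {s t : ℝ} (hs : s ∈ Icc a b)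
    (ht : t ∈ Icc a b) : X s = X t := by
  ext i
  have := (h.congr (fun _ _ => rfl) (Y' := fun _ => 0) h0 i).sub_eq hs ht
  simp only [Pi.zero_apply, intervalIntegral.integral_zero] at this
  linarith

end VecPrimitiveOn

end Primitives

/-! ### Fundamental matrices of linear systems with integrable coefficients. -/

/-- `Z` and `W` solve `Z' = F Z` and `W' = -W F` on `[a,b]` and equal `1` at `b`, so that
`Z s * W t` is the state-transition matrix of `X' = F X`. -/
structure IsFundamental {ι : Type*} [Fintype ι] [DecidableEq ι] (F Z W : ℝ → Matrix ι ι ℝ)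
    (a b : ℝ) : Prop where
  left : MatPrimitiveOn Z (fun s => F s * Z s) a b
  right : MatPrimitiveOn W (fun s => -(W s * F s)) a b
  left_end : Z b = 1
  right_end : W b = 1

theorem matrix_integrableOn_mul_continuousOn {ι κ l : Type*} [Fintype κ] {a b : ℝ}
    {F : ℝ → Matrix ι κ ℝ}
    {H : ℝ → Matrix κ l ℝ} (hF : ∀ i j, IntegrableOn (fun s => F s i j) (Icc a b))
    (hH : ContinuousOn H (Icc a b)) (i : ι) (j : l) :
    IntegrableOn (fun s => (F s * H s) i j) (Icc a b) := by
  simp only [mul_apply]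
  refine integrable_finsetSum _ fun k _ => (hF i k).mul_continuousOn ?_ isCompact_Icc
  exact (continuous_id.matrix_elem k j).comp_continuousOn hH

theorem matrix_integrableOn_continuousOn_mul {ι κ l : Type*} [Fintype κ] {a b : ℝ}
    {F : ℝ → Matrix κ ι ℝ}
    {H : ℝ → Matrix l κ ℝ} (hF : ∀ i j, IntegrableOn (fun s => F s i j) (Icc a b))
    (hH : ContinuousOn H (Icc a b)) (i : l) (j : ι) :
    IntegrableOn (fun s => (H s * F s) i j) (Icc a b) := by
  simp only [mul_apply]
  refine integrable_finsetSum _ fun k _ => (hF k j).continuousOn_mul ?_ isCompact_Icc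
  exact (continuous_id.matrix_elem i k).comp_continuousOn hH

section Fundamental

variable {ι κ : Type*} [Fintype ι] [DecidableEq ι] {a b : ℝ}

theorem exists_matPrimitiveOn_mul (hab : a ≤ b) {F : ℝ → Matrix ι ι ℝ}
    (hF : ∀ i j, IntegrableOn (fun s => F s i j) (Icc a b)) :
    ∃ Z, MatPrimitiveOn Z (fun s => F s * Z s) a b ∧ Z b = 1 := by
  have hb : b ∈ Icc a b := right_mem_Icc.2 hab
  have hcont : ∀ f : ℝ → ι → ι → ℝ, ContinuousOn f (Icc a b) → ∀ i j,
      IntegrableOn (fun s => (F s * Matrix.of (f s)) i j) (Icc a b) := fun f hf i j =>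
    matrix_integrableOn_mul_continuousOn (H := fun s => Matrix.of (f s)) hF hf i j
  obtain ⟨f, hf, hfix⟩ := exists_volterra_fixedPoint (E := ι → ι → ℝ) hab
    (matrix_integrableOn_absSum hF) (Eventually.of_forall fun s => absSum_nonneg _)
    (fun f t i j => (1 : Matrix ι ι ℝ) i j - ∫ s in t..b, (F s * Matrix.of (f s)) i j)
    (fun f hf => continuousOn_pi.2 fun i => continuousOn_pi.2 fun j =>
      continuousOn_const.sub (IsPrimitiveOn.of_integral_right (hcont f hf i j) hab).continuousOn)
    (fun f g hf hg t ht => by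
      refine (pi_norm_le_iff_of_nonneg ?_).2 fun i => (pi_norm_le_iff_of_nonneg ?_).2 fun j => ?_
      · exact intervalIntegral.integral_nonneg ht.2 fun s _ =>
          mul_nonneg (absSum_nonneg _) (norm_nonneg _)
      · exact intervalIntegral.integral_nonneg ht.2 fun s _ =>
          mul_nonneg (absSum_nonneg _) (norm_nonneg _)
      have hfi := (hcont f hf i j).intervalIntegrable_of_mem ht hb
      have hgi := (hcont g hg i j).intervalIntegrable_of_mem ht hb
      simp only [Pi.sub_apply, sub_sub_sub_cancel_left]
      rw [← intervalIntegral.integral_sub hgi hfi, Real.norm_eq_abs]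
      refine (intervalIntegral.abs_integral_le_integral_abs ht.2).trans ?_
      refine intervalIntegral.integral_mono_on ht.2 (hgi.sub hfi).abs ?_ fun s _ => ?_
      · exact ((matrix_integrableOn_absSum hF).mul_continuousOn (hf.sub hg).norm
          isCompact_Icc).intervalIntegrable_of_mem ht hb
      · rw [mul_apply, mul_apply, ← Finset.sum_sub_distrib]
        refine (Finset.abs_sum_le_sum_abs _ _).trans ?_
        have h1 : ∑ k, |F s i k| ≤ (F s).absSum :=
          Finset.single_le_sum (f := fun i => ∑ k, |F s i k|)
            (fun _ _ => Finset.sum_nonneg fun _ _ => abs_nonneg _) (Finset.mem_univ i)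
        refine le_trans ?_ (mul_le_mul_of_nonneg_right h1 (norm_nonneg _))
        rw [Finset.sum_mul]
        refine Finset.sum_le_sum fun k _ => ?_
        rw [← mul_sub, abs_mul]
        refine mul_le_mul_of_nonneg_left ?_ (abs_nonneg _)
        rw [abs_sub_comm]
        exact (norm_le_pi_norm ((f s - g s) k) j).trans (norm_le_pi_norm (f s - g s) k))
  refine ⟨fun s => Matrix.of (f s), fun i j => IsPrimitiveOn.of_backward (hcont f hf i j) hab
    fun s hs => ?_, ?_⟩
  · simp only [of_apply]
    rw [← hfix s hs, ← hfix b hb]; simp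
  · ext i j
    simp only [of_apply]
    rw [← hfix b hb]; simp

/-- The matrix `W` is the transpose of the solution of the adjoint system, whose coefficient is
`-Fᵀ`. -/
theorem exists_isFundamental (hab : a ≤ b) {F : ℝ → Matrix ι ι ℝ}
    (hF : ∀ i j, IntegrableOn (fun s => F s i j) (Icc a b)) :
    ∃ Z W, IsFundamental F Z W a b := by
  obtain ⟨Z, hZ, hZb⟩ := exists_matPrimitiveOn_mul hab hF
  obtain ⟨V, hV, hVb⟩ := exists_matPrimitiveOn_mul hab (F := fun s => -(F s)ᵀ)
    (fun i j => (hF j i).neg)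
  refine ⟨Z, fun s => (V s)ᵀ, hZ, ?_, hZb, by rw [hVb, transpose_one]⟩
  refine hV.transpose.congr (fun s _ => rfl) (Eventually.of_forall fun s => ?_)
  simp

namespace IsFundamental

variable {F Z W : ℝ → Matrix ι ι ℝ}

theorem congr (h : IsFundamental F Z W a b) {F' : ℝ → Matrix ι ι ℝ}
    (hF : ∀ᵐ s ∂volume.restrict (Icc a b), F s = F' s) : IsFundamental F' Z W a b :=
  ⟨h.left.congr (fun _ _ => rfl) (hF.mono fun s hs => by rw [hs]),
    h.right.congr (fun _ _ => rfl) (hF.mono fun s hs => by rw [hs]), h.left_end, h.right_end⟩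

/-- The product `W Z` has derivative zero and equals the identity at `b`. -/
theorem mul_eq_one (h : IsFundamental F Z W a b) {t : ℝ} (ht : t ∈ Icc a b) : W t * Z t = 1 := by
  have := (h.right.mul h.left).eq_of_zero (Eventually.of_forall fun s => by
    rw [Matrix.neg_mul, Matrix.mul_assoc, neg_add_cancel]) ht ⟨ht.1.trans ht.2, le_rfl⟩
  rw [this, h.left_end, h.right_end, one_mul]

theorem mul_eq_one' (h : IsFundamental F Z W a b) {t : ℝ} (ht : t ∈ Icc a b) : Z t * W t = 1 :=
  mul_eq_one_comm.1 (h.mul_eq_one ht)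

theorem transpose_mul_eq_one' (h : IsFundamental F Z W a b) {t : ℝ} (ht : t ∈ Icc a b) :
    (W t)ᵀ * (Z t)ᵀ = 1 := by rw [← transpose_mul, h.mul_eq_one' ht, transpose_one]

/-- Solutions of `X' = F X` are given by the state-transition matrix. -/
theorem vec_eq (h : IsFundamental F Z W a b) {t r : ℝ} (ht : t ∈ Icc a b) (hr : r ≤ b)
    {X : ℝ → ι → ℝ} (hX : VecPrimitiveOn X (fun s => F s *ᵥ X s) t r) {s : ℝ} (hs : s ∈ Icc t r) :
    X s = (Z s * W t) *ᵥ X t := by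
  have hr' : r ∈ Icc a b := ⟨ht.1.trans (hs.1.trans hs.2), hr⟩
  have := ((h.right.mono ht hr').mulVec hX).eq_of_zero (Eventually.of_forall fun s => by
    rw [mulVec_mulVec, neg_mulVec, neg_add_cancel]) hs ⟨le_rfl, hs.1.trans hs.2⟩
  rw [← mulVec_mulVec, ← this, mulVec_mulVec,
    h.mul_eq_one' ⟨ht.1.trans hs.1, hs.2.trans hr⟩, one_mulVec]

/-- Solutions of `Y' = F Y` are given by the state-transition matrix. -/
theorem mat_eq (h : IsFundamental F Z W a b) {t : ℝ} (ht : t ∈ Icc a b) {Y : ℝ → Matrix ι κ ℝ}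
    (hY : MatPrimitiveOn Y (fun s => F s * Y s) a b) {s : ℝ} (hs : s ∈ Icc a b) :
    Y s = Z s * W t * Y t := by
  have := (h.right.mul hY).eq_of_zero (Eventually.of_forall fun s => by
    rw [Matrix.neg_mul, Matrix.mul_assoc, neg_add_cancel]) hs ht
  rw [Matrix.mul_assoc, ← this, ← Matrix.mul_assoc, h.mul_eq_one' hs, Matrix.one_mul]

/-- Variation of constants. -/
theorem exists_affine (h : IsFundamental F Z W a b) {c : ℝ → ι → ℝ}
    (hc : ∀ i, IntegrableOn (fun s => c s i) (Icc a b)) {t : ℝ} (ht : t ∈ Icc a b) (x : ι → ℝ) :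
    ∃ X, VecPrimitiveOn X (fun s => F s *ᵥ X s + c s) t b ∧ X t = x := by
  have hb : b ∈ Icc a b := ⟨ht.1.trans ht.2, le_rfl⟩
  have hW := h.right.continuousOn
  have hWc : ∀ i, IntegrableOn (fun s => (W s *ᵥ c s) i) (Icc t b) := fun i => by
    refine IntegrableOn.mono_set ?_ (Icc_subset_Icc_left ht.1)
    refine integrable_finsetSum _ fun k _ => (hc k).continuousOn_mul ?_ isCompact_Icc
    exact (continuous_id.matrix_elem i k).comp_continuousOn hW
  have h1 : VecPrimitiveOn (fun s i => ∫ τ in t..s, (W τ *ᵥ c τ) i) (fun s => W s *ᵥ c s) t b :=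
    fun i => IsPrimitiveOn.of_integral (hWc i)
  -- Multiplication by `W` turns the equation into `(W X)' = W c`, hence the ansatz `X = Z (W(t) x +
  -- ∫ W c)`.
  have h2 := (h.left.mono ht hb).mulVec ((VecPrimitiveOn.const (W t *ᵥ x)).add h1)
  refine ⟨_, h2.congr (fun _ _ => rfl) ?_, ?_⟩
  · filter_upwards [ae_restrict_mem measurableSet_Icc] with s hs
    rw [zero_add, mulVec_mulVec, h.mul_eq_one' ⟨ht.1.trans hs.1, hs.2⟩, one_mulVec, mulVec_mulVec]
  · have : (fun i => ∫ τ in t..t, (W τ *ᵥ c τ) i) = 0 := by ext i; simp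
    simp only [this, add_zero, mulVec_mulVec, h.mul_eq_one' ht, one_mulVec]

theorem absSum_left_le (h : IsFundamental F Z W a b) {g : ℝ → ℝ} (hg : IntegrableOn g (Icc a b))
    (hF : ∀ᵐ s ∂volume.restrict (Icc a b), (F s).absSum ≤ g s) {t : ℝ} (ht : t ∈ Icc a b) :
    (Z t).absSum ≤ Fintype.card ι * Real.exp (∫ s in a..b, g s) := by
  have h1 := MatPrimitiveOn.absSum_le (F := F) (Z := Z) (H := fun _ => 0)
    (by simpa using h.left) hg hF (fun i j => by simp) t ht
  rw [h.left_end, absSum_one] at h1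
  simp only [absSum_zero, intervalIntegral.integral_zero, add_zero] at h1
  refine h1.trans (mul_le_mul_of_nonneg_left (Real.exp_le_exp.2 ?_) (by positivity))
  rw [← intervalIntegral.integral_add_adjacent_intervals
    (hg.intervalIntegrable_of_mem ⟨le_rfl, ht.1.trans ht.2⟩ ht)
    (hg.intervalIntegrable_of_mem ht ⟨ht.1.trans ht.2, le_rfl⟩)]
  have := intervalIntegral.integral_nonneg_of_ae_restrict (μ := volume) (f := g) ht.1 (by
    filter_upwards [ae_restrict_of_ae_restrict_of_subset (Icc_subset_Icc_right ht.2) hF] with s hs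
    exact (absSum_nonneg _).trans hs)
  linarith

theorem absSum_left_sub_le (h : IsFundamental F Z W a b) {F' Z' W' : ℝ → Matrix ι ι ℝ}
    (h' : IsFundamental F' Z' W' a b) {g : ℝ → ℝ} (hg : IntegrableOn g (Icc a b))
    (hF : ∀ᵐ s ∂volume.restrict (Icc a b), (F s).absSum ≤ g s)
    (hF' : ∀ᵐ s ∂volume.restrict (Icc a b), (F' s).absSum ≤ g s)
    (hFi : ∀ i j, IntegrableOn (fun s => (F s - F' s) i j) (Icc a b))
    {t : ℝ} (ht : t ∈ Icc a b) :
    (Z t - Z' t).absSum ≤ Fintype.card ι * Real.exp (∫ s in a..b, g s) ^ 2 *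
      ∫ s in t..b, (F s - F' s).absSum := by
  have hb : b ∈ Icc a b := ⟨ht.1.trans ht.2, le_rfl⟩
  have hHi := matrix_integrableOn_mul_continuousOn hFi h'.left.continuousOn
  -- The difference solves `(Z - Z')' = F (Z - Z') + (F - F') Z'` with terminal value zero. One
  -- exponential comes from Gronwall, the other from the bound on `Z'`.
  have h1 := MatPrimitiveOn.absSum_le (F := F) (Z := fun s => Z s - Z' s)
    (H := fun s => (F s - F' s) * Z' s)
    ((h.left.sub h'.left).congr (fun _ _ => rfl) (Eventually.of_forall fun s => by
      simp only [Matrix.sub_mul, Matrix.mul_sub]; abel)) hg hF hHi t ht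
  simp only [h.left_end, h'.left_end, sub_self, absSum_zero, zero_add] at h1
  set I := Real.exp (∫ s in a..b, g s)
  have hg0 : ∀ᵐ s ∂volume.restrict (Icc a b), 0 ≤ g s := hF.mono fun s hs =>
    (absSum_nonneg _).trans hs
  have h2 : Real.exp (∫ s in t..b, g s) ≤ I := by
    refine Real.exp_le_exp.2 ?_
    rw [← intervalIntegral.integral_add_adjacent_intervals
      (hg.intervalIntegrable_of_mem ⟨le_rfl, ht.1.trans ht.2⟩ ht)
      (hg.intervalIntegrable_of_mem ht hb)]
    have := intervalIntegral.integral_nonneg_of_ae_restrict (μ := volume) (f := g) ht.1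
      (ae_restrict_of_ae_restrict_of_subset (Icc_subset_Icc_right ht.2) hg0)
    linarith
  have h3 : ∫ s in t..b, ((F s - F' s) * Z' s).absSum ≤
      (Fintype.card ι * I) * ∫ s in t..b, (F s - F' s).absSum := by
    rw [← intervalIntegral.integral_const_mul]
    refine intervalIntegral.integral_mono_on ht.2
      ((matrix_integrableOn_absSum hHi).intervalIntegrable_of_mem ht hb)
      (((matrix_integrableOn_absSum hFi).intervalIntegrable_of_mem ht hb).const_mul _)
      fun s hs => ?_
    rw [mul_comm (Fintype.card ι * I)]
    refine (absSum_mul_le _ _).trans (mul_le_mul_of_nonneg_left ?_ (absSum_nonneg _))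
    exact h'.absSum_left_le hg hF' ⟨ht.1.trans hs.1, hs.2⟩
  have hI : 0 < I := Real.exp_pos _
  have h4 : 0 ≤ ∫ s in t..b, ((F s - F' s) * Z' s).absSum :=
    intervalIntegral.integral_nonneg ht.2 fun s _ => absSum_nonneg _
  calc _ ≤ _ := h1
    _ ≤ ((Fintype.card ι * I) * ∫ s in t..b, (F s - F' s).absSum) * I :=
      mul_le_mul h3 h2 (Real.exp_nonneg _) (h4.trans h3)
    _ = _ := by ring

/-- This symmetry transfers every estimate on `Z` to `W`. -/
theorem dual (h : IsFundamental F Z W a b) :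
    IsFundamental (fun s => -(F s)ᵀ) (fun s => (W s)ᵀ) (fun s => (Z s)ᵀ) a b :=
  ⟨h.right.transpose.congr (fun _ _ => rfl) (Eventually.of_forall fun s => by simp),
    h.left.transpose.congr (fun _ _ => rfl) (Eventually.of_forall fun s => by simp),
    by simp [h.right_end], by simp [h.left_end]⟩

theorem absSum_right_le (h : IsFundamental F Z W a b) {g : ℝ → ℝ} (hg : IntegrableOn g (Icc a b))
    (hF : ∀ᵐ s ∂volume.restrict (Icc a b), (F s).absSum ≤ g s) {t : ℝ} (ht : t ∈ Icc a b) :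
    (W t).absSum ≤ Fintype.card ι * Real.exp (∫ s in a..b, g s) := by
  simpa using h.dual.absSum_left_le hg (by simpa using hF) ht

theorem absSum_right_sub_le (h : IsFundamental F Z W a b) {F' Z' W' : ℝ → Matrix ι ι ℝ}
    (h' : IsFundamental F' Z' W' a b) {g : ℝ → ℝ} (hg : IntegrableOn g (Icc a b))
    (hF : ∀ᵐ s ∂volume.restrict (Icc a b), (F s).absSum ≤ g s)
    (hF' : ∀ᵐ s ∂volume.restrict (Icc a b), (F' s).absSum ≤ g s)
    (hFi : ∀ i j, IntegrableOn (fun s => (F s - F' s) i j) (Icc a b))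
    {t : ℝ} (ht : t ∈ Icc a b) :
    (W t - W' t).absSum ≤ Fintype.card ι * Real.exp (∫ s in a..b, g s) ^ 2 *
      ∫ s in t..b, (F s - F' s).absSum := by
  have he : ∀ s, -(F s)ᵀ - -(F' s)ᵀ = -(F s - F' s)ᵀ := fun s => by
    rw [transpose_sub]; abel
  have := h.dual.absSum_left_sub_le h'.dual hg (by simpa using hF) (by simpa using hF')
    (fun i j => by simp only [he]; exact (hFi j i).neg) ht
  simpa only [he, absSum_neg, absSum_transpose, ← transpose_sub] using this

end IsFundamental

end Fundamental

/-! ### Differentiation of integrals whose lower limit and parameter both move. -/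

section Leibniz

variable {T : ℝ} {c : ℝ → ℝ → ℝ}

theorem hasDerivWithinAt_slice (hc : ContDiffOn ℝ 1 (fun q : ℝ × ℝ => c q.1 q.2)
      (Icc 0 T ×ˢ Icc 0 T)) {t s : ℝ} (ht : t ∈ Icc 0 T) (hs : s ∈ Icc 0 T) :
    HasDerivWithinAt (fun r => c r s)
      (fderivWithin ℝ (fun q : ℝ × ℝ => c q.1 q.2) (Icc 0 T ×ˢ Icc 0 T) (t, s) (1, 0))
      (Icc 0 T) t := by
  have h1 := (hc.differentiableOn one_ne_zero (t, s) ⟨ht, hs⟩).hasFDerivWithinAt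
  have h2 : HasDerivWithinAt (fun r : ℝ => (r, s)) ((1 : ℝ), (0 : ℝ)) (Icc 0 T) t :=
    (hasDerivWithinAt_id t _).prodMk (hasDerivWithinAt_const t _ s)
  exact HasFDerivWithinAt.comp_hasDerivWithinAt (f := fun r : ℝ => (r, s)) t h1 h2
    fun r hr => ⟨hr, hs⟩

theorem derivWithin_slice_eq (hT : 0 < T) (hc : ContDiffOn ℝ 1 (fun q : ℝ × ℝ => c q.1 q.2)
      (Icc 0 T ×ˢ Icc 0 T)) {t s : ℝ} (ht : t ∈ Icc 0 T) (hs : s ∈ Icc 0 T) :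
    derivWithin (fun r => c r s) (Icc 0 T) t =
      fderivWithin ℝ (fun q : ℝ × ℝ => c q.1 q.2) (Icc 0 T ×ˢ Icc 0 T) (t, s) (1, 0) :=
  (hasDerivWithinAt_slice hc ht hs).derivWithin (uniqueDiffOn_Icc hT t ht)

theorem continuousOn_derivWithin_slice (hT : 0 < T)
    (hc : ContDiffOn ℝ 1 (fun q : ℝ × ℝ => c q.1 q.2) (Icc 0 T ×ˢ Icc 0 T)) :
    ContinuousOn (fun q : ℝ × ℝ => derivWithin (fun r => c r q.2) (Icc 0 T) q.1)
      (Icc 0 T ×ˢ Icc 0 T) := by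
  have := hc.continuousOn_fderivWithin ((uniqueDiffOn_Icc hT).prod (uniqueDiffOn_Icc hT)) le_rfl
  exact (this.clm_apply continuousOn_const).congr fun q hq => derivWithin_slice_eq hT hc hq.1 hq.2

theorem continuousOn_slice {f : ℝ → ℝ → ℝ}
    (hc : ContinuousOn (fun q : ℝ × ℝ => f q.1 q.2) (Icc 0 T ×ˢ Icc 0 T)) {t : ℝ}
    (ht : t ∈ Icc 0 T) : ContinuousOn (fun s => f t s) (Icc 0 T) :=
  hc.comp (f := fun s => (t, s)) (by fun_prop) fun _ hs => ⟨ht, hs⟩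

theorem continuousOn_slice' {f : ℝ → ℝ → ℝ}
    (hc : ContinuousOn (fun q : ℝ × ℝ => f q.1 q.2) (Icc 0 T ×ˢ Icc 0 T)) {s : ℝ}
    (hs : s ∈ Icc 0 T) : ContinuousOn (fun t => f t s) (Icc 0 T) :=
  hc.comp (f := fun t => (t, s)) (by fun_prop) fun _ ht => ⟨ht, hs⟩

theorem continuousOn_diag {f : ℝ → ℝ → ℝ}
    (hc : ContinuousOn (fun q : ℝ × ℝ => f q.1 q.2) (Icc 0 T ×ˢ Icc 0 T)) :
    ContinuousOn (fun s => f s s) (Icc 0 T) :=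
  hc.comp (f := fun s => (s, s)) (by fun_prop) fun _ hs => ⟨hs, hs⟩

theorem integral_derivWithin_slice (hT : 0 < T)
    (hc : ContDiffOn ℝ 1 (fun q : ℝ × ℝ => c q.1 q.2) (Icc 0 T ×ˢ Icc 0 T)) {t s : ℝ}
    (ht : 0 ≤ t) (hts : t ≤ s) (hs : s ≤ T) :
    ∫ r in t..s, derivWithin (fun r => c r s) (Icc 0 T) r = c s s - c t s := by
  have hs' : s ∈ Icc 0 T := ⟨ht.trans hts, hs⟩
  have hsub : Icc t s ⊆ Icc 0 T := Icc_subset_Icc ht hs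
  refine intervalIntegral.integral_eq_sub_of_hasDerivAt_of_le hts
    ((continuousOn_slice' hc.continuousOn hs').mono hsub) (fun r hr => ?_) ?_
  · have hr' := hsub (Ioo_subset_Icc_self hr)
    rw [derivWithin_slice_eq hT hc hr' hs']
    exact (hasDerivWithinAt_slice hc hr' hs').hasDerivAt
      (Icc_mem_nhds (ht.trans_lt hr.1) (hr.2.trans_le hs))
  · refine ContinuousOn.intervalIntegrable_of_Icc hts ?_
    exact (continuousOn_slice' (f := fun t s => derivWithin (fun r => c r s) (Icc 0 T) t)
      (continuousOn_derivWithin_slice hT hc) hs').mono hsub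

/-- Fubini's theorem on a triangle. -/
theorem integral_triangle_swap {f : ℝ → ℝ → ℝ} {φ : ℝ → ℝ}
    (hf : ContinuousOn (fun q : ℝ × ℝ => f q.1 q.2) (Icc 0 T ×ˢ Icc 0 T))
    (hφ : IntegrableOn φ (Icc 0 T)) :
    IntegrableOn (fun r => ∫ s in r..T, f r s * φ s) (Icc 0 T) ∧
    ∀ t ∈ Icc 0 T, ∫ r in t..T, ∫ s in r..T, f r s * φ s =
      ∫ s in t..T, (∫ r in t..s, f r s) * φ s := by
  set μ := volume.restrict (Icc (0 : ℝ) T)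
  have hμ : μ.prod μ = volume.restrict (Icc 0 T ×ˢ Icc 0 T) := by
    rw [Measure.volume_eq_prod, Measure.prod_restrict]
  have hmeas : MeasurableSet {q : ℝ × ℝ | q.1 < q.2} :=
    measurableSet_lt measurable_fst measurable_snd
  have hint0 : Integrable (fun q : ℝ × ℝ => f q.1 q.2 * φ q.2) (μ.prod μ) := by
    have h1 : Integrable (fun q : ℝ × ℝ => φ q.2) (μ.prod μ) := hφ.comp_snd μ
    rw [hμ] at h1 ⊢
    exact IntegrableOn.continuousOn_mul hf h1 (isCompact_Icc.prod isCompact_Icc)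
  have hint := hint0.indicator hmeas
  set g : ℝ × ℝ → ℝ := {q : ℝ × ℝ | q.1 < q.2}.indicator (fun q => f q.1 q.2 * φ q.2)
  have hin : ∀ r ∈ Icc 0 T, ∫ s, g (r, s) ∂μ = ∫ s in r..T, f r s * φ s := by
    intro r hr
    rw [intervalIntegral.integral_of_le hr.2]
    have : (fun s => g (r, s)) = (Ioi r).indicator (fun s => f r s * φ s) := by
      ext s; simp [g, indicator_apply]
    rw [this, integral_indicator measurableSet_Ioi, Measure.restrict_restrict measurableSet_Ioi]
    congr 2
    ext s
    exact ⟨fun h => ⟨h.1, h.2.2⟩, fun h => ⟨h.1, hr.1.trans h.1.le, h.2⟩⟩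
  refine ⟨hint.integral_prod_left.congr ?_, fun t ht => ?_⟩
  · filter_upwards [ae_restrict_mem measurableSet_Icc] with r hr
    exact hin r hr
  set ν := volume.restrict (Ioc t T)
  have hνμ : ν ≤ μ := Measure.restrict_mono_set _ fun r hr => ⟨ht.1.trans hr.1.le, hr.2⟩
  have hint2 : Integrable (fun q : ℝ × ℝ => g (q.1, q.2)) (ν.prod μ) :=
    hint.mono_measure (Measure.prod_mono hνμ le_rfl)
  have hswap := integral_integral_swap (f := fun r s => g (r, s)) hint2
  rw [intervalIntegral.integral_of_le ht.2, intervalIntegral.integral_of_le ht.2]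
  rw [← setIntegral_congr_fun measurableSet_Ioc (fun r hr => hin r ⟨ht.1.trans hr.1.le, hr.2⟩)]
  rw [hswap]
  have h3 : ∀ s ∈ Icc 0 T, ∫ r, g (r, s) ∂ν =
      (Ioc t T).indicator (fun s => (∫ r in t..s, f r s) * φ s) s := by
    intro s hs
    have h4 : (fun r => g (r, s)) = (Iio s).indicator (fun r => f r s * φ s) := by
      ext r; simp [g, indicator_apply]
    rw [h4, integral_indicator measurableSet_Iio, Measure.restrict_restrict measurableSet_Iio]
    by_cases hst : t < s
    · rw [indicator_of_mem (show s ∈ Ioc t T from ⟨hst, hs.2⟩), integral_mul_const,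
        intervalIntegral.integral_of_le hst.le, integral_Ioc_eq_integral_Ioo]
      congr 3
      ext r
      exact ⟨fun h => ⟨h.2.1, h.1⟩, fun h => ⟨h.2, h.1, h.2.le.trans hs.2⟩⟩
    · rw [indicator_of_notMem fun h => hst h.1]
      have : Iio s ∩ Ioc t T = ∅ := by
        ext r
        simp only [mem_inter_iff, mem_Iio, mem_Ioc, mem_empty_iff_false, iff_false]
        rintro ⟨h1, h2, -⟩
        exact hst (h2.trans h1)
      simp [this]
  rw [setIntegral_congr_fun measurableSet_Icc h3, setIntegral_indicator measurableSet_Ioc]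
  congr 2
  ext s
  exact ⟨fun h => h.2, fun h => ⟨⟨ht.1.trans h.1.le, h.2⟩, h⟩⟩

/-- Differentiation of an integral with respect to its lower limit and a parameter. -/
theorem isPrimitiveOn_integral_param (hT : 0 < T)
    (hc : ContDiffOn ℝ 1 (fun q : ℝ × ℝ => c q.1 q.2) (Icc 0 T ×ˢ Icc 0 T)) {φ : ℝ → ℝ}
    (hφ : IntegrableOn φ (Icc 0 T)) :
    IsPrimitiveOn (fun t => ∫ s in t..T, c t s * φ s)
      (fun t => -(c t t * φ t) + ∫ s in t..T, derivWithin (fun r => c r s) (Icc 0 T) t * φ s)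
      0 T := by
  obtain ⟨h1, h2⟩ := integral_triangle_swap
    (f := fun t s => derivWithin (fun r => c r s) (Icc 0 T) t)
    (continuousOn_derivWithin_slice hT hc) hφ
  have h3 : IntegrableOn (fun t => c t t * φ t) (Icc 0 T) :=
    hφ.continuousOn_mul (continuousOn_diag hc.continuousOn) isCompact_Icc
  refine IsPrimitiveOn.of_backward (h3.neg.add h1) hT.le fun t ht => ?_
  have hT' : T ∈ Icc 0 T := right_mem_Icc.2 hT.le
  have h4 : IntegrableOn (fun s => c t s * φ s) (Icc 0 T) :=
    hφ.continuousOn_mul (continuousOn_slice hc.continuousOn ht) isCompact_Icc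
  have h3' : IntegrableOn (fun t => -(c t t * φ t)) (Icc 0 T) := h3.neg
  rw [intervalIntegral.integral_add (h3'.intervalIntegrable_of_mem ht hT')
    (h1.intervalIntegrable_of_mem ht hT'), h2 t ht, intervalIntegral.integral_same]
  -- After exchanging the integrals over the triangle, the inner one is `c s s - c t s`. Its
  -- diagonal part cancels against the boundary term, so `φ` need only be integrable.
  have h5 : ∫ s in t..T, (∫ r in t..s, derivWithin (fun r => c r s) (Icc 0 T) r) * φ s =
      ∫ s in t..T, (c s s * φ s - c t s * φ s) := by
    refine intervalIntegral.integral_congr fun s hs => ?_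
    rw [uIcc_of_le ht.2] at hs
    rw [integral_derivWithin_slice hT hc ht.1 hs.1 hs.2]
    ring
  rw [h5, intervalIntegral.integral_sub (h3.intervalIntegrable_of_mem ht hT')
    (h4.intervalIntegrable_of_mem ht hT')]
  rw [intervalIntegral.integral_neg]
  ring

theorem sandwich_apply {ι κ : Type*} [Fintype κ] (U : Matrix κ ι ℝ) (R : Matrix κ κ ℝ) (i j : ι) :
    (Uᵀ * R * U) i j = ∑ x, ∑ y, R x y * (U x i * U y j) := by
  simp only [mul_apply, transpose_apply, Finset.sum_mul]
  rw [Finset.sum_comm]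
  exact Finset.sum_congr rfl fun x _ => Finset.sum_congr rfl fun y _ => by ring

theorem integrableOn_mul_of_memLp {f g : ℝ → ℝ} {u : Set ℝ}
    (hf : MemLp f 2 (volume.restrict u)) (hg : MemLp g 2 (volume.restrict u)) :
    IntegrableOn (fun s => f s * g s) u := hf.integrable_mul hg

theorem integrableOn_sandwich {ι κ : Type*} [Fintype κ] {R : ℝ → Matrix κ κ ℝ}
    {Y : ℝ → Matrix κ ι ℝ} (hY : ∀ i j, MemLp (fun s => Y s i j) 2 (volume.restrict (Icc 0 T)))
    (hR : ∀ i j, ContinuousOn (fun s => R s i j) (Icc 0 T)) (i j : ι) :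
    IntegrableOn (fun s => ((Y s)ᵀ * R s * Y s) i j) (Icc 0 T) := by
  simp only [sandwich_apply]
  exact integrable_finsetSum _ fun x _ => integrable_finsetSum _ fun y _ =>
    (integrableOn_mul_of_memLp (hY x i) (hY y j)).continuousOn_mul (hR x y) isCompact_Icc

theorem integral_sandwich {ι κ : Type*} [Fintype κ] {R : ℝ → Matrix κ κ ℝ}
    {Y : ℝ → Matrix κ ι ℝ} (hY : ∀ i j, MemLp (fun s => Y s i j) 2 (volume.restrict (Icc 0 T)))
    (hR : ∀ i j, ContinuousOn (fun s => R s i j) (Icc 0 T)) (i j : ι) {t : ℝ} (ht : t ∈ Icc 0 T) :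
    ∫ s in t..T, ((Y s)ᵀ * R s * Y s) i j =
      ∑ x, ∑ y, ∫ s in t..T, R s x y * (Y s x i * Y s y j) := by
  have hi : ∀ x y, IntervalIntegrable (fun s => R s x y * (Y s x i * Y s y j)) volume t T :=
    fun x y => ((integrableOn_mul_of_memLp (hY x i) (hY y j)).continuousOn_mul (hR x y)
      isCompact_Icc).intervalIntegrable_of_mem ht ⟨ht.1.trans ht.2, le_rfl⟩
  simp only [sandwich_apply]
  rw [intervalIntegral.integral_finsetSum fun x _ => ?_]
  · refine Finset.sum_congr rfl fun x _ => ?_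
    rw [intervalIntegral.integral_finsetSum fun y _ => hi x y]
  · have := IntervalIntegrable.sum Finset.univ fun y _ => hi x y
    simpa [Finset.sum_fn] using this

/-- The factor `Y` does not depend on the parameter, so each entry is a finite sum of scalar
parameter integrals with `L¹` densities `Y x i * Y y j`. The factorization `Φ(s,t) = Z(s) W(t)` is
what brings the cost into this form. -/
theorem matPrimitiveOn_integral_param {κ : Type*} [Fintype κ] {k : ℕ} (hT : 0 < T)
    {R R₁ : ℝ → ℝ → Matrix κ κ ℝ} {Y : ℝ → Matrix κ (Fin k) ℝ}
    (hY : ∀ i j, MemLp (fun s => Y s i j) 2 (volume.restrict (Icc 0 T)))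
    (hR : ∀ i j, ContDiffOn ℝ 1 (fun q : ℝ × ℝ => R q.1 q.2 i j) (Icc 0 T ×ˢ Icc 0 T))
    (hR₁ : ∀ t s i j, R₁ t s i j = derivWithin (fun r => R r s i j) (Icc 0 T) t) :
    MatPrimitiveOn (fun t => matIntegral t T fun s => (Y s)ᵀ * R t s * Y s)
      (fun t => -((Y t)ᵀ * R t t * Y t) + matIntegral t T fun s => (Y s)ᵀ * R₁ t s * Y s) 0 T := by
  intro i j
  have h1 := IsPrimitiveOn.sum Finset.univ fun x _ => IsPrimitiveOn.sum Finset.univ fun y _ =>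
    isPrimitiveOn_integral_param (c := fun t s => R t s x y) hT (hR x y)
      (integrableOn_mul_of_memLp (hY x i) (hY y j))
  refine h1.congr (fun t ht => ?_) ?_
  · simp only [matIntegral, of_apply]
    rw [integral_sandwich hY (fun x y => continuousOn_slice (f := fun t s => R t s x y)
      (hR x y).continuousOn ht) i j ht]
  · filter_upwards [ae_restrict_mem measurableSet_Icc] with t ht
    simp only [matIntegral, Matrix.add_apply, Matrix.neg_apply, of_apply]
    rw [integral_sandwich hY (fun x y => ?_) i j ht, sandwich_apply]
    · simp only [hR₁, Finset.sum_add_distrib, Finset.sum_neg_distrib]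
    · simp only [hR₁]
      exact continuousOn_slice (f := fun t s => derivWithin (fun r => R r s x y) (Icc 0 T) t)
        (continuousOn_derivWithin_slice (c := fun t s => R t s x y) hT (hR x y)) ht

end Leibniz

/-! ### Quadratic forms in state and control. -/

theorem Matrix.PosSemidef.transpose_eq {ι : Type*} {A : Matrix ι ι ℝ} (h : A.PosSemidef) :
    Aᵀ = A := by
  rw [← conjTranspose_eq_transpose_of_trivial]; exact h.isHermitian

section QuadraticForms

variable {ι κ : Type*} [Fintype ι] [Fintype κ]

theorem Matrix.PosSemidef.quadratic_nonneg {A : Matrix ι ι ℝ} (h : A.PosSemidef) (x : ι → ℝ) :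
    0 ≤ x ⬝ᵥ (A *ᵥ x) := by simpa using h.dotProduct_mulVec_nonneg x

theorem dotProduct_transpose_mulVec_eq (A : Matrix ι κ ℝ) (x : κ → ℝ) (y : ι → ℝ) :
    x ⬝ᵥ (Aᵀ *ᵥ y) = (A *ᵥ x) ⬝ᵥ y := by
  rw [dotProduct_mulVec, vecMul_transpose]

theorem dotProduct_mulVec_comm_of_symm {A : Matrix ι ι ℝ} (h : Aᵀ = A) (x y : ι → ℝ) :
    x ⬝ᵥ (A *ᵥ y) = y ⬝ᵥ (A *ᵥ x) := by
  rw [dotProduct_mulVec, ← mulVec_transpose, h, dotProduct_comm]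

theorem quadratic_sandwich (A : Matrix ι ι ℝ) (U : Matrix ι κ ℝ) (x : κ → ℝ) :
    x ⬝ᵥ ((Uᵀ * A * U) *ᵥ x) = (U *ᵥ x) ⬝ᵥ (A *ᵥ (U *ᵥ x)) := by
  rw [← mulVec_mulVec, ← mulVec_mulVec, dotProduct_transpose_mulVec_eq]

theorem sandwich_transpose {ι κ : Type*} [Fintype ι] {A : Matrix ι ι ℝ} (h : Aᵀ = A)
    (U : Matrix ι κ ℝ) : (Uᵀ * A * U)ᵀ = Uᵀ * A * U := by
  rw [transpose_mul, transpose_mul, transpose_transpose, h, Matrix.mul_assoc]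

theorem block_quadratic (Q : Matrix ι ι ℝ) (S : Matrix κ ι ℝ) (M : Matrix κ κ ℝ) (x : ι → ℝ)
    (u : κ → ℝ) :
    Sum.elim x u ⬝ᵥ (fromBlocks Q Sᵀ S M *ᵥ Sum.elim x u) =
      x ⬝ᵥ (Q *ᵥ x) + 2 * (u ⬝ᵥ (S *ᵥ x)) + u ⬝ᵥ (M *ᵥ u) := by
  rw [fromBlocks_mulVec, sumElim_dotProduct_sumElim]
  simp only [Sum.elim_comp_inl, Sum.elim_comp_inr, dotProduct_add, dotProduct_transpose_mulVec_eq]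
  rw [dotProduct_comm (S *ᵥ x) u]
  ring

/-- The form is `⟨M(u + Kx), u + Kx⟩ + ⟨(Q - SᵀK)x, x⟩`. No inverse of `M` occurs, so this also
covers singular `M_t`. -/
theorem block_quadratic_nonneg {Q : Matrix ι ι ℝ} {S : Matrix κ ι ℝ} {M : Matrix κ κ ℝ}
    {K : Matrix κ ι ℝ} (hM : M.PosSemidef) (hK : M * K = S) (hQ : (Q - Sᵀ * K).PosSemidef)
    (z : ι ⊕ κ → ℝ) : 0 ≤ z ⬝ᵥ (fromBlocks Q Sᵀ S M *ᵥ z) := by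
  set x := z ∘ Sum.inl
  set u := z ∘ Sum.inr
  have hz : z = Sum.elim x u := (Sum.elim_comp_inl_inr z).symm
  rw [hz, block_quadratic]
  have h1 := hM.quadratic_nonneg (u + K *ᵥ x)
  have h2 := hQ.quadratic_nonneg x
  rw [sub_mulVec, dotProduct_sub, ← mulVec_mulVec, dotProduct_transpose_mulVec_eq] at h2
  rw [mulVec_add, mulVec_mulVec, hK, add_dotProduct, dotProduct_add, dotProduct_add,
    dotProduct_mulVec_comm_of_symm hM.transpose_eq (K *ᵥ x) u, mulVec_mulVec, hK,
    dotProduct_comm (K *ᵥ x)] at h1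
  linarith

theorem dotProduct_matIntegral_mulVec {k : ℕ} {a b : ℝ} {F : ℝ → Matrix (Fin k) (Fin k) ℝ}
    (hF : ∀ i j, IntervalIntegrable (fun s => F s i j) volume a b) (x : Fin k → ℝ) :
    x ⬝ᵥ (matIntegral a b F *ᵥ x) = ∫ s in a..b, x ⬝ᵥ (F s *ᵥ x) := by
  have h1 : ∀ i j, IntervalIntegrable (fun s => x i * (F s i j * x j)) volume a b := fun i j =>
    ((hF i j).mul_const _).const_mul _
  simp only [dotProduct, mulVec, Finset.mul_sum]
  rw [intervalIntegral.integral_finsetSum fun i _ => ?_]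
  · refine Finset.sum_congr rfl fun i _ => ?_
    rw [intervalIntegral.integral_finsetSum fun j _ => h1 i j]
    refine Finset.sum_congr rfl fun j _ => ?_
    rw [intervalIntegral.integral_const_mul, intervalIntegral.integral_mul_const]
    rfl
  · have := IntervalIntegrable.sum Finset.univ fun j _ => h1 i j
    simpa [Finset.sum_fn] using this

theorem matIntegral_transpose {k l : ℕ} (a b : ℝ) (F : ℝ → Matrix (Fin k) (Fin l) ℝ) :
    (matIntegral a b F)ᵀ = matIntegral a b fun s => (F s)ᵀ := rfl

end QuadraticForms

/-! ### Conjugation by fundamental matrices and Lyapunov equations. -/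

section Conjugation

variable {ι : Type*} [Fintype ι] [DecidableEq ι] {a b : ℝ} {F Z W : ℝ → Matrix ι ι ℝ}

/-- As `W' = -W F`, conjugation by `W` creates the Lyapunov terms with a minus sign. Conjugation by
`Z`, in `conj_left`, adds them with a plus sign and thereby removes them. -/
theorem IsFundamental.conj_right (h : IsFundamental F Z W a b) {N N' : ℝ → Matrix ι ι ℝ}
    (hN : MatPrimitiveOn N N' a b) :
    MatPrimitiveOn (fun t => (W t)ᵀ * N t * W t)
      (fun t => (W t)ᵀ * N' t * W t
        - ((F t)ᵀ * ((W t)ᵀ * N t * W t) + (W t)ᵀ * N t * W t * F t)) a b := by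
  refine ((h.right.transpose.mul hN).mul h.right).congr (fun _ _ => rfl)
    (Eventually.of_forall fun t => ?_)
  simp only [transpose_neg, transpose_mul, Matrix.add_mul, Matrix.mul_neg, Matrix.neg_mul,
    Matrix.mul_assoc]
  abel

theorem IsFundamental.conj_left (h : IsFundamental F Z W a b) {P P' : ℝ → Matrix ι ι ℝ}
    (hP : MatPrimitiveOn P P' a b) :
    MatPrimitiveOn (fun t => (Z t)ᵀ * P t * Z t)
      (fun t => (Z t)ᵀ * (P' t + ((F t)ᵀ * P t + P t * F t)) * Z t) a b := by
  refine ((h.left.transpose.mul hP).mul h.left).congr (fun _ _ => rfl)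
    (Eventually.of_forall fun t => ?_)
  simp only [transpose_mul, Matrix.add_mul, Matrix.mul_add, Matrix.mul_assoc]
  abel

/-- Uniqueness for the terminal value problem of Lyapunov equations. -/
theorem IsFundamental.lyapunov_unique (h : IsFundamental F Z W a b) {P P' H : ℝ → Matrix ι ι ℝ}
    (hP : MatPrimitiveOn P (fun t => H t - ((F t)ᵀ * P t + P t * F t)) a b)
    (hP' : MatPrimitiveOn P' (fun t => H t - ((F t)ᵀ * P' t + P' t * F t)) a b)
    (hb : P b = P' b) {t : ℝ} (ht : t ∈ Icc a b) : P t = P' t := by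
  -- The Lyapunov terms cancel, so `Zᵀ (P - P') Z` is constant. It vanishes at `b`, and conjugation
  -- by `W` recovers `P - P'`.
  have h1 := (h.conj_left (hP.sub hP')).eq_of_zero (Eventually.of_forall fun s => by
    rw [show H s - ((F s)ᵀ * P s + P s * F s) - (H s - ((F s)ᵀ * P' s + P' s * F s)) +
      ((F s)ᵀ * (P s - P' s) + (P s - P' s) * F s) = 0 by
        simp only [Matrix.mul_sub, Matrix.sub_mul]; abel, Matrix.mul_zero, Matrix.zero_mul])
    ht ⟨ht.1.trans ht.2, le_rfl⟩
  simp only [hb, sub_self, Matrix.mul_zero, Matrix.zero_mul] at h1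
  have h2 : (W t)ᵀ * ((Z t)ᵀ * (P t - P' t) * Z t) * W t = 0 := by
    rw [h1, Matrix.mul_zero, Matrix.zero_mul]
  rw [show (W t)ᵀ * ((Z t)ᵀ * (P t - P' t) * Z t) * W t =
    ((W t)ᵀ * (Z t)ᵀ) * (P t - P' t) * (Z t * W t) by simp only [Matrix.mul_assoc],
    h.transpose_mul_eq_one' ht, h.mul_eq_one' ht, Matrix.one_mul, Matrix.mul_one] at h2
  exact sub_eq_zero.1 h2

end Conjugation

/-! ### The cost matrix of a linear feedback and its differential equations. -/

/-- The matrix of the map `x ↦ (x, k x)`. -/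
def augment {n m : ℕ} (k : Matrix (Fin m) (Fin n) ℝ) : Matrix (Fin n ⊕ Fin m) (Fin n) ℝ :=
  fromRows 1 k

namespace LQProblem

variable {n m : ℕ} (p : LQProblem n m)

/-- The standing assumptions. -/
structure Standing : Prop where
  T_pos : 0 < p.T
  h1 : p.H1
  h2 : p.H2
  h3 : p.H3
  h4 : p.H4
  h5 : p.H5

/-- The weight matrix of the running cost as a quadratic form in state and control. -/
def weight (t s : ℝ) : Matrix (Fin n ⊕ Fin m) (Fin n ⊕ Fin m) ℝ :=
  fromBlocks (p.Q t s) (p.S t s)ᵀ (p.S t s) (p.M t s)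

/-- The partial derivative of `weight` with respect to the first variable. -/
def weightDeriv (t s : ℝ) : Matrix (Fin n ⊕ Fin m) (Fin n ⊕ Fin m) ℝ :=
  fromBlocks (matDeriv₁ p.T p.Q t s) (matDeriv₁ p.T p.S t s)ᵀ (matDeriv₁ p.T p.S t s)
    (matDeriv₁ p.T p.M t s)

/-- Square-integrable gains. -/
def IsGain (k : ℝ → Matrix (Fin m) (Fin n) ℝ) : Prop :=
  ∀ i j, MemLp (fun t => k t i j) 2 (volume.restrict (Icc 0 p.T))

/-- The drift matrix of the closed-loop system with gain `k`. -/
def closedLoop (k : ℝ → Matrix (Fin m) (Fin n) ℝ) (s : ℝ) : Matrix (Fin n) (Fin n) ℝ :=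
  p.A s + p.B s * k s

/-- The matrix of the cost, with the preferences of time `r`, of the linear feedback with gain `k`
started at time `t`; `Z` and `W` are the fundamental matrices of the closed-loop system. -/
def costMat (k : ℝ → Matrix (Fin m) (Fin n) ℝ) (Z W : ℝ → Matrix (Fin n) (Fin n) ℝ) (r t : ℝ) :
    Matrix (Fin n) (Fin n) ℝ :=
  (W t)ᵀ * (p.G r + matIntegral t p.T fun s =>
    (augment (k s) * Z s)ᵀ * p.weight r s * (augment (k s) * Z s)) * W t

/-- The derivative of `costMat` with respect to the time of the preferences, on the diagonal. -/
def costDrift (k : ℝ → Matrix (Fin m) (Fin n) ℝ) (Z W : ℝ → Matrix (Fin n) (Fin n) ℝ) (t : ℝ) :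
    Matrix (Fin n) (Fin n) ℝ :=
  (W t)ᵀ * (matDeriv p.T p.G t + matIntegral t p.T fun s =>
    (augment (k s) * Z s)ᵀ * p.weightDeriv t s * (augment (k s) * Z s)) * W t

variable {p}

namespace Standing

variable (h : p.Standing)
include h

theorem weight_contDiffOn (i j : Fin n ⊕ Fin m) :
    ContDiffOn ℝ 1 (fun q : ℝ × ℝ => p.weight q.1 q.2 i j) (Icc 0 p.T ×ˢ Icc 0 p.T) := by
  rcases i with i | i <;> rcases j with j | j
  · exact h.h3.1 i j
  · exact h.h4 j i
  · exact h.h4 i j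
  · exact h.h2.1 i j

omit h in
theorem weightDeriv_apply (t s : ℝ) (i j : Fin n ⊕ Fin m) :
    p.weightDeriv t s i j = derivWithin (fun r => p.weight r s i j) (Icc 0 p.T) t := by
  rcases i with i | i <;> rcases j with j | j <;> rfl

theorem weight_slice_continuousOn {r : ℝ} (hr : r ∈ Icc 0 p.T) (i j : Fin n ⊕ Fin m) :
    ContinuousOn (fun s => p.weight r s i j) (Icc 0 p.T) :=
  continuousOn_slice (f := fun t s => p.weight t s i j) (h.weight_contDiffOn i j).continuousOn hr

theorem weightDeriv_slice_continuousOn {r : ℝ} (hr : r ∈ Icc 0 p.T) (i j : Fin n ⊕ Fin m) :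
    ContinuousOn (fun s => p.weightDeriv r s i j) (Icc 0 p.T) := by
  simp only [weightDeriv_apply]
  exact continuousOn_slice (f := fun t s => derivWithin (fun r => p.weight r s i j) (Icc 0 p.T) t)
    (continuousOn_derivWithin_slice (c := fun t s => p.weight t s i j) h.T_pos
      (h.weight_contDiffOn i j)) hr

theorem weight_transpose {t s : ℝ} (ht : t ∈ Icc 0 p.T) (hs : s ∈ Icc 0 p.T) :
    (p.weight t s)ᵀ = p.weight t s := by
  rw [weight, fromBlocks_transpose, transpose_transpose, (h.h3.2.1 t ht s hs).transpose_eq,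
    (h.h2.2 t ht s hs).posSemidef.transpose_eq]

theorem M_mul_inv {t s : ℝ} (ht : t ∈ Icc 0 p.T) (hs : s ∈ Icc 0 p.T) :
    p.M t s * (p.M t s)⁻¹ = 1 :=
  Matrix.mul_nonsing_inv _ (h.h2.2 t ht s hs).det_pos.ne'.isUnit

theorem M_inv_mul {t s : ℝ} (ht : t ∈ Icc 0 p.T) (hs : s ∈ Icc 0 p.T) :
    (p.M t s)⁻¹ * p.M t s = 1 :=
  Matrix.nonsing_inv_mul _ (h.h2.2 t ht s hs).det_pos.ne'.isUnit

theorem weight_nonneg {t s : ℝ} (ht : 0 ≤ t) (hts : t ≤ s) (hs : s ≤ p.T)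
    (z : Fin n ⊕ Fin m → ℝ) : 0 ≤ z ⬝ᵥ (p.weight t s *ᵥ z) := by
  have ht' : t ∈ Icc 0 p.T := ⟨ht, hts.trans hs⟩
  have hs' : s ∈ Icc 0 p.T := ⟨ht.trans hts, hs⟩
  obtain ⟨-, -, h3, -⟩ := h.h5.2 t s ht hts hs
  refine block_quadratic_nonneg (K := (p.M t s)⁻¹ * p.S t s) (h.h2.2 t ht' s hs').posSemidef ?_ ?_ z
  · rw [← Matrix.mul_assoc, h.M_mul_inv ht' hs', Matrix.one_mul]
  · rwa [← Matrix.mul_assoc]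

theorem weightDeriv_nonneg {t s : ℝ} (ht : 0 ≤ t) (hts : t ≤ s) (hs : s ≤ p.T)
    (z : Fin n ⊕ Fin m → ℝ) : 0 ≤ z ⬝ᵥ (p.weightDeriv t s *ᵥ z) := by
  obtain ⟨-, h2, -, K, hK, h3⟩ := h.h5.2 t s ht hts hs
  exact block_quadratic_nonneg h2 hK h3 z

theorem integrableOn_closedLoop {k : ℝ → Matrix (Fin m) (Fin n) ℝ} (hk : p.IsGain k)
    (i j : Fin n) : IntegrableOn (fun s => p.closedLoop k s i j) (Icc 0 p.T) := by
  simp only [closedLoop, Matrix.add_apply, mul_apply]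
  refine (h.h1.1 i j).add (integrable_finsetSum _ fun l _ => ?_)
  exact ((hk l j).mul' (r := 2) (h.h1.2 i l)).integrable one_le_two

omit h in
theorem memLp_response {k : ℝ → Matrix (Fin m) (Fin n) ℝ} (hk : p.IsGain k)
    {Z : ℝ → Matrix (Fin n) (Fin n) ℝ} (hZ : ContinuousOn Z (Icc 0 p.T)) (i : Fin n ⊕ Fin m)
    (j : Fin n) :
    MemLp (fun s => (augment (k s) * Z s) i j) 2 (volume.restrict (Icc 0 p.T)) := by
  have hZ' : ∀ i, MemLp (fun s => Z s i j) ⊤ (volume.restrict (Icc 0 p.T)) := fun i => by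
    have hc : ContinuousOn (fun s => Z s i j) (Icc 0 p.T) :=
      (continuous_id.matrix_elem i j).comp_continuousOn hZ
    obtain ⟨C, hC⟩ := isCompact_Icc.exists_bound_of_continuousOn hc
    refine MemLp.of_bound (hc.aestronglyMeasurable measurableSet_Icc) C ?_
    filter_upwards [ae_restrict_mem measurableSet_Icc] with s hs using hC s hs
  rcases i with i | i
  · simp only [augment, fromRows_mul, fromRows_apply_inl, Matrix.one_mul]
    exact (hZ' i).mono_exponent le_top
  · simp only [augment, fromRows_apply_inr, mul_apply]
    exact memLp_finsetSum _ fun l _ => (hZ' l).mul' (r := 2) (hk i l)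

section CostMatrix

variable {k : ℝ → Matrix (Fin m) (Fin n) ℝ} {Z W : ℝ → Matrix (Fin n) (Fin n) ℝ}
  (hk : p.IsGain k) (hZ : IsFundamental (p.closedLoop k) Z W 0 p.T)
include hk hZ

omit h in
theorem integrableOn_response {R : ℝ → Matrix (Fin n ⊕ Fin m) (Fin n ⊕ Fin m) ℝ}
    (hR : ∀ i j, ContinuousOn (fun s => R s i j) (Icc 0 p.T)) (i j : Fin n) :
    IntegrableOn (fun s => ((augment (k s) * Z s)ᵀ * R s * (augment (k s) * Z s)) i j)
      (Icc 0 p.T) :=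
  integrableOn_sandwich (memLp_response hk hZ.left.continuousOn) hR i j

omit h hk in
-- Because `Z W = 1`, the boundary term at `s = t` no longer contains the fundamental matrices.
theorem response_mul {t : ℝ} (ht : t ∈ Icc 0 p.T) (R : Matrix (Fin n ⊕ Fin m) (Fin n ⊕ Fin m) ℝ) :
    (W t)ᵀ * ((augment (k t) * Z t)ᵀ * R * (augment (k t) * Z t)) * W t =
      (augment (k t))ᵀ * R * augment (k t) := by
  have h1 : augment (k t) * Z t * W t = augment (k t) := by
    rw [Matrix.mul_assoc, hZ.mul_eq_one' ht, Matrix.mul_one]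
  calc _ = (augment (k t) * Z t * W t)ᵀ * R * (augment (k t) * Z t * W t) := by
        simp only [transpose_mul, Matrix.mul_assoc]
    _ = _ := by rw [h1]

/-- With frozen preferences this is the Lyapunov equation of a time-consistent problem. It is the
one needed to complete the square. -/
theorem costMat_primitive {r : ℝ} (hr : r ∈ Icc 0 p.T) :
    MatPrimitiveOn (p.costMat k Z W r) (fun t =>
      -((augment (k t))ᵀ * p.weight r t * augment (k t))
        - ((p.closedLoop k t)ᵀ * p.costMat k Z W r t + p.costMat k Z W r t * p.closedLoop k t))
      0 p.T := by
  have hi := integrableOn_response hk hZ (h.weight_slice_continuousOn hr)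
  have hN : MatPrimitiveOn (fun t => p.G r + matIntegral t p.T fun s =>
      (augment (k s) * Z s)ᵀ * p.weight r s * (augment (k s) * Z s))
      (fun t => -((augment (k t) * Z t)ᵀ * p.weight r t * (augment (k t) * Z t))) 0 p.T :=
    fun i j => by
      have := (IsPrimitiveOn.const (a := 0) (b := p.T) (p.G r i j)).add
        (IsPrimitiveOn.of_integral_right (hi i j) h.T_pos.le)
      exact this.congr (fun _ _ => rfl) (Eventually.of_forall fun s => by simp)
  refine (hZ.conj_right hN).congr (fun _ _ => rfl) ?_
  filter_upwards [ae_restrict_mem measurableSet_Icc] with t ht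
  rw [Matrix.mul_neg, Matrix.neg_mul, response_mul hZ ht]
  rfl

/-- Letting the preferences move with `t` adds the derivatives of `G` and of the weight in the first
variable. Their contribution `costDrift` is the nonlocal part of the Riccati equation. -/
theorem costMat_diag_primitive :
    MatPrimitiveOn (fun t => p.costMat k Z W t t) (fun t =>
      (p.costDrift k Z W t - (augment (k t))ᵀ * p.weight t t * augment (k t))
        - ((p.closedLoop k t)ᵀ * p.costMat k Z W t t + p.costMat k Z W t t * p.closedLoop k t))
      0 p.T := by
  have hG : MatPrimitiveOn p.G (matDeriv p.T p.G) 0 p.T := fun i j => by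
    have hd := h.h3.2.2.1 i j
    have hc := hd.continuousOn_derivWithin (uniqueDiffOn_Icc h.T_pos) le_rfl
    refine ⟨hc.integrableOn_compact isCompact_Icc, fun s hs => ?_⟩
    have hsub : Icc 0 s ⊆ Icc 0 p.T := Icc_subset_Icc_right hs.2
    have := intervalIntegral.integral_eq_sub_of_hasDerivAt_of_le (f := fun t => p.G t i j)
      (f' := fun t => matDeriv p.T p.G t i j) hs.1 (hd.continuousOn.mono hsub)
      (fun t ht => ((hd.differentiableOn one_ne_zero) t
        (hsub (Ioo_subset_Icc_self ht))).hasDerivWithinAt.hasDerivAt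
          (Icc_mem_nhds ht.1 (ht.2.trans_le hs.2)))
      ((hc.mono hsub).intervalIntegrable_of_Icc hs.1)
    rw [this]; ring
  have hN := hG.add (matPrimitiveOn_integral_param h.T_pos
    (memLp_response hk hZ.left.continuousOn) h.weight_contDiffOn weightDeriv_apply)
  refine (hZ.conj_right hN).congr (fun _ _ => rfl) ?_
  filter_upwards [ae_restrict_mem measurableSet_Icc] with t ht
  have h1 : ∀ N : Matrix (Fin n) (Fin n) ℝ, (W t)ᵀ * (matDeriv p.T p.G t +
      (-((augment (k t) * Z t)ᵀ * p.weight t t * (augment (k t) * Z t)) + N)) * W t =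
      (W t)ᵀ * (matDeriv p.T p.G t + N) * W t
        - (augment (k t))ᵀ * p.weight t t * augment (k t) := fun N => by
    rw [← response_mul hZ ht]
    simp only [Matrix.mul_add, Matrix.add_mul, Matrix.mul_neg, Matrix.neg_mul]
    abel
  rw [h1]
  rfl

omit hk hZ in
theorem costMat_transpose {r t : ℝ} (hr : r ∈ Icc 0 p.T) (ht : t ∈ Icc 0 p.T) :
    (p.costMat k Z W r t)ᵀ = p.costMat k Z W r t := by
  refine sandwich_transpose ?_ _
  rw [transpose_add, (h.h3.2.2.2 r hr).transpose_eq, matIntegral_transpose]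
  congr 1
  ext i j
  refine intervalIntegral.integral_congr fun s hs => ?_
  rw [uIcc_of_le ht.2] at hs
  exact congrFun (congrFun (sandwich_transpose
    (h.weight_transpose hr ⟨ht.1.trans hs.1, hs.2⟩) _) i) j

theorem costMat_nonneg {t : ℝ} (ht : t ∈ Icc 0 p.T) (x : Fin n → ℝ) :
    0 ≤ x ⬝ᵥ (p.costMat k Z W t t *ᵥ x) := by
  rw [costMat, quadratic_sandwich, add_mulVec, dotProduct_add, dotProduct_matIntegral_mulVec]
  · refine add_nonneg ((h.h3.2.2.2 t ht).quadratic_nonneg _)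
      (intervalIntegral.integral_nonneg ht.2 fun s hs => ?_)
    rw [quadratic_sandwich]
    exact h.weight_nonneg ht.1 hs.1 hs.2 _
  · exact fun i j => (integrableOn_response hk hZ (h.weight_slice_continuousOn ht)
      i j).intervalIntegrable_of_mem ht (right_mem_Icc.2 h.T_pos.le)

theorem costDrift_nonneg {t : ℝ} (ht : t ∈ Icc 0 p.T) (x : Fin n → ℝ) :
    0 ≤ x ⬝ᵥ (p.costDrift k Z W t *ᵥ x) := by
  rw [costDrift, quadratic_sandwich, add_mulVec, dotProduct_add, dotProduct_matIntegral_mulVec]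
  · refine add_nonneg ((h.h5.1 t ht).quadratic_nonneg _)
      (intervalIntegral.integral_nonneg ht.2 fun s hs => ?_)
    rw [quadratic_sandwich]
    exact h.weightDeriv_nonneg ht.1 hs.1 hs.2 _
  · exact fun i j => (integrableOn_response hk hZ (h.weightDeriv_slice_continuousOn ht)
      i j).intervalIntegrable_of_mem ht (right_mem_Icc.2 h.T_pos.le)

end CostMatrix

end Standing

end LQProblem

/-! ### Essentially bounded gains and Lipschitz dependence of the cost matrix. -/

/-- Matrix-valued functions with essentially bounded entries on `[0,T]`. -/
def MatEssBdd {ι κ : Type*} (T : ℝ) (F : ℝ → Matrix ι κ ℝ) : Prop :=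
  ∀ i j, MemLp (fun s => F s i j) ⊤ (volume.restrict (Icc 0 T))

namespace MatEssBdd

variable {ι κ l : Type*} {T : ℝ} {F H : ℝ → Matrix ι κ ℝ}

theorem of_continuousOn (hF : ContinuousOn F (Icc 0 T)) : MatEssBdd T F := fun i j => by
  have hc : ContinuousOn (fun s => F s i j) (Icc 0 T) :=
    (continuous_id.matrix_elem i j).comp_continuousOn hF
  obtain ⟨C, hC⟩ := isCompact_Icc.exists_bound_of_continuousOn hc
  refine MemLp.of_bound (hc.aestronglyMeasurable measurableSet_Icc) C ?_
  filter_upwards [ae_restrict_mem measurableSet_Icc] with s hs using hC s hs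

theorem integrableOn (hF : MatEssBdd T F) (i : ι) (j : κ) :
    IntegrableOn (fun s => F s i j) (Icc 0 T) := (hF i j).integrable le_top

theorem add (hF : MatEssBdd T F) (hH : MatEssBdd T H) : MatEssBdd T fun s => F s + H s :=
  fun i j => (hF i j).add (hH i j)

theorem neg (hF : MatEssBdd T F) : MatEssBdd T fun s => -F s := fun i j => (hF i j).neg

theorem transpose (hF : MatEssBdd T F) : MatEssBdd T fun s => (F s)ᵀ := fun i j => hF j i

theorem mul [Fintype κ] {K : ℝ → Matrix κ l ℝ} (hF : MatEssBdd T F) (hK : MatEssBdd T K) :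
    MatEssBdd T fun s => F s * K s := fun i j => by
  simp only [mul_apply]
  exact memLp_finsetSum _ fun x _ => (hK x j).mul' (r := ⊤) (hF i x)

theorem smul {θ : ℝ → ℝ} (hθ : ContinuousOn θ (Icc 0 T)) (hF : MatEssBdd T F) :
    MatEssBdd T fun s => θ s • F s := fun i j => by
  have h1 := of_continuousOn (F := fun s => Matrix.of fun _ _ : Unit => θ s)
    (continuousOn_pi.2 fun _ => continuousOn_pi.2 fun _ => hθ)
  exact (hF i j).mul' (r := ⊤) (h1 () ())

theorem exists_absSum_le [Fintype ι] [Fintype κ] (hF : MatEssBdd T F) :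
    ∃ c, 0 ≤ c ∧ ∀ᵐ s ∂volume.restrict (Icc 0 T), (F s).absSum ≤ c := by
  have h1 : ∀ i j, ∃ c : ℝ, ∀ᵐ s ∂volume.restrict (Icc 0 T), |F s i j| ≤ c := fun i j => by
    refine ⟨(eLpNormEssSup (fun s => F s i j) (volume.restrict (Icc 0 T))).toReal, ?_⟩
    have hfin := (hF i j).2
    rw [eLpNorm_exponent_top] at hfin
    filter_upwards [ae_le_eLpNormEssSup (f := fun s => F s i j)] with s hs
    have := ENNReal.toReal_mono hfin.ne hs
    simpa using this
  choose c hc using h1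
  refine ⟨∑ i, ∑ j, |c i j|, by positivity, ?_⟩
  have h2 : ∀ᵐ s ∂volume.restrict (Icc 0 T), ∀ i j, |F s i j| ≤ c i j :=
    ae_all_iff.2 fun i => ae_all_iff.2 fun j => hc i j
  filter_upwards [h2] with s hs
  exact Finset.sum_le_sum fun i _ => Finset.sum_le_sum fun j _ => (hs i j).trans (le_abs_self _)

end MatEssBdd

theorem norm_mulVec_le_absSum {ι κ : Type*} [Fintype ι] [Fintype κ] (A : Matrix ι κ ℝ) (x : κ → ℝ) :
    ‖A *ᵥ x‖ ≤ A.absSum * ‖x‖ := by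
  refine (pi_norm_le_iff_of_nonneg (mul_nonneg A.absSum_nonneg (norm_nonneg _))).2 fun i => ?_
  rw [Real.norm_eq_abs]
  calc |(A *ᵥ x) i| ≤ ∑ j, |A i j| * ‖x‖ := by
        refine (Finset.abs_sum_le_sum_abs _ _).trans (Finset.sum_le_sum fun j _ => ?_)
        rw [abs_mul]
        exact mul_le_mul_of_nonneg_left (norm_le_pi_norm x j) (abs_nonneg _)
    _ = (∑ j, |A i j|) * ‖x‖ := by rw [Finset.sum_mul]
    _ ≤ _ := mul_le_mul_of_nonneg_right (Finset.single_le_sum (f := fun i => ∑ j, |A i j|)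
        (fun _ _ => Finset.sum_nonneg fun _ _ => abs_nonneg _) (Finset.mem_univ i)) (norm_nonneg _)

theorem absSum_augment {n m : ℕ} (k : Matrix (Fin m) (Fin n) ℝ) :
    (augment k).absSum = n + k.absSum := by
  have : (1 : Matrix (Fin n) (Fin n) ℝ).absSum = n := by rw [absSum_one, Fintype.card_fin]
  rw [← this]
  simp [absSum, augment, Fintype.sum_sum_type]

theorem absSum_augment_sub {n m : ℕ} (k k' : Matrix (Fin m) (Fin n) ℝ) :
    (augment k - augment k').absSum = (k - k').absSum := by
  simp [absSum, augment, Fintype.sum_sum_type]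

theorem absSum_matIntegral_le {k l : ℕ} {F : ℝ → Matrix (Fin k) (Fin l) ℝ} {a b : ℝ}
    (hab : a ≤ b) (hF : ∀ i j, IntervalIntegrable (fun s => F s i j) volume a b) :
    (matIntegral a b F).absSum ≤ ∫ s in a..b, (F s).absSum := absSum_integral_le hab hF

theorem ContinuousOn.matrix_entry {ι κ X : Type*} [TopologicalSpace X] {F : X → Matrix ι κ ℝ}
    {u : Set X} (hF : ContinuousOn F u) (i : ι) (j : κ) : ContinuousOn (fun s => F s i j) u :=
  (continuous_id.matrix_elem i j).comp_continuousOn hF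

theorem continuousOn_matrix {ι κ X : Type*} [TopologicalSpace X] {F : X → Matrix ι κ ℝ}
    {u : Set X} (hF : ∀ i j, ContinuousOn (fun s => F s i j) u) : ContinuousOn F u :=
  continuousOn_pi.2 fun i => continuousOn_pi.2 fun j => hF i j

namespace LQProblem

variable {n m : ℕ} {p : LQProblem n m}

theorem IsGain.of_essBdd {k : ℝ → Matrix (Fin m) (Fin n) ℝ} (hk : MatEssBdd p.T k) :
    p.IsGain k := fun i j => (hk i j).mono_exponent le_top

namespace Standing

variable (h : p.Standing)
include h

theorem exists_weight_le : ∃ ρ, 0 ≤ ρ ∧ ∀ t ∈ Icc 0 p.T, ∀ s ∈ Icc 0 p.T,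
    (p.weight t s).absSum ≤ ρ := by
  have hc : ContinuousOn (fun q : ℝ × ℝ => (p.weight q.1 q.2).absSum) (Icc 0 p.T ×ˢ Icc 0 p.T) :=
    ContinuousOn.matrix_absSum (F := fun q : ℝ × ℝ => p.weight q.1 q.2)
      (continuousOn_matrix fun i j => (h.weight_contDiffOn i j).continuousOn)
  obtain ⟨ρ, hρ⟩ := (isCompact_Icc.prod isCompact_Icc).exists_bound_of_continuousOn hc
  refine ⟨max ρ 0, le_max_right _ _, fun t ht s hs => ?_⟩
  exact ((le_abs_self _).trans (hρ (t, s) ⟨ht, hs⟩)).trans (le_max_left _ _)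

theorem G_continuousOn : ContinuousOn p.G (Icc 0 p.T) :=
  continuousOn_matrix fun i j => (h.h3.2.2.1 i j).continuousOn

theorem exists_G_le : ∃ γ, 0 ≤ γ ∧ ∀ t ∈ Icc 0 p.T, (p.G t).absSum ≤ γ := by
  obtain ⟨γ, hγ⟩ := isCompact_Icc.exists_bound_of_continuousOn h.G_continuousOn.matrix_absSum
  refine ⟨max γ 0, le_max_right _ _, fun t ht => ?_⟩
  exact ((le_abs_self _).trans (hγ t ht)).trans (le_max_left _ _)

/-- The cost matrix depends in a Lipschitz continuous way on bounded gains. -/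
theorem exists_costMat_lipschitz {κ : ℝ} (hκ : 0 ≤ κ) : ∃ c, 0 ≤ c ∧
    ∀ (k k' : ℝ → Matrix (Fin m) (Fin n) ℝ) (Z W Z' W' : ℝ → Matrix (Fin n) (Fin n) ℝ),
      MatEssBdd p.T k → MatEssBdd p.T k' →
      (∀ᵐ s ∂volume.restrict (Icc 0 p.T), (k s).absSum ≤ κ) →
      (∀ᵐ s ∂volume.restrict (Icc 0 p.T), (k' s).absSum ≤ κ) →
      IsFundamental (p.closedLoop k) Z W 0 p.T → IsFundamental (p.closedLoop k') Z' W' 0 p.T →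
      ∀ t ∈ Icc 0 p.T, (p.costMat k Z W t t - p.costMat k' Z' W' t t).absSum ≤
        c * ∫ s in t..p.T, (k s - k' s).absSum := by
  obtain ⟨ρ, hρ0, hρ⟩ := h.exists_weight_le
  obtain ⟨γ, hγ0, hγ⟩ := h.exists_G_le
  obtain ⟨β, hβ0, hβ⟩ := MatEssBdd.exists_absSum_le (T := p.T) (F := p.B) h.h1.2
  have hT := h.T_pos
  set g : ℝ → ℝ := fun s => (p.A s).absSum + β * κ with hg
  have hgi : IntegrableOn g (Icc 0 p.T) :=
    (matrix_integrableOn_absSum h.h1.1).add (continuousOn_const.integrableOn_compact isCompact_Icc)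
  set E := Real.exp (∫ s in 0..p.T, g s)
  have hE0 : 0 < E := Real.exp_pos _
  have hF : ∀ k : ℝ → Matrix (Fin m) (Fin n) ℝ,
      (∀ᵐ s ∂volume.restrict (Icc 0 p.T), (k s).absSum ≤ κ) →
      ∀ᵐ s ∂volume.restrict (Icc 0 p.T), (p.closedLoop k s).absSum ≤ g s := fun k hk => by
    filter_upwards [hk, hβ] with s h1 h2
    refine (absSum_add_le _ _).trans (add_le_add_right ((absSum_mul_le _ _).trans ?_) _)
    exact mul_le_mul h2 h1 (absSum_nonneg _) hβ0
  -- Here `ζ` bounds all four fundamental matrices, `δ` is their Lipschitz constant in the `L¹`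
  -- distance of the gains, and `ℓ` bounds the augmented gains. Below, `ν₀` bounds the matrix
  -- conjugated by `W`, and `ν` is its Lipschitz constant. All of them depend only on `κ` and the
  -- data.
  set ζ := (n : ℝ) * E
  set δ := (n : ℝ) * E ^ 2 * β
  set ℓ := (n : ℝ) + κ
  have hζ0 : 0 ≤ ζ := by positivity
  have hδ0 : 0 ≤ δ := by positivity
  have hℓ0 : 0 ≤ ℓ := by positivity
  set ν := ρ * (ℓ * ζ + ℓ * ζ) * (ζ + p.T * (ℓ * δ))
  set ν₀ := γ + p.T * ((ℓ * ζ) * ρ * (ℓ * ζ))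
  refine ⟨ν₀ * (ζ + ζ) * δ + ζ * ν * ζ, by positivity, ?_⟩
  intro k k' Z W Z' W' hk hk' hkκ hk'κ hZ hZ' t ht
  have hTm : p.T ∈ Icc 0 p.T := right_mem_Icc.2 hT.le
  have hd : MatEssBdd p.T fun s => k s - k' s := fun i j => (hk i j).sub (hk' i j)
  have hdi : IntegrableOn (fun s => (k s - k' s).absSum) (Icc 0 p.T) :=
    matrix_integrableOn_absSum fun i j => (hd i j).integrable le_top
  have hFF : ∀ s, p.closedLoop k s - p.closedLoop k' s = p.B s * (k s - k' s) := fun s => by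
    simp only [closedLoop, Matrix.mul_sub]; abel
  have hBd : MatEssBdd p.T fun s => p.B s * (k s - k' s) :=
    MatEssBdd.mul (F := p.B) h.h1.2 hd
  have hFi : ∀ i j, IntegrableOn (fun s => (p.closedLoop k s - p.closedLoop k' s) i j)
      (Icc 0 p.T) := fun i j => by
    simp only [hFF]; exact (hBd i j).integrable le_top
  have hFint : ∀ s ∈ Icc 0 p.T, ∫ r in s..p.T, (p.closedLoop k r - p.closedLoop k' r).absSum ≤
      β * ∫ r in s..p.T, (k r - k' r).absSum := fun s hs => by
    rw [← intervalIntegral.integral_const_mul]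
    refine intervalIntegral.integral_mono_ae_restrict hs.2
      ((matrix_integrableOn_absSum hFi).intervalIntegrable_of_mem hs hTm)
      ((hdi.intervalIntegrable_of_mem hs hTm).const_mul _) ?_
    filter_upwards [ae_restrict_of_ae_restrict_of_subset (Icc_subset_Icc_left hs.1) hβ] with r hr
    rw [hFF]
    exact (absSum_mul_le _ _).trans (mul_le_mul_of_nonneg_right hr (absSum_nonneg _))
  have hcard : (Fintype.card (Fin n) : ℝ) = n := by simp
  have hZb : ∀ s ∈ Icc 0 p.T, (Z s).absSum ≤ ζ := fun s hs => by
    simpa [hcard] using hZ.absSum_left_le hgi (hF k hkκ) hs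
  have hZb' : ∀ s ∈ Icc 0 p.T, (Z' s).absSum ≤ ζ := fun s hs => by
    simpa [hcard] using hZ'.absSum_left_le hgi (hF k' hk'κ) hs
  have hWb : ∀ s ∈ Icc 0 p.T, (W s).absSum ≤ ζ := fun s hs => by
    simpa [hcard] using hZ.absSum_right_le hgi (hF k hkκ) hs
  have hWb' : ∀ s ∈ Icc 0 p.T, (W' s).absSum ≤ ζ := fun s hs => by
    simpa [hcard] using hZ'.absSum_right_le hgi (hF k' hk'κ) hs
  set I : ℝ → ℝ := fun s => ∫ r in s..p.T, (k r - k' r).absSum with hI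
  have hI0 : ∀ s ∈ Icc 0 p.T, 0 ≤ I s := fun s hs =>
    intervalIntegral.integral_nonneg hs.2 fun _ _ => absSum_nonneg _
  have hZd : ∀ s ∈ Icc 0 p.T, (Z s - Z' s).absSum ≤ δ * I s := fun s hs => by
    have := hZ.absSum_left_sub_le hZ' hgi (hF k hkκ) (hF k' hk'κ) hFi hs
    rw [hcard] at this
    refine this.trans ((mul_le_mul_of_nonneg_left (hFint s hs) (by positivity)).trans (le_of_eq ?_))
    ring
  have hWd : ∀ s ∈ Icc 0 p.T, (W s - W' s).absSum ≤ δ * I s := fun s hs => by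
    have := hZ.absSum_right_sub_le hZ' hgi (hF k hkκ) (hF k' hk'κ) hFi hs
    rw [hcard] at this
    refine this.trans ((mul_le_mul_of_nonneg_left (hFint s hs) (by positivity)).trans (le_of_eq ?_))
    ring
  have hImono : ∀ s ∈ Icc t p.T, I s ≤ I t := fun s hs => by
    have hs' : s ∈ Icc 0 p.T := ⟨ht.1.trans hs.1, hs.2⟩
    simp only [hI]
    rw [← intervalIntegral.integral_add_adjacent_intervals (hdi.intervalIntegrable_of_mem ht hs')
      (hdi.intervalIntegrable_of_mem hs' hTm)]
    have := intervalIntegral.integral_nonneg (μ := volume) (f := fun s => (k s - k' s).absSum) hs.1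
      fun s _ => absSum_nonneg _
    linarith
  have hsub : Icc t p.T ⊆ Icc 0 p.T := Icc_subset_Icc_left ht.1
  have hYb : ∀ (k : ℝ → Matrix (Fin m) (Fin n) ℝ) (Z : ℝ → Matrix (Fin n) (Fin n) ℝ) s,
      (k s).absSum ≤ κ → (Z s).absSum ≤ ζ → (augment (k s) * Z s).absSum ≤ ℓ * ζ :=
    fun k Z s h1 h2 => by
      refine (absSum_mul_le _ _).trans (mul_le_mul ?_ h2 (absSum_nonneg _) hℓ0)
      rw [absSum_augment]
      exact add_le_add_right h1 _
  have hint := integrableOn_response (IsGain.of_essBdd hk) hZ (h.weight_slice_continuousOn ht)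
  have hint' := integrableOn_response (IsGain.of_essBdd hk') hZ' (h.weight_slice_continuousOn ht)
  set V : ℝ → Matrix (Fin n) (Fin n) ℝ := fun s =>
    (augment (k s) * Z s)ᵀ * p.weight t s * (augment (k s) * Z s) with hV
  set V' : ℝ → Matrix (Fin n) (Fin n) ℝ := fun s =>
    (augment (k' s) * Z' s)ᵀ * p.weight t s * (augment (k' s) * Z' s) with hV'
  set N := p.G t + matIntegral t p.T V with hN
  set N' := p.G t + matIntegral t p.T V' with hN'
  have hNb : N.absSum ≤ ν₀ := by
    refine (absSum_add_le _ _).trans (add_le_add (hγ t ht) ?_)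
    refine (absSum_matIntegral_le ht.2
      fun i j => (hint i j).intervalIntegrable_of_mem ht hTm).trans ?_
    have h1 : ∫ s in t..p.T, (V s).absSum ≤ ∫ _ in t..p.T, (ℓ * ζ) * ρ * (ℓ * ζ) := by
      refine intervalIntegral.integral_mono_ae_restrict ht.2
        ((matrix_integrableOn_absSum hint).intervalIntegrable_of_mem ht hTm)
        intervalIntegrable_const ?_
      filter_upwards [ae_restrict_of_ae_restrict_of_subset hsub hkκ,
        ae_restrict_mem measurableSet_Icc] with s h1 hs
      have h2 := hYb k Z s h1 (hZb s (hsub hs))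
      refine (absSum_mul_le _ _).trans (mul_le_mul ((absSum_mul_le _ _).trans ?_) h2
        (absSum_nonneg _) (by positivity))
      rw [absSum_transpose]
      exact mul_le_mul h2 (hρ t ht s (hsub hs)) (absSum_nonneg _) (by positivity)
    refine h1.trans ?_
    rw [intervalIntegral.integral_const, smul_eq_mul]
    exact mul_le_mul_of_nonneg_right (by linarith [ht.1]) (by positivity)
  have hNd : (N - N').absSum ≤ ν * I t := by
    have h0 : N - N' = matIntegral t p.T fun s => V s - V' s := by
      ext i j
      simp only [hN, hN', Matrix.sub_apply, Matrix.add_apply, matIntegral, of_apply]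
      rw [intervalIntegral.integral_sub ((hint i j).intervalIntegrable_of_mem ht hTm)
        ((hint' i j).intervalIntegrable_of_mem ht hTm)]
      ring
    have hVi : ∀ i j, IntegrableOn (fun s => (V s - V' s) i j) (Icc 0 p.T) := fun i j =>
      (hint i j).sub (hint' i j)
    rw [h0]
    refine (absSum_matIntegral_le ht.2
      fun i j => (hVi i j).intervalIntegrable_of_mem ht hTm).trans ?_
    have h1 : ∫ s in t..p.T, (V s - V' s).absSum ≤
        ∫ s in t..p.T, ρ * (ℓ * ζ + ℓ * ζ) * (ζ * (k s - k' s).absSum + ℓ * (δ * I t)) := by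
      refine intervalIntegral.integral_mono_ae_restrict ht.2
        ((matrix_integrableOn_absSum hVi).intervalIntegrable_of_mem ht hTm)
        ((((hdi.intervalIntegrable_of_mem ht hTm).const_mul _).add
          intervalIntegrable_const).const_mul _) ?_
      filter_upwards [ae_restrict_of_ae_restrict_of_subset hsub hkκ,
        ae_restrict_of_ae_restrict_of_subset hsub hk'κ,
        ae_restrict_mem measurableSet_Icc] with s h1 h1' hs
      have h2 := hYb k Z s h1 (hZb s (hsub hs))
      have h2' := hYb k' Z' s h1' (hZb' s (hsub hs))
      refine (absSum_sandwich_sub_le _ _ _).trans ?_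
      refine mul_le_mul (mul_le_mul (hρ t ht s (hsub hs)) (add_le_add h2 h2')
        (add_nonneg (absSum_nonneg _) (absSum_nonneg _)) hρ0) ?_ (absSum_nonneg _) (by positivity)
      have h3 : augment (k s) * Z s - augment (k' s) * Z' s =
          (augment (k s) - augment (k' s)) * Z s + augment (k' s) * (Z s - Z' s) := by
        simp only [Matrix.sub_mul, Matrix.mul_sub]; abel
      rw [h3]
      refine (absSum_add_le _ _).trans (add_le_add ?_ ?_)
      · refine (absSum_mul_le _ _).trans ?_
        rw [absSum_augment_sub, mul_comm]
        exact mul_le_mul_of_nonneg_right (hZb s (hsub hs)) (absSum_nonneg _)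
      · refine (absSum_mul_le _ _).trans (mul_le_mul ?_ ((hZd s (hsub hs)).trans ?_)
          (absSum_nonneg _) hℓ0)
        · rw [absSum_augment]
          exact add_le_add_right h1' _
        · exact mul_le_mul_of_nonneg_left (hImono s hs) hδ0
    refine h1.trans ?_
    rw [intervalIntegral.integral_const_mul, intervalIntegral.integral_add
      ((hdi.intervalIntegrable_of_mem ht hTm).const_mul _) intervalIntegrable_const,
      intervalIntegral.integral_const_mul, intervalIntegral.integral_const, smul_eq_mul]
    have h4 : (p.T - t) * (ℓ * (δ * I t)) ≤ p.T * (ℓ * (δ * I t)) :=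
      mul_le_mul_of_nonneg_right (by linarith [ht.1])
        (mul_nonneg hℓ0 (mul_nonneg hδ0 (hI0 t ht)))
    calc _ ≤ ρ * (ℓ * ζ + ℓ * ζ) * (ζ * I t + p.T * (ℓ * (δ * I t))) := by
          refine mul_le_mul_of_nonneg_left ?_ (by positivity)
          linarith
      _ = _ := by ring
  have hsplit : p.costMat k Z W t t - p.costMat k' Z' W' t t =
      ((W t)ᵀ * N * W t - (W' t)ᵀ * N * W' t) + (W' t)ᵀ * (N - N') * W' t := by
    change (W t)ᵀ * N * W t - (W' t)ᵀ * N' * W' t = _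
    simp only [Matrix.mul_sub, Matrix.sub_mul]; abel
  rw [hsplit]
  have h5 : ((W t)ᵀ * N * W t - (W' t)ᵀ * N * W' t).absSum ≤ ν₀ * (ζ + ζ) * (δ * I t) := by
    refine (absSum_sandwich_sub_le _ _ _).trans (mul_le_mul (mul_le_mul hNb
      (add_le_add (hWb t ht) (hWb' t ht)) (add_nonneg (absSum_nonneg _) (absSum_nonneg _))
      (by positivity)) (hWd t ht) (absSum_nonneg _) (by positivity))
  have h6 : ((W' t)ᵀ * (N - N') * W' t).absSum ≤ ζ * (ν * I t) * ζ := by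
    have hI0' := hI0 t ht
    refine (absSum_mul_le _ _).trans (mul_le_mul ((absSum_mul_le _ _).trans ?_) (hWb' t ht)
      (absSum_nonneg _) (by positivity))
    rw [absSum_transpose]
    exact mul_le_mul (hWb' t ht) hNd (absSum_nonneg _) hζ0
  refine (absSum_add_le _ _).trans ((add_le_add h5 h6).trans (le_of_eq ?_))
  ring

end Standing

end LQProblem

/-! ### Truncated gains and the truncated fixed point problem. -/

/-- The factor of the radial retraction onto the ball of radius `R`. -/
def cutoff {ι κ : Type*} [Fintype ι] [Fintype κ] (R : ℝ) (P : Matrix ι κ ℝ) : ℝ :=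
  R / max R P.absSum

section Cutoff

variable {ι κ : Type*} [Fintype ι] [Fintype κ] {R : ℝ}

theorem cutoff_pos (hR : 0 < R) (P : Matrix ι κ ℝ) : 0 < cutoff R P :=
  div_pos hR (lt_max_of_lt_left hR)

theorem cutoff_le_one (hR : 0 < R) (P : Matrix ι κ ℝ) : cutoff R P ≤ 1 :=
  (div_le_one (lt_max_of_lt_left hR)).2 (le_max_left _ _)

theorem cutoff_eq_one (hR : 0 < R) {P : Matrix ι κ ℝ} (hP : P.absSum ≤ R) : cutoff R P = 1 := by
  rw [cutoff, max_eq_left hP, div_self hR.ne']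

theorem absSum_cutoff_smul_le (hR : 0 < R) (P : Matrix ι κ ℝ) : (cutoff R P • P).absSum ≤ R := by
  rw [absSum_smul, abs_of_pos (cutoff_pos hR P), cutoff, div_mul_eq_mul_div,
    div_le_iff₀ (lt_max_of_lt_left hR)]
  exact mul_le_mul_of_nonneg_left (le_max_right _ _) hR.le

theorem abs_cutoff_sub_le (hR : 0 < R) (P P' : Matrix ι κ ℝ) :
    |cutoff R P - cutoff R P'| * max R P'.absSum ≤ (P - P').absSum := by
  have ha : 0 < max R P.absSum := lt_max_of_lt_left hR
  have ha' : 0 < max R P'.absSum := lt_max_of_lt_left hR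
  have h1 : |max R P'.absSum - max R P.absSum| ≤ (P - P').absSum := by
    have h2 := absSum_add_le (P - P') P'
    have h3 := absSum_add_le (P' - P) P
    rw [sub_add_cancel] at h2 h3
    rw [absSum_sub_comm P' P] at h3
    rw [max_comm R, max_comm R]
    exact (abs_max_sub_max_le_abs _ _ _).trans (abs_le.2 ⟨by linarith, by linarith⟩)
  have h4 : cutoff R P - cutoff R P' =
      R / max R P.absSum * (max R P'.absSum - max R P.absSum) / max R P'.absSum := by
    rw [cutoff, cutoff]; field_simp
  rw [h4, abs_div, abs_of_pos ha', div_mul_cancel₀ _ ha'.ne', abs_mul]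
  have h5 := cutoff_le_one hR P
  have h6 := cutoff_pos hR P
  rw [show R / max R P.absSum = cutoff R P from rfl, abs_of_pos h6]
  exact (mul_le_of_le_one_left (abs_nonneg _) h5).trans h1

theorem abs_cutoff_sub_le_div (hR : 0 < R) (P P' : Matrix ι κ ℝ) :
    |cutoff R P - cutoff R P'| ≤ (P - P').absSum / R := by
  rw [le_div_iff₀ hR]
  exact (mul_le_mul_of_nonneg_left (le_max_left _ _) (abs_nonneg _)).trans
    (abs_cutoff_sub_le hR P P')

theorem absSum_cutoff_smul_sub_le (hR : 0 < R) (P P' : Matrix ι κ ℝ) :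
    (cutoff R P • P - cutoff R P' • P').absSum ≤ 2 * (P - P').absSum := by
  have h1 : cutoff R P • P - cutoff R P' • P' =
      cutoff R P • (P - P') + (cutoff R P - cutoff R P') • P' := by
    rw [smul_sub, sub_smul]; abel
  rw [h1]
  refine (absSum_add_le _ _).trans ?_
  rw [absSum_smul, absSum_smul, abs_of_pos (cutoff_pos hR P)]
  have h2 := mul_le_of_le_one_left (P - P').absSum_nonneg (cutoff_le_one hR P)
  have h3 := (mul_le_mul_of_nonneg_left (le_max_right R P'.absSum)
    (abs_nonneg (cutoff R P - cutoff R P'))).trans (abs_cutoff_sub_le hR P P')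
  linarith

theorem continuousOn_cutoff (hR : 0 < R) {X : Type*} [TopologicalSpace X] {P : X → Matrix ι κ ℝ}
    {u : Set X} (hP : ContinuousOn P u) : ContinuousOn (fun s => cutoff R (P s)) u :=
  continuousOn_const.div (continuousOn_const.sup hP.matrix_absSum)
    fun _ _ => (lt_max_of_lt_left hR).ne'

end Cutoff

namespace LQProblem

variable {n m : ℕ} (p : LQProblem n m)

/-- `P t` is the matrix of the cost at time `t`, with the preferences of time `t`, of the linear
feedback with gain `k`. -/
def HasCost (k : ℝ → Matrix (Fin m) (Fin n) ℝ) (P : ℝ → Matrix (Fin n) (Fin n) ℝ) : Prop :=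
  ∃ Z W, IsFundamental (p.closedLoop k) Z W 0 p.T ∧ ∀ t ∈ Icc 0 p.T, P t = p.costMat k Z W t t

/-- The truncated equilibrium gain. -/
def truncGain (R : ℝ) (P : ℝ → Matrix (Fin n) (Fin n) ℝ) (s : ℝ) : Matrix (Fin m) (Fin n) ℝ :=
  -(cutoff R (P s) • p.Upsilon P s)

variable {p}

namespace Standing

variable (h : p.Standing)
include h

theorem M_inv_continuousOn : ContinuousOn (fun s => (p.M s s)⁻¹) (Icc 0 p.T) := by
  have h1 : ContinuousOn (fun s => p.M s s) (Icc 0 p.T) := continuousOn_matrix fun i j =>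
    continuousOn_diag (f := fun t s => p.M t s i j) (h.h2.1 i j).continuousOn
  have h2 : ContinuousOn (fun s => (p.M s s).det) (Icc 0 p.T) :=
    continuous_id.matrix_det.comp_continuousOn h1
  have h3 : ContinuousOn (fun s => (p.M s s).adjugate) (Icc 0 p.T) :=
    continuous_id.matrix_adjugate.comp_continuousOn h1
  simp only [Matrix.inv_def, Ring.inverse_eq_inv']
  exact (h2.inv₀ fun s hs => (h.h2.2 s hs s hs).det_pos.ne').smul h3

theorem S_diag_continuousOn : ContinuousOn (fun s => p.S s s) (Icc 0 p.T) :=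
  continuousOn_matrix fun i j =>
    continuousOn_diag (f := fun t s => p.S t s i j) (h.h4 i j).continuousOn

theorem upsilon_essBdd {P : ℝ → Matrix (Fin n) (Fin n) ℝ} (hP : ContinuousOn P (Icc 0 p.T)) :
    MatEssBdd p.T (p.Upsilon P) := by
  have hB : MatEssBdd p.T p.B := h.h1.2
  exact (MatEssBdd.of_continuousOn h.M_inv_continuousOn).mul
    ((hB.transpose.mul (MatEssBdd.of_continuousOn hP)).add
      (MatEssBdd.of_continuousOn h.S_diag_continuousOn))

theorem truncGain_essBdd {R : ℝ} (hR : 0 < R) {P : ℝ → Matrix (Fin n) (Fin n) ℝ}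
    (hP : ContinuousOn P (Icc 0 p.T)) : MatEssBdd p.T (p.truncGain R P) :=
  (MatEssBdd.smul (continuousOn_cutoff hR hP) (h.upsilon_essBdd hP)).neg

/-- The cutoff multiplies all of `Υ`, so it can be moved onto `P` and onto `S`; the retraction of
`P` is Lipschitz with constant `2` and the cutoff itself with constant `1/R`. Only the values of `P`
and `P'` at `s` enter, hence one null set serves all functions. -/
theorem exists_truncGain_le {R : ℝ} (hR : 0 < R) : ∃ κ lam : ℝ, 0 ≤ κ ∧ 0 ≤ lam ∧
    ∀ᵐ s ∂volume.restrict (Icc 0 p.T), ∀ P P' : ℝ → Matrix (Fin n) (Fin n) ℝ,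
      (p.truncGain R P s).absSum ≤ κ ∧
      (p.truncGain R P s - p.truncGain R P' s).absSum ≤ lam * (P s - P' s).absSum := by
  obtain ⟨β, hβ0, hβ⟩ := MatEssBdd.exists_absSum_le (T := p.T) (F := p.B) h.h1.2
  obtain ⟨μ, hμ0, hμ⟩ := (MatEssBdd.of_continuousOn h.M_inv_continuousOn).exists_absSum_le
  obtain ⟨σ, hσ0, hσ⟩ := (MatEssBdd.of_continuousOn h.S_diag_continuousOn).exists_absSum_le
  refine ⟨μ * (β * R + σ), μ * (β * 2 + σ / R), by positivity, by positivity, ?_⟩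
  filter_upwards [hβ, hμ, hσ] with s hβ hμ hσ P P'
  have hform : ∀ P : ℝ → Matrix (Fin n) (Fin n) ℝ, p.truncGain R P s =
      -((p.M s s)⁻¹ * ((p.B s)ᵀ * (cutoff R (P s) • P s) + cutoff R (P s) • p.S s s)) := fun P => by
    rw [truncGain, Upsilon, ← Matrix.mul_smul, smul_add, Matrix.mul_smul (p.B s)ᵀ]
  constructor
  · rw [hform, absSum_neg]
    refine (absSum_mul_le _ _).trans (mul_le_mul hμ ((absSum_add_le _ _).trans
      (add_le_add ((absSum_mul_le _ _).trans ?_) ?_)) (absSum_nonneg _) hμ0)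
    · rw [absSum_transpose]
      exact mul_le_mul hβ (absSum_cutoff_smul_le hR _) (absSum_nonneg _) hβ0
    · rw [absSum_smul, abs_of_pos (cutoff_pos hR _)]
      exact (mul_le_of_le_one_left (absSum_nonneg _) (cutoff_le_one hR _)).trans hσ
  · have hd : p.truncGain R P s - p.truncGain R P' s =
        -((p.M s s)⁻¹ * ((p.B s)ᵀ * (cutoff R (P s) • P s - cutoff R (P' s) • P' s) +
          (cutoff R (P s) - cutoff R (P' s)) • p.S s s)) := by
      rw [hform, hform]
      simp only [Matrix.mul_add, Matrix.mul_sub, sub_smul]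
      abel
    rw [hd, absSum_neg, mul_assoc]
    refine (absSum_mul_le _ _).trans (mul_le_mul hμ ((absSum_add_le _ _).trans ?_)
      (absSum_nonneg _) hμ0)
    rw [add_mul]
    refine add_le_add ((absSum_mul_le _ _).trans ?_) ?_
    · rw [absSum_transpose, mul_assoc]
      exact mul_le_mul hβ (absSum_cutoff_smul_sub_le hR _ _) (absSum_nonneg _) hβ0
    · rw [absSum_smul, mul_comm, div_mul_eq_mul_div, mul_div_assoc]
      exact mul_le_mul hσ (abs_cutoff_sub_le_div hR _ _) (abs_nonneg _) hσ0

/-- Only the values after `t` matter. This Volterra structure yields existence by the weighted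
contraction and uniqueness by Gronwall. -/
theorem exists_truncated_lipschitz {R : ℝ} (hR : 0 < R) : ∃ c, 0 ≤ c ∧
    ∀ P P' Z W Z' W' : ℝ → Matrix (Fin n) (Fin n) ℝ,
      ContinuousOn P (Icc 0 p.T) → ContinuousOn P' (Icc 0 p.T) →
      IsFundamental (p.closedLoop (p.truncGain R P)) Z W 0 p.T →
      IsFundamental (p.closedLoop (p.truncGain R P')) Z' W' 0 p.T →
      ∀ t ∈ Icc 0 p.T,
        (p.costMat (p.truncGain R P) Z W t t - p.costMat (p.truncGain R P') Z' W' t t).absSum ≤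
          c * ∫ s in t..p.T, (P s - P' s).absSum := by
  obtain ⟨κ, lam, hκ0, hlam0, hae⟩ := h.exists_truncGain_le hR
  obtain ⟨c, hc0, hc⟩ := h.exists_costMat_lipschitz hκ0
  refine ⟨c * lam, by positivity, fun P P' Z W Z' W' hP hP' hZ hZ' t ht => ?_⟩
  have hTm : p.T ∈ Icc 0 p.T := right_mem_Icc.2 h.T_pos.le
  have hk := h.truncGain_essBdd hR hP
  have hk' := h.truncGain_essBdd hR hP'
  refine (hc _ _ Z W Z' W' hk hk' (hae.mono fun s hs => (hs P P').1)
    (hae.mono fun s hs => (hs P' P).1) hZ hZ' t ht).trans ?_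
  rw [mul_assoc]
  refine mul_le_mul_of_nonneg_left ?_ hc0
  rw [← intervalIntegral.integral_const_mul]
  refine intervalIntegral.integral_mono_ae_restrict ht.2
    ((matrix_integrableOn_absSum fun i j =>
      ((hk i j).sub (hk' i j)).integrable le_top).intervalIntegrable_of_mem ht hTm)
    (((ContinuousOn.matrix_absSum (hP.sub hP')).integrableOn_compact
      isCompact_Icc).intervalIntegrable_of_mem ht hTm |>.const_mul _) ?_
  filter_upwards [ae_restrict_of_ae_restrict_of_subset (Icc_subset_Icc_left ht.1) hae] with s hs
  exact (hs P P').2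

theorem exists_isFundamental_closedLoop {k : ℝ → Matrix (Fin m) (Fin n) ℝ} (hk : p.IsGain k) :
    ∃ Z W, IsFundamental (p.closedLoop k) Z W 0 p.T :=
  exists_isFundamental h.T_pos.le (h.integrableOn_closedLoop hk)

theorem exists_truncated {R : ℝ} (hR : 0 < R) : ∃ P : ℝ → Matrix (Fin n) (Fin n) ℝ,
    ContinuousOn P (Icc 0 p.T) ∧ p.HasCost (p.truncGain R P) P := by
  obtain ⟨c, hc0, hc⟩ := h.exists_truncated_lipschitz hR
  -- The operator must be defined on all functions. Discontinuous ones receive the pair `(0, 0)`,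
  -- which plays no role.
  have hex : ∀ f : ℝ → Fin n → Fin n → ℝ, ∃ ZW : (ℝ → Matrix (Fin n) (Fin n) ℝ) ×
      (ℝ → Matrix (Fin n) (Fin n) ℝ), ContinuousOn f (Icc 0 p.T) →
        IsFundamental (p.closedLoop (p.truncGain R fun s => Matrix.of (f s))) ZW.1 ZW.2 0 p.T := by
    intro f
    by_cases hf : ContinuousOn f (Icc 0 p.T)
    · obtain ⟨Z, W, hZ⟩ := h.exists_isFundamental_closedLoop (IsGain.of_essBdd
        (h.truncGain_essBdd hR (P := fun s => Matrix.of (f s)) hf))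
      exact ⟨(Z, W), fun _ => hZ⟩
    · exact ⟨(0, 0), fun hf' => absurd hf' hf⟩
  choose ZW hZW using hex
  obtain ⟨f, hf, hfix⟩ := exists_volterra_fixedPoint (E := Fin n → Fin n → ℝ) h.T_pos.le
    -- The factor `n * n` compares the entrywise sum norm with the supremum norm of `E`.
    (h := fun _ => c * (n * n))
    (continuousOn_const.integrableOn_compact isCompact_Icc)
    (Eventually.of_forall fun _ => by positivity)
    (fun f t i j => p.costMat (p.truncGain R fun s => Matrix.of (f s)) (ZW f).1 (ZW f).2 t t i j)
    (fun f hf => (h.costMat_diag_primitive (IsGain.of_essBdd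
        (h.truncGain_essBdd hR (P := fun s => Matrix.of (f s)) hf)) (hZW f hf)).continuousOn)
    (fun f g hf hg t ht => by
      have h1 := hc (fun s => Matrix.of (f s)) (fun s => Matrix.of (g s)) _ _ _ _ hf hg
        (hZW f hf) (hZW g hg) t ht
      have hTm : p.T ∈ Icc 0 p.T := right_mem_Icc.2 h.T_pos.le
      have h2 : c * ∫ s in t..p.T, (Matrix.of (f s) - Matrix.of (g s)).absSum ≤
          ∫ s in t..p.T, c * (n * n) * ‖f s - g s‖ := by
        rw [← intervalIntegral.integral_const_mul]
        have hcf : ContinuousOn (fun s => Matrix.of (f s) - Matrix.of (g s)) (Icc 0 p.T) :=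
          hf.sub hg
        refine intervalIntegral.integral_mono_on ht.2 ?_ ?_ fun s hs => ?_
        · exact ((hcf.matrix_absSum.integrableOn_compact
            isCompact_Icc).intervalIntegrable_of_mem ht hTm).const_mul _
        · exact (((hf.sub hg).norm.integrableOn_compact
            isCompact_Icc).intervalIntegrable_of_mem ht hTm).const_mul _
        · rw [mul_assoc]
          refine mul_le_mul_of_nonneg_left ?_ hc0
          have := absSum_le (A := Matrix.of (f s) - Matrix.of (g s)) (c := ‖f s - g s‖)
            fun i j => (norm_le_pi_norm ((f s - g s) i) j).trans (norm_le_pi_norm (f s - g s) i)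
          simpa [mul_assoc] using this
      refine le_trans ?_ (h1.trans h2)
      refine (pi_norm_le_iff_of_nonneg (absSum_nonneg _)).2 fun i =>
        (pi_norm_le_iff_of_nonneg (absSum_nonneg _)).2 fun j => ?_
      exact abs_le_absSum (p.costMat
        (p.truncGain R fun s => Matrix.of (f s)) (ZW f).1 (ZW f).2 t t -
        p.costMat (p.truncGain R fun s => Matrix.of (g s)) (ZW g).1 (ZW g).2 t t) i j)
  exact ⟨fun s => Matrix.of (f s), hf, _, _, hZW f hf, fun t ht => (hfix t ht).symm⟩

theorem truncated_unique {R : ℝ} (hR : 0 < R) {P P' : ℝ → Matrix (Fin n) (Fin n) ℝ}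
    (hP : ContinuousOn P (Icc 0 p.T)) (hP' : ContinuousOn P' (Icc 0 p.T))
    (hc : p.HasCost (p.truncGain R P) P) (hc' : p.HasCost (p.truncGain R P') P') :
    EqOn P P' (Icc 0 p.T) := by
  obtain ⟨c, hc0, hlip⟩ := h.exists_truncated_lipschitz hR
  obtain ⟨Z, W, hZ, hZP⟩ := hc
  obtain ⟨Z', W', hZ', hZP'⟩ := hc'
  intro t ht
  have := gronwall_backward (φ := fun s => (P s - P' s).absSum) (h := fun _ => c) (c := 0)
    (ContinuousOn.matrix_absSum (hP.sub hP'))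
    (continuousOn_const.integrableOn_compact isCompact_Icc)
    (Eventually.of_forall fun _ => hc0) (fun t ht => by
      rw [zero_add, intervalIntegral.integral_const_mul, hZP t ht, hZP' t ht]
      exact hlip P P' Z W Z' W' hP hP' hZ hZ' t ht) t ht
  rw [zero_mul] at this
  exact sub_eq_zero.1 (eq_zero_of_absSum_le this)

end Standing

end LQProblem

/-! ### The a priori bound and the unique self-consistent cost matrix. -/

theorem single_quadratic {ι : Type*} [Fintype ι] [DecidableEq ι] (A : Matrix ι ι ℝ) (i j : ι) :
    Pi.single i 1 ⬝ᵥ (A *ᵥ Pi.single j 1) = A i j := by simp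

/-- Testing with `eᵢ ± eⱼ` gives `2 |A i j| ≤ A i i + A j j`. An upper bound on the diagonal thus
controls every entry. -/
theorem abs_apply_le_of_quadratic_nonneg {ι : Type*} [Fintype ι] [DecidableEq ι]
    {A : Matrix ι ι ℝ} (hs : Aᵀ = A) (h0 : ∀ x, 0 ≤ x ⬝ᵥ (A *ᵥ x)) {c : ℝ} (hc : ∀ i, A i i ≤ c)
    (i j : ι) : |A i j| ≤ c := by
  have hsym : A j i = A i j := congrFun (congrFun hs i) j
  have h1 := h0 (Pi.single i 1 + Pi.single j 1)
  have h2 := h0 (Pi.single i 1 - Pi.single j 1)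
  simp only [mulVec_add, mulVec_sub, dotProduct_add, dotProduct_sub, add_dotProduct, sub_dotProduct,
    single_quadratic, hsym] at h1 h2
  have h3 := hc i
  have h4 := hc j
  exact abs_le.2 ⟨by linarith, by linarith⟩

theorem MatPrimitiveOn.quadratic {ι : Type*} [Fintype ι] {N N' : ℝ → Matrix ι ι ℝ} {a b : ℝ}
    (h : MatPrimitiveOn N N' a b) (x : ι → ℝ) :
    IsPrimitiveOn (fun s => x ⬝ᵥ (N s *ᵥ x)) (fun s => x ⬝ᵥ (N' s *ᵥ x)) a b := by
  refine ((VecPrimitiveOn.const x).dotProduct (h.mulVec (VecPrimitiveOn.const x))).congr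
    (fun _ _ => rfl) (Eventually.of_forall fun s => ?_)
  simp

namespace LQProblem

variable {n m : ℕ} {p : LQProblem n m}

/-- Both the closed-loop equation and the running cost see the gain only almost everywhere. -/
theorem HasCost.congr {k k' : ℝ → Matrix (Fin m) (Fin n) ℝ} {P : ℝ → Matrix (Fin n) (Fin n) ℝ}
    (hP : p.HasCost k P) (hk : ∀ᵐ s ∂volume.restrict (Icc 0 p.T), k s = k' s) :
    p.HasCost k' P := by
  obtain ⟨Z, W, hZ, hZP⟩ := hP
  refine ⟨Z, W, hZ.congr (hk.mono fun s hs => by rw [closedLoop, closedLoop, hs]), fun t ht => ?_⟩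
  rw [hZP t ht, costMat, costMat]
  congr 3
  ext i j
  refine intervalIntegral.integral_congr_ae ?_
  filter_upwards [(ae_restrict_iff' measurableSet_Icc).1 hk] with s hs hst
  rw [uIoc_of_le ht.2] at hst
  rw [hs ⟨ht.1.trans hst.1.le, hst.2⟩]

namespace Standing

variable (h : p.Standing)
include h

omit h in
theorem costMat_terminal {k : ℝ → Matrix (Fin m) (Fin n) ℝ} {Z W : ℝ → Matrix (Fin n) (Fin n) ℝ}
    (hZ : IsFundamental (p.closedLoop k) Z W 0 p.T) (r : ℝ) : p.costMat k Z W r p.T = p.G r := by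
  have : (matIntegral p.T p.T fun s =>
      (augment (k s) * Z s)ᵀ * p.weight r s * (augment (k s) * Z s)) = 0 := by
    ext i j; simp [matIntegral]
  rw [costMat, this, hZ.right_end]
  simp

theorem hasCost_transpose_eq {k : ℝ → Matrix (Fin m) (Fin n) ℝ}
    {P : ℝ → Matrix (Fin n) (Fin n) ℝ} (hP : p.HasCost k P) {t : ℝ}
    (ht : t ∈ Icc 0 p.T) : (P t)ᵀ = P t := by
  obtain ⟨Z, W, hZ, hZP⟩ := hP
  rw [hZP t ht, h.costMat_transpose ht ht]

theorem hasCost_continuousOn {k : ℝ → Matrix (Fin m) (Fin n) ℝ} (hk : p.IsGain k)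
    {P : ℝ → Matrix (Fin n) (Fin n) ℝ} (hP : p.HasCost k P) : ContinuousOn P (Icc 0 p.T) := by
  obtain ⟨Z, W, hZ, hZP⟩ := hP
  exact (h.costMat_diag_primitive hk hZ).continuousOn.congr hZP

omit h in
theorem augment_quadratic (t s : ℝ) (k : Matrix (Fin m) (Fin n) ℝ) (y : Fin n → ℝ) :
    y ⬝ᵥ (((augment k)ᵀ * p.weight t s * augment k) *ᵥ y) =
      y ⬝ᵥ (p.Q t s *ᵥ y) + 2 * ((k *ᵥ y) ⬝ᵥ (p.S t s *ᵥ y))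
        + (k *ᵥ y) ⬝ᵥ (p.M t s *ᵥ (k *ᵥ y)) := by
  rw [quadratic_sandwich, augment, fromRows_mulVec, one_mulVec, weight, block_quadratic]

theorem M_mul_upsilon (P : ℝ → Matrix (Fin n) (Fin n) ℝ) {t : ℝ} (ht : t ∈ Icc 0 p.T) :
    p.M t t * p.Upsilon P t = (p.B t)ᵀ * P t + p.S t t := by
  rw [Upsilon, ← Matrix.mul_assoc, h.M_mul_inv ht ht, Matrix.one_mul]

/-- Since `BᵀP + S = MΥ`, the terms linear in the gain combine to `-2θ ⟨MΥy, Υy⟩` and the quadratic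
one is `θ² ⟨MΥy, Υy⟩`. For `0 ≤ θ ≤ 1` the gain can therefore only lower the value `⟨Qy, y⟩`,
whether it is truncated or not. -/
theorem riccati_quadratic {t θ : ℝ} (ht : t ∈ Icc 0 p.T) {k : Matrix (Fin m) (Fin n) ℝ}
    {P : ℝ → Matrix (Fin n) (Fin n) ℝ} (hP : (P t)ᵀ = P t) (hk : k = -(θ • p.Upsilon P t))
    (y : Fin n → ℝ) :
    y ⬝ᵥ (((augment k)ᵀ * p.weight t t * augment k) *ᵥ y)
      + y ⬝ᵥ (((p.B t * k)ᵀ * P t + P t * (p.B t * k)) *ᵥ y) =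
    y ⬝ᵥ (p.Q t t *ᵥ y)
      - (2 * θ - θ ^ 2) * ((p.Upsilon P t *ᵥ y) ⬝ᵥ (p.M t t *ᵥ (p.Upsilon P t *ᵥ y))) := by
  have h1 : k *ᵥ y = -(θ • (p.Upsilon P t *ᵥ y)) := by rw [hk, neg_mulVec, smul_mulVec]
  have h2 : y ⬝ᵥ (((p.B t * k)ᵀ * P t + P t * (p.B t * k)) *ᵥ y) =
      2 * ((k *ᵥ y) ⬝ᵥ (((p.B t)ᵀ * P t) *ᵥ y)) := by
    rw [add_mulVec, dotProduct_add, ← mulVec_mulVec, dotProduct_transpose_mulVec_eq,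
      ← mulVec_mulVec, ← mulVec_mulVec, ← mulVec_mulVec,
      dotProduct_mulVec_comm_of_symm hP y, ← mulVec_mulVec,
      dotProduct_transpose_mulVec_eq]
    ring
  have h3 : ((p.B t)ᵀ * P t) *ᵥ y + p.S t t *ᵥ y = p.M t t *ᵥ (p.Upsilon P t *ᵥ y) := by
    rw [← add_mulVec, ← h.M_mul_upsilon P ht, mulVec_mulVec]
  rw [h2, augment_quadratic]
  have h4 : (k *ᵥ y) ⬝ᵥ (((p.B t)ᵀ * P t) *ᵥ y) + (k *ᵥ y) ⬝ᵥ (p.S t t *ᵥ y) =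
      (k *ᵥ y) ⬝ᵥ (p.M t t *ᵥ (p.Upsilon P t *ᵥ y)) := by
    rw [← dotProduct_add, h3]
  rw [h1] at h4 ⊢
  simp only [mulVec_neg, mulVec_smul, neg_dotProduct, dotProduct_neg, smul_dotProduct,
    dotProduct_smul, smul_eq_mul] at h4 ⊢
  linear_combination 2 * h4

/-- The lower bound is `P ≥ 0`. The upper bound comes from comparison with the zero control:
transported by the flow of `A` alone, `P` decreases backward in time no faster than the integral of
`Q(s,s)` allows it to grow, because `costDrift` and `(2θ - θ²) ΥᵀMΥ` are both nonnegative. The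
constant does not depend on `θ`, so truncated and genuine solutions obey the same bound. -/
theorem exists_apriori_bound : ∃ R, 0 < R ∧ ∀ (P : ℝ → Matrix (Fin n) (Fin n) ℝ) (θ : ℝ → ℝ)
    (k : ℝ → Matrix (Fin m) (Fin n) ℝ), (∀ s, 0 ≤ θ s ∧ θ s ≤ 1) → p.IsGain k →
    (∀ s ∈ Icc 0 p.T, k s = -(θ s • p.Upsilon P s)) → p.HasCost k P →
    ∀ t ∈ Icc 0 p.T, (P t).absSum ≤ R := by
  have hT := h.T_pos
  have hTm : p.T ∈ Icc 0 p.T := right_mem_Icc.2 hT.le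
  obtain ⟨ZA, WA, hA⟩ := exists_isFundamental hT.le h.h1.1
  have hQc : ContinuousOn (fun s => p.Q s s) (Icc 0 p.T) := continuousOn_matrix fun i j =>
    continuousOn_diag (f := fun t s => p.Q t s i j) (h.h3.1 i j).continuousOn
  set q : ℝ → Matrix (Fin n) (Fin n) ℝ := fun s => (ZA s)ᵀ * p.Q s s * ZA s with hq
  have hqc : ContinuousOn q (Icc 0 p.T) := by
    have hZc := hA.left.continuousOn
    have hZt : ContinuousOn (fun s => (ZA s)ᵀ) (Icc 0 p.T) := hA.left.transpose.continuousOn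
    exact continuousOn_matrix fun i j => by
      simp only [hq, mul_apply]
      exact continuousOn_finsetSum _ fun x _ => (continuousOn_finsetSum _ fun y _ =>
        (hZt.matrix_entry i y).mul (hQc.matrix_entry y x)).mul (hZc.matrix_entry x j)
  obtain ⟨C, hC⟩ := isCompact_Icc.exists_bound_of_continuousOn hqc.matrix_absSum
  obtain ⟨w, hw⟩ := isCompact_Icc.exists_bound_of_continuousOn
    hA.right.continuousOn.matrix_absSum
  set c := ((p.G p.T).absSum + p.T * |C|) * (|w| * |w|)
  have hc0 : 0 ≤ c := by have := (p.G p.T).absSum_nonneg; positivity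
  -- The bound itself is `n * (n * c)`; adding one makes the radius positive also when it is zero.
  refine ⟨n * (n * c) + 1, by positivity, ?_⟩
  intro P θ k hθ hk hkθ hP t ht
  have hsym : ∀ s ∈ Icc 0 p.T, (P s)ᵀ = P s := fun s hs => h.hasCost_transpose_eq hP hs
  obtain ⟨Z, W, hZ, hZP⟩ := hP
  have hPp := (h.costMat_diag_primitive hk hZ).congr (fun s hs => (hZP s hs).symm)
    (Eventually.of_forall fun _ => rfl)
  have hconj := hA.conj_left hPp
  have hkey : ∀ x : Fin n → ℝ, x ⬝ᵥ (((ZA t)ᵀ * P t * ZA t) *ᵥ x) ≤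
      ((p.G p.T).absSum + p.T * |C|) * (‖x‖ * ‖x‖) := by
    intro x
    have hqp : IsPrimitiveOn (fun s => ∫ r in s..p.T, x ⬝ᵥ (q r *ᵥ x))
        (fun s => -(x ⬝ᵥ (q s *ᵥ x))) 0 p.T := by
      refine IsPrimitiveOn.of_integral_right (ContinuousOn.integrableOn_compact isCompact_Icc ?_)
        hT.le
      simp only [dotProduct, mulVec]
      exact continuousOn_finsetSum _ fun i _ => continuousOn_const.mul
        (continuousOn_finsetSum _ fun j _ => (hqc.matrix_entry i j).mul continuousOn_const)
    -- The function `s ↦ ⟨Z_AᵀPZ_A x, x⟩ - ∫ₛᵀ ⟨q x, x⟩` is nondecreasing: the terms with `A` cancel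
    -- by conjugation, those with `Q` against `q`, and what remains is nonnegative.
    have hmono := (((hconj.quadratic x).sub hqp).mono ht hTm).le_of_nonneg ht.2 (by
      filter_upwards [ae_restrict_mem measurableSet_Icc] with s hs
      have hs' : s ∈ Icc 0 p.T := ⟨ht.1.trans hs.1, hs.2⟩
      rw [sub_neg_eq_add, hq, quadratic_sandwich, quadratic_sandwich]
      set y := ZA s *ᵥ x
      have e1 : (p.costDrift k Z W s - (augment (k s))ᵀ * p.weight s s * augment (k s)) -
          ((p.closedLoop k s)ᵀ * p.costMat k Z W s s + p.costMat k Z W s s * p.closedLoop k s) +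
          ((p.A s)ᵀ * P s + P s * p.A s) =
          p.costDrift k Z W s - ((augment (k s))ᵀ * p.weight s s * augment (k s)
            + ((p.B s * k s)ᵀ * P s + P s * (p.B s * k s))) := by
        rw [← hZP s hs', closedLoop]
        simp only [transpose_add, Matrix.add_mul, Matrix.mul_add]
        abel
      have e2 := h.riccati_quadratic hs' (hsym s hs') (hkθ s hs') y
      have e3 := h.costDrift_nonneg hk hZ hs' y
      have e4 := (h.h2.2 s hs' s hs').posSemidef.quadratic_nonneg (p.Upsilon P s *ᵥ y)
      rw [e1, sub_mulVec, dotProduct_sub, add_mulVec, dotProduct_add, e2]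
      have e5 : 0 ≤ 2 * θ s - θ s ^ 2 := by
        obtain ⟨h1, h2⟩ := hθ s
        nlinarith
      have e6 := mul_nonneg e5 e4
      linarith)
    simp only [intervalIntegral.integral_same, sub_zero, hA.left_end, transpose_one,
      Matrix.one_mul, Matrix.mul_one, hZP p.T hTm, costMat_terminal hZ] at hmono
    have hG := (le_abs_self _).trans (abs_dotProduct_mulVec_le (p.G p.T) x x)
    have hqi : ∫ r in t..p.T, x ⬝ᵥ (q r *ᵥ x) ≤ p.T * |C| * (‖x‖ * ‖x‖) := by
      refine (le_abs_self _).trans ?_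
      rw [← Real.norm_eq_abs]
      refine (intervalIntegral.norm_integral_le_of_norm_le_const
        (C := |C| * (‖x‖ * ‖x‖)) fun r hr => ?_).trans ?_
      · rw [uIoc_of_le ht.2] at hr
        refine (abs_dotProduct_mulVec_le (q r) x x).trans
          (mul_le_mul_of_nonneg_right ?_ (by positivity))
        exact ((le_abs_self _).trans (hC r ⟨ht.1.trans hr.1.le, hr.2⟩)).trans (le_abs_self _)
      · rw [abs_of_nonneg (sub_nonneg.2 ht.2), mul_comm, ← mul_assoc]
        exact mul_le_mul_of_nonneg_right (mul_le_mul_of_nonneg_right (by linarith [ht.1])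
          (abs_nonneg _)) (by positivity)
    linarith
  have hdiag : ∀ i, P t i i ≤ c := fun i => by
    -- The vector `W_A(t) eᵢ` undoes the conjugation, leaving the diagonal entry of `P`.
    have h1 := hkey (WA t *ᵥ Pi.single i 1)
    rw [quadratic_sandwich, mulVec_mulVec, hA.mul_eq_one' ht, one_mulVec, single_quadratic] at h1
    refine h1.trans (mul_le_mul_of_nonneg_left ?_ ?_)
    · have h2 : ‖WA t *ᵥ (Pi.single i 1 : Fin n → ℝ)‖ ≤ |w| := by
        refine (norm_mulVec_le_absSum _ _).trans ?_
        have h3 : ‖(Pi.single i 1 : Fin n → ℝ)‖ ≤ 1 := by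
          refine (pi_norm_le_iff_of_nonneg zero_le_one).2 fun j => ?_
          by_cases hij : j = i
          · subst hij; simp
          · simp [Pi.single_eq_of_ne hij]
        exact (mul_le_of_le_one_right (absSum_nonneg _) h3).trans
          (((le_abs_self _).trans (hw t ht)).trans (le_abs_self _))
      exact mul_le_mul h2 h2 (norm_nonneg _) (abs_nonneg _)
    · have := (p.G p.T).absSum_nonneg; positivity
  have hfin := absSum_le (A := P t) (abs_apply_le_of_quadratic_nonneg (hsym t ht) (fun x => by
    rw [hZP t ht]; exact h.costMat_nonneg hk hZ ht x) hdiag)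
  simp only [Fintype.card_fin] at hfin
  linarith

/-- There is exactly one matrix function which is the cost matrix of its own feedback. -/
theorem exists_unique_hasCost : ∃ P : ℝ → Matrix (Fin n) (Fin n) ℝ,
    ContinuousOn P (Icc 0 p.T) ∧ p.HasCost (fun s => -p.Upsilon P s) P ∧
    ∀ P', ContinuousOn P' (Icc 0 p.T) → p.HasCost (fun s => -p.Upsilon P' s) P' →
      EqOn P' P (Icc 0 p.T) := by
  obtain ⟨R, hR, hbound⟩ := h.exists_apriori_bound
  have htrunc : ∀ P : ℝ → Matrix (Fin n) (Fin n) ℝ, (∀ t ∈ Icc 0 p.T, (P t).absSum ≤ R) →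
      ∀ᵐ s ∂volume.restrict (Icc 0 p.T), p.truncGain R P s = -p.Upsilon P s := fun P hP => by
    filter_upwards [ae_restrict_mem measurableSet_Icc] with s hs
    rw [truncGain, cutoff_eq_one hR (hP s hs), one_smul]
  obtain ⟨P, hPc, hP⟩ := h.exists_truncated hR
  -- The radius was chosen before truncating. The bound with `θ` equal to the cutoff shows that the
  -- truncation is never active on `P`.
  have hPR : ∀ t ∈ Icc 0 p.T, (P t).absSum ≤ R :=
    hbound P (fun s => cutoff R (P s)) _ (fun s => ⟨(cutoff_pos hR _).le, cutoff_le_one hR _⟩)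
      (IsGain.of_essBdd (h.truncGain_essBdd hR hPc)) (fun _ _ => rfl) hP
  refine ⟨P, hPc, hP.congr (htrunc P hPR), fun P' hPc' hP' => ?_⟩
  -- With `θ = 1` every self-consistent `P'` obeys the same bound, so it also solves the truncated
  -- problem, where uniqueness is known.
  have hPR' : ∀ t ∈ Icc 0 p.T, (P' t).absSum ≤ R :=
    hbound P' (fun _ => 1) _ (fun s => ⟨zero_le_one, le_rfl⟩)
      (IsGain.of_essBdd (h.upsilon_essBdd hPc').neg) (fun _ _ => by rw [one_smul]) hP'
  exact h.truncated_unique hR hPc' hPc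
    (hP'.congr ((htrunc P' hPR').mono fun s hs => hs.symm)) hP

end Standing

end LQProblem

/-! ### Equivalence of self-consistency and the Riccati equation. -/

theorem augment_sandwich {n m : ℕ} (Q : Matrix (Fin n) (Fin n) ℝ) (S : Matrix (Fin m) (Fin n) ℝ)
    (M : Matrix (Fin m) (Fin m) ℝ) (k : Matrix (Fin m) (Fin n) ℝ) :
    (augment k)ᵀ * fromBlocks Q Sᵀ S M * augment k = Q + Sᵀ * k + kᵀ * S + kᵀ * M * k := by
  rw [augment, transpose_fromRows, transpose_one, Matrix.fromCols_mul_fromBlocks,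
    fromCols_mul_fromRows]
  simp only [Matrix.one_mul, Matrix.mul_one, Matrix.add_mul]
  abel

theorem mul_matIntegral_mul {k l q r : ℕ} {a b : ℝ} (U : Matrix (Fin q) (Fin k) ℝ)
    {F : ℝ → Matrix (Fin k) (Fin l) ℝ} (V : Matrix (Fin l) (Fin r) ℝ)
    (hF : ∀ i j, IntervalIntegrable (fun s => F s i j) volume a b) :
    U * matIntegral a b F * V = matIntegral a b fun s => U * F s * V := by
  ext i j
  simp only [matIntegral, mul_apply, of_apply, Finset.sum_mul]
  have h1 : ∀ x y, IntervalIntegrable (fun s => U i y * F s y x * V x j) volume a b :=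
    fun x y => ((hF y x).const_mul _).mul_const _
  rw [intervalIntegral.integral_finsetSum fun x _ => ?_]
  · refine Finset.sum_congr rfl fun x _ => ?_
    rw [intervalIntegral.integral_finsetSum fun y _ => h1 x y]
    refine Finset.sum_congr rfl fun y _ => ?_
    rw [intervalIntegral.integral_mul_const, intervalIntegral.integral_const_mul]
  · have := IntervalIntegrable.sum Finset.univ fun y _ => h1 x y
    simpa [Finset.sum_fn] using this

theorem matIntegral_congr {k l : ℕ} {a b : ℝ} (hab : a ≤ b) {F H : ℝ → Matrix (Fin k) (Fin l) ℝ}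
    (h : ∀ s ∈ Icc a b, F s = H s) : matIntegral a b F = matIntegral a b H := by
  ext i j
  refine intervalIntegral.integral_congr fun s hs => ?_
  rw [uIcc_of_le hab] at hs
  simp only [h s hs]

theorem matIntegral_add {k l : ℕ} {a b : ℝ} {F H : ℝ → Matrix (Fin k) (Fin l) ℝ}
    (hF : ∀ i j, IntervalIntegrable (fun s => F s i j) volume a b)
    (hH : ∀ i j, IntervalIntegrable (fun s => H s i j) volume a b) :
    matIntegral a b (fun s => F s + H s) = matIntegral a b F + matIntegral a b H := by
  ext i j
  exact intervalIntegral.integral_add (hF i j) (hH i j)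

namespace LQProblem

variable {n m : ℕ} {p : LQProblem n m}

namespace Standing

variable (h : p.Standing)
include h

/-- Substituting `MΥ = BᵀP + S` and its transpose collapses all terms in `Υ` into the quadratic
Riccati term. The matrix `D` later becomes `costDrift`. -/
theorem riccati_rhs {t : ℝ} (ht : t ∈ Icc 0 p.T) {P : ℝ → Matrix (Fin n) (Fin n) ℝ}
    (hP : (P t)ᵀ = P t) (D : Matrix (Fin n) (Fin n) ℝ) :
    (D - (augment (-p.Upsilon P t))ᵀ * p.weight t t * augment (-p.Upsilon P t))
      - ((p.closedLoop (fun s => -p.Upsilon P s) t)ᵀ * P t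
        + P t * p.closedLoop (fun s => -p.Upsilon P s) t) =
    -((p.A t)ᵀ * P t + P t * p.A t + (p.Q t t - D)
      - (P t * p.B t + (p.S t t)ᵀ) * (p.M t t)⁻¹ * ((p.B t)ᵀ * P t + p.S t t)) := by
  have h1 := h.M_mul_upsilon P ht
  have h2 : (p.Upsilon P t)ᵀ * p.M t t = P t * p.B t + (p.S t t)ᵀ := by
    have := congrArg Matrix.transpose h1
    rw [transpose_mul, (h.h2.2 t ht t ht).posSemidef.transpose_eq, transpose_add, transpose_mul,
      transpose_transpose, hP] at this
    exact this
  have h3 : (p.M t t)⁻¹ * ((p.B t)ᵀ * P t + p.S t t) = p.Upsilon P t := rfl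
  rw [Matrix.mul_assoc _ (p.M t t)⁻¹, h3, weight, augment_sandwich]
  set U := p.Upsilon P t
  have h4 : Uᵀ * p.M t t * U = Uᵀ * ((p.B t)ᵀ * P t) + Uᵀ * p.S t t := by
    rw [Matrix.mul_assoc, h1, Matrix.mul_add]
  simp only [closedLoop, transpose_neg, transpose_add, transpose_mul, Matrix.mul_neg,
    Matrix.neg_mul, neg_neg, Matrix.add_mul, Matrix.mul_add, h4]
  simp only [Matrix.mul_assoc]
  abel

theorem integrableOn_drift {k : ℝ → Matrix (Fin m) (Fin n) ℝ} (hk : p.IsGain k)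
    {Z W P : ℝ → Matrix (Fin n) (Fin n) ℝ} (hZ : IsFundamental (p.closedLoop k) Z W 0 p.T)
    (hP : ContinuousOn P (Icc 0 p.T)) (i j : Fin n) :
    IntegrableOn (fun t => ((p.costDrift k Z W t - (augment (k t))ᵀ * p.weight t t * augment (k t))
      - ((p.closedLoop k t)ᵀ * P t + P t * p.closedLoop k t)) i j) (Icc 0 p.T) := by
  have h1 := h.costMat_diag_primitive hk hZ
  have hF := h.integrableOn_closedLoop hk
  have hlin : ∀ P : ℝ → Matrix (Fin n) (Fin n) ℝ, ContinuousOn P (Icc 0 p.T) → ∀ i j,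
      IntegrableOn (fun t => ((p.closedLoop k t)ᵀ * P t + P t * p.closedLoop k t) i j)
        (Icc 0 p.T) := fun P hP i j =>
    (matrix_integrableOn_mul_continuousOn (F := fun t => (p.closedLoop k t)ᵀ)
      (fun i j => hF j i) hP i j).add (matrix_integrableOn_continuousOn_mul hF hP i j)
  refine (((h1 i j).integrableOn.add (hlin _ h1.continuousOn i j)).sub (hlin P hP i j)).congr
    (Eventually.of_forall fun t => ?_)
  simp only [Pi.add_apply, Pi.sub_apply, Matrix.sub_apply]
  ring

omit h in
theorem transition_eq {k : ℝ → Matrix (Fin m) (Fin n) ℝ} (h' : p.Standing) (hk : p.IsGain k)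
    {Z W : ℝ → Matrix (Fin n) (Fin n) ℝ} (hZ : IsFundamental (p.closedLoop k) Z W 0 p.T)
    {Φ : ℝ → ℝ → Matrix (Fin n) (Fin n) ℝ} (hΦ : p.IsTransition (p.closedLoop k) Φ) {t s : ℝ}
    (ht : t ∈ Icc 0 p.T) (hs : s ∈ Icc 0 p.T) : Φ s t = Z s * W t := by
  obtain ⟨hc, heq⟩ := hΦ t ht
  have hY : MatPrimitiveOn (fun s => Φ s t) (fun s => p.closedLoop k s * Φ s t) 0 p.T :=
    fun i j => IsPrimitiveOn.of_sub
      (matrix_integrableOn_mul_continuousOn (h'.integrableOn_closedLoop hk) hc i j) ht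
      fun s hs => by
        simp only
        rw [heq s hs, heq t ht]; simp [matIntegral]
  have h1 : Φ t t = 1 := by
    rw [heq t ht]; ext i j; simp [matIntegral]
  have h2 := hZ.mat_eq ht hY hs
  rwa [h1, Matrix.mul_one] at h2

/-- In terms of the transition matrix, `costDrift` for the gain `-Υ` is the terminal part with the
derivative of `G` plus the two integrals of `Qbar`; the block product with the augmented gain yields
their integrands. -/
theorem qbar_eq {P : ℝ → Matrix (Fin n) (Fin n) ℝ} (hP : ContinuousOn P (Icc 0 p.T))
    {Z W : ℝ → Matrix (Fin n) (Fin n) ℝ}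
    (hZ : IsFundamental (p.closedLoop fun s => -p.Upsilon P s) Z W 0 p.T)
    {Φ : ℝ → ℝ → Matrix (Fin n) (Fin n) ℝ} {t : ℝ} (ht : t ∈ Icc 0 p.T)
    (hΦ : ∀ s ∈ Icc 0 p.T, Φ s t = Z s * W t) :
    p.Qbar P Φ t = p.Q t t - p.costDrift (fun s => -p.Upsilon P s) Z W t := by
  have hTm : p.T ∈ Icc 0 p.T := right_mem_Icc.2 h.T_pos.le
  have hk : p.IsGain fun s => -p.Upsilon P s := IsGain.of_essBdd (h.upsilon_essBdd hP).neg
  have hsub : Icc t p.T ⊆ Icc 0 p.T := Icc_subset_Icc_left ht.1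
  have hΦc : ContinuousOn (fun s => Φ s t) (Icc 0 p.T) := by
    refine (ContinuousOn.congr ?_ hΦ)
    exact (hZ.left.mul (MatPrimitiveOn.const (W t))).continuousOn
  have hU := h.upsilon_essBdd hP
  have hd : ∀ i j, ContinuousOn (fun s => p.weightDeriv t s i j) (Icc 0 p.T) :=
    h.weightDeriv_slice_continuousOn ht
  have hΦb := MatEssBdd.of_continuousOn hΦc
  have hQb : MatEssBdd p.T fun s => matDeriv₁ p.T p.Q t s :=
    MatEssBdd.of_continuousOn (continuousOn_matrix fun i j => hd (Sum.inl i) (Sum.inl j))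
  have hSb : MatEssBdd p.T fun s => matDeriv₁ p.T p.S t s :=
    MatEssBdd.of_continuousOn (continuousOn_matrix fun i j => hd (Sum.inr i) (Sum.inl j))
  have hMb : MatEssBdd p.T fun s => matDeriv₁ p.T p.M t s :=
    MatEssBdd.of_continuousOn (continuousOn_matrix fun i j => hd (Sum.inr i) (Sum.inr j))
  have hi1 : ∀ i j, IntervalIntegrable
      (fun s => ((Φ s t)ᵀ * matDeriv₁ p.T p.Q t s * Φ s t) i j) volume t p.T := fun i j =>
    (((hΦb.transpose.mul hQb).mul hΦb).integrableOn i j).intervalIntegrable_of_mem ht hTm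
  have hi2 : ∀ i j, IntervalIntegrable (fun s => ((Φ s t)ᵀ *
      ((p.Upsilon P s)ᵀ * matDeriv₁ p.T p.M t s * p.Upsilon P s
          - (p.Upsilon P s)ᵀ * matDeriv₁ p.T p.S t s
          - (matDeriv₁ p.T p.S t s)ᵀ * p.Upsilon P s) * Φ s t) i j) volume t p.T := fun i j => by
    have h1 := ((hU.transpose.mul hMb).mul hU).add
      (((hU.transpose.mul hSb).neg).add (hSb.transpose.mul hU).neg)
    have h2 := (((hΦb.transpose.mul h1).mul hΦb).integrableOn i j).intervalIntegrable_of_mem ht hTm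
    simpa only [sub_eq_add_neg, add_assoc] using h2
  have hdrift : p.costDrift (fun s => -p.Upsilon P s) Z W t =
      (Φ p.T t)ᵀ * matDeriv p.T p.G t * Φ p.T t +
        (matIntegral t p.T (fun s => (Φ s t)ᵀ * matDeriv₁ p.T p.Q t s * Φ s t) +
        matIntegral t p.T (fun s => (Φ s t)ᵀ *
        ((p.Upsilon P s)ᵀ * matDeriv₁ p.T p.M t s * p.Upsilon P s
          - (p.Upsilon P s)ᵀ * matDeriv₁ p.T p.S t s
          - (matDeriv₁ p.T p.S t s)ᵀ * p.Upsilon P s) * Φ s t)) := by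
    rw [← matIntegral_add hi1 hi2, costDrift, Matrix.mul_add, Matrix.add_mul]
    congr 1
    · rw [hΦ p.T hTm, hZ.left_end, Matrix.one_mul]
    · rw [mul_matIntegral_mul _ _ fun i j => (integrableOn_response hk hZ
        hd i j).intervalIntegrable_of_mem ht hTm]
      refine matIntegral_congr ht.2 fun s hs => ?_
      rw [← Matrix.add_mul, ← Matrix.mul_add, hΦ s (hsub hs)]
      have e1 : matDeriv₁ p.T p.Q t s + ((p.Upsilon P s)ᵀ * matDeriv₁ p.T p.M t s * p.Upsilon P s
          - (p.Upsilon P s)ᵀ * matDeriv₁ p.T p.S t s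
          - (matDeriv₁ p.T p.S t s)ᵀ * p.Upsilon P s) =
          (augment (-p.Upsilon P s))ᵀ * p.weightDeriv t s * augment (-p.Upsilon P s) := by
        rw [weightDeriv, augment_sandwich]
        simp only [transpose_neg, Matrix.mul_neg, Matrix.neg_mul, neg_neg]
        abel
      rw [e1]
      simp only [transpose_mul, Matrix.mul_assoc]
  rw [hdrift, Qbar]
  abel

/-- With the gain `-Υ(P)` held fixed, the Riccati equation is a linear Lyapunov equation for `P`.
The diagonal cost matrix of this gain solves the same equation with the same terminal value. -/
theorem hasCost_of_isRiccatiSolution {P : ℝ → Matrix (Fin n) (Fin n) ℝ}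
    (hP : p.IsRiccatiSolution P) : p.HasCost (fun s => -p.Upsilon P s) P := by
  obtain ⟨hPc, hPs, Φ, hΦ, hPeq⟩ := hP
  have hTm : p.T ∈ Icc 0 p.T := right_mem_Icc.2 h.T_pos.le
  have hk : p.IsGain fun s => -p.Upsilon P s := IsGain.of_essBdd (h.upsilon_essBdd hPc).neg
  obtain ⟨Z, W, hZ⟩ := h.exists_isFundamental_closedLoop hk
  have hF : (fun τ => p.A τ - p.B τ * p.Upsilon P τ) = p.closedLoop fun s => -p.Upsilon P s := by
    ext1 s; rw [closedLoop, Matrix.mul_neg, sub_eq_add_neg]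
  rw [hF] at hΦ
  refine ⟨Z, W, hZ, fun t ht => ?_⟩
  have hPT : P p.T = p.G p.T := by
    rw [hPeq p.T hTm]; ext i j; simp [matIntegral]
  have hPp : MatPrimitiveOn P (fun t => (p.costDrift (fun s => -p.Upsilon P s) Z W t -
      (augment (-p.Upsilon P t))ᵀ * p.weight t t * augment (-p.Upsilon P t))
      - ((p.closedLoop (fun s => -p.Upsilon P s) t)ᵀ * P t +
        P t * p.closedLoop (fun s => -p.Upsilon P s) t)) 0 p.T := by
    intro i j
    refine IsPrimitiveOn.of_backward (h.integrableOn_drift hk hZ hPc i j) h.T_pos.le fun t ht => ?_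
    have e1 : matIntegral t p.T (fun s =>
        (p.A s)ᵀ * P s + P s * p.A s + p.Qbar P Φ s
          - (P s * p.B s + (p.S s s)ᵀ) * (p.M s s)⁻¹ * ((p.B s)ᵀ * P s + p.S s s)) =
        matIntegral t p.T fun t => -((p.costDrift (fun s => -p.Upsilon P s) Z W t -
      (augment (-p.Upsilon P t))ᵀ * p.weight t t * augment (-p.Upsilon P t))
      - ((p.closedLoop (fun s => -p.Upsilon P s) t)ᵀ * P t +
        P t * p.closedLoop (fun s => -p.Upsilon P s) t)) := by
      refine matIntegral_congr ht.2 fun s hs => ?_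
      have hs' : s ∈ Icc 0 p.T := ⟨ht.1.trans hs.1, hs.2⟩
      rw [h.riccati_rhs hs' (hPs s hs'), neg_neg, h.qbar_eq hPc hZ hs'
        fun r hr => transition_eq h hk hZ hΦ hs' hr]
    rw [hPT, hPeq t ht, e1]
    simp only [Matrix.add_apply, matIntegral, of_apply, Matrix.neg_apply,
      intervalIntegral.integral_neg]
    rfl
  refine hZ.lyapunov_unique hPp (h.costMat_diag_primitive hk hZ) ?_ ht
  rw [hPT, costMat_terminal hZ]

theorem isRiccatiSolution_of_hasCost {P : ℝ → Matrix (Fin n) (Fin n) ℝ}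
    (hPc : ContinuousOn P (Icc 0 p.T)) (hP : p.HasCost (fun s => -p.Upsilon P s) P) :
    p.IsRiccatiSolution P := by
  have hTm : p.T ∈ Icc 0 p.T := right_mem_Icc.2 h.T_pos.le
  have hk : p.IsGain fun s => -p.Upsilon P s := IsGain.of_essBdd (h.upsilon_essBdd hPc).neg
  have hPs : ∀ t ∈ Icc 0 p.T, (P t)ᵀ = P t := fun t ht => h.hasCost_transpose_eq hP ht
  obtain ⟨Z, W, hZ, hZP⟩ := hP
  have hF : (fun τ => p.A τ - p.B τ * p.Upsilon P τ) = p.closedLoop fun s => -p.Upsilon P s := by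
    ext1 s; rw [closedLoop, Matrix.mul_neg, sub_eq_add_neg]
  -- The product `Z(s) W(t)` is the transition matrix; with it, the diagonal Lyapunov equation reads
  -- as the Riccati equation.
  refine ⟨hPc, hPs, fun s t => Z s * W t, ?_, fun t ht => ?_⟩
  · rw [hF]
    intro t ht
    have hY : MatPrimitiveOn (fun s => Z s * W t)
        (fun s => p.closedLoop (fun s => -p.Upsilon P s) s * (Z s * W t)) 0 p.T :=
      (hZ.left.mul (MatPrimitiveOn.const (W t))).congr (fun _ _ => rfl)
        (Eventually.of_forall fun s => by simp [Matrix.mul_assoc])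
    refine ⟨hY.continuousOn, fun s hs => ?_⟩
    ext i j
    have := (hY i j).sub_eq ht hs
    simp only [hZ.mul_eq_one' ht] at this
    simp only [Matrix.add_apply, matIntegral, of_apply, this]
    ring
  · have hPp := (h.costMat_diag_primitive hk hZ).congr (fun s hs => (hZP s hs).symm)
      (Eventually.of_forall fun _ => rfl)
    have e1 : matIntegral t p.T (fun s =>
        (p.A s)ᵀ * P s + P s * p.A s + p.Qbar P (fun s t => Z s * W t) s
          - (P s * p.B s + (p.S s s)ᵀ) * (p.M s s)⁻¹ * ((p.B s)ᵀ * P s + p.S s s)) =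
        matIntegral t p.T fun t => -((p.costDrift (fun s => -p.Upsilon P s) Z W t -
      (augment (-p.Upsilon P t))ᵀ * p.weight t t * augment (-p.Upsilon P t))
      - ((p.closedLoop (fun s => -p.Upsilon P s) t)ᵀ * P t +
        P t * p.closedLoop (fun s => -p.Upsilon P s) t)) := by
      refine matIntegral_congr ht.2 fun s hs => ?_
      have hs' : s ∈ Icc 0 p.T := ⟨ht.1.trans hs.1, hs.2⟩
      rw [h.riccati_rhs hs' (hPs s hs'), neg_neg, h.qbar_eq hPc hZ hs' fun r hr => rfl]
    rw [e1, ← costMat_terminal hZ p.T, ← hZP p.T hTm]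
    ext i j
    have := (hPp i j).sub_eq ht hTm
    simp only [Matrix.add_apply, matIntegral, of_apply, Matrix.neg_apply,
      intervalIntegral.integral_neg]
    rw [intervalIntegral.integral_congr (g := fun s => ((p.costDrift (fun s => -p.Upsilon P s) Z W s
      - (augment (-p.Upsilon P s))ᵀ * p.weight s s * augment (-p.Upsilon P s))
      - ((p.closedLoop (fun s => -p.Upsilon P s) s)ᵀ *
        p.costMat (fun s => -p.Upsilon P s) Z W s s +
        p.costMat (fun s => -p.Upsilon P s) Z W s s *
          p.closedLoop (fun s => -p.Upsilon P s) s)) i j), this]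
    · ring
    · intro s hs
      rw [uIcc_of_le ht.2] at hs
      simp only [hZP s ⟨ht.1.trans hs.1, hs.2⟩]

end Standing

end LQProblem

/-! ### States, completion of squares, and the effect of a perturbation on the cost. -/

theorem ContinuousOn.memLp_Icc {f : ℝ → ℝ} {a b : ℝ} (hf : ContinuousOn f (Icc a b))
    (q : ENNReal) : MemLp f q (volume.restrict (Icc a b)) := by
  obtain ⟨C, hC⟩ := isCompact_Icc.exists_bound_of_continuousOn hf
  refine MemLp.of_bound (hf.aestronglyMeasurable measurableSet_Icc) C ?_
  filter_upwards [ae_restrict_mem measurableSet_Icc] with s hs using hC s hs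

namespace LQProblem

variable {n m : ℕ} {p : LQProblem n m}

/-- The integrand by which the cost of a control exceeds the cost of the linear feedback with gain
`k`, where `w` is the deviation of the control from the feedback and `y` is the state. -/
def costGap (p : LQProblem n m) (k : ℝ → Matrix (Fin m) (Fin n) ℝ)
    (Z W : ℝ → Matrix (Fin n) (Fin n) ℝ) (t s : ℝ) (w : Fin m → ℝ) (y : Fin n → ℝ) : ℝ :=
  w ⬝ᵥ (p.M t s *ᵥ w) +
    2 * (w ⬝ᵥ ((p.M t s * k s + p.S t s + (p.B s)ᵀ * p.costMat k Z W t s) *ᵥ y))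

namespace Standing

variable (h : p.Standing)
include h

theorem integrableOn_stateDrift {t : ℝ} (ht : t ∈ Icc 0 p.T) {X : ℝ → Fin n → ℝ}
    {u : ℝ → Fin m → ℝ} (hX : ContinuousOn X (Icc t p.T))
    (hu : MemLp u 2 (volume.restrict (Icc t p.T))) (i : Fin n) :
    IntegrableOn (fun s => (p.A s *ᵥ X s + p.B s *ᵥ u s) i) (Icc t p.T) := by
  have hsub : Icc t p.T ⊆ Icc 0 p.T := Icc_subset_Icc_left ht.1
  simp only [Pi.add_apply, mulVec, dotProduct]
  refine (integrable_finsetSum _ fun j _ => ?_).add (integrable_finsetSum _ fun j _ => ?_)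
  · exact ((h.h1.1 i j).mono_set hsub).mul_continuousOn (continuousOn_pi.1 hX j) isCompact_Icc
  · exact ((memLp_pi_iff.1 hu j).mul' (r := 2)
      ((h.h1.2 i j).mono_measure (Measure.restrict_mono_set _ hsub))).integrable one_le_two

/-- The vector-valued integral can be taken entrywise since the integrand is integrable; this gives
access to the calculus of primitives. -/
theorem isState_iff {t : ℝ} (ht : t ∈ Icc 0 p.T) {x : Fin n → ℝ} {X : ℝ → Fin n → ℝ}
    {u : ℝ → Fin m → ℝ} : p.IsState t x u X ↔ MemLp u 2 (volume.restrict (Icc t p.T)) ∧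
      VecPrimitiveOn X (fun s => p.A s *ᵥ X s + p.B s *ᵥ u s) t p.T ∧ X t = x := by
  have key : ∀ (hX : ContinuousOn X (Icc t p.T)) (hu : MemLp u 2 (volume.restrict (Icc t p.T)))
      (s : ℝ) (hs : s ∈ Icc t p.T) (i : Fin n),
      (∫ τ in t..s, (p.A τ *ᵥ X τ + p.B τ *ᵥ u τ)) i =
        ∫ τ in t..s, (p.A τ *ᵥ X τ + p.B τ *ᵥ u τ) i := fun hX hu s hs i => by
    rw [intervalIntegral.integral_of_le hs.1, intervalIntegral.integral_of_le hs.1]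
    exact eval_integral (fun i => (h.integrableOn_stateDrift ht hX hu i).mono_set
      (Ioc_subset_Icc_self.trans (Icc_subset_Icc_right hs.2))) i
  constructor
  · rintro ⟨hu, hX, he⟩
    have h0 : X t = x := by rw [he t ⟨le_rfl, ht.2⟩, intervalIntegral.integral_same, add_zero]
    refine ⟨hu, fun i => ⟨h.integrableOn_stateDrift ht hX hu i, fun s hs => ?_⟩, h0⟩
    rw [h0, he s hs, Pi.add_apply, key hX hu s hs]
  · rintro ⟨hu, hX, h0⟩
    refine ⟨hu, hX.continuousOn, fun s hs => ?_⟩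
    ext i
    rw [Pi.add_apply, key hX.continuousOn hu s hs, ← h0, (hX i).eq_add s hs]

theorem integrableOn_runningCost {t : ℝ} (ht : t ∈ Icc 0 p.T) {X : ℝ → Fin n → ℝ}
    {u : ℝ → Fin m → ℝ} (hX : ContinuousOn X (Icc t p.T))
    (hu : MemLp u 2 (volume.restrict (Icc t p.T))) :
    IntegrableOn (fun s => X s ⬝ᵥ (p.Q t s *ᵥ X s) + 2 * (u s ⬝ᵥ (p.S t s *ᵥ X s))
      + u s ⬝ᵥ (p.M t s *ᵥ u s)) (Icc t p.T) := by
  have hsub : Icc t p.T ⊆ Icc 0 p.T := Icc_subset_Icc_left ht.1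
  have hz : ∀ i, MemLp (fun s => Sum.elim (X s) (u s) i) 2 (volume.restrict (Icc t p.T)) := by
    rintro (i | i)
    · exact (continuousOn_pi.1 hX i).memLp_Icc 2
    · exact memLp_pi_iff.1 hu i
  have : IntegrableOn (fun s => ∑ i, ∑ j, p.weight t s i j *
      (Sum.elim (X s) (u s) i * Sum.elim (X s) (u s) j)) (Icc t p.T) :=
    integrable_finsetSum _ fun i _ => integrable_finsetSum _ fun j _ =>
      (integrableOn_mul_of_memLp (hz i) (hz j)).continuousOn_mul
        ((h.weight_slice_continuousOn ht i j).mono hsub) isCompact_Icc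
  refine this.congr (Eventually.of_forall fun s => ?_)
  simp only
  rw [← block_quadratic, ← weight]
  simp only [mulVec, dotProduct, Finset.mul_sum]
  exact Finset.sum_congr rfl fun i _ => Finset.sum_congr rfl fun j _ => by ring

section Gap

variable {k : ℝ → Matrix (Fin m) (Fin n) ℝ} {Z W : ℝ → Matrix (Fin n) (Fin n) ℝ}
  (hk : p.IsGain k) (hZ : IsFundamental (p.closedLoop k) Z W 0 p.T)

omit h in
-- The last summand is the derivative of `⟨C(t,s) X(s), X(s)⟩` along the state equation. By the
-- Lyapunov equation, running cost plus this derivative vanishes for `u = k y`, so only the terms in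
-- the deviation remain.
theorem costGap_eq {t s : ℝ} (hM : (p.M t s)ᵀ = p.M t s)
    (hC : (p.costMat k Z W t s)ᵀ = p.costMat k Z W t s) (y : Fin n → ℝ) (u : Fin m → ℝ) :
    p.costGap k Z W t s (u - k s *ᵥ y) y =
      y ⬝ᵥ (p.Q t s *ᵥ y) + 2 * (u ⬝ᵥ (p.S t s *ᵥ y)) + u ⬝ᵥ (p.M t s *ᵥ u)
      + ((p.A s *ᵥ y + p.B s *ᵥ u) ⬝ᵥ (p.costMat k Z W t s *ᵥ y) +
        y ⬝ᵥ ((-((augment (k s))ᵀ * p.weight t s * augment (k s)) -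
          ((p.closedLoop k s)ᵀ * p.costMat k Z W t s + p.costMat k Z W t s * p.closedLoop k s))
            *ᵥ y + p.costMat k Z W t s *ᵥ (p.A s *ᵥ y + p.B s *ᵥ u))) := by
  rw [costGap]
  set C := p.costMat k Z W t s
  obtain ⟨w, rfl⟩ : ∃ w, u = k s *ᵥ y + w := ⟨u - k s *ᵥ y, by abel⟩
  simp only [add_sub_cancel_left]
  have e1 : p.A s *ᵥ y + p.B s *ᵥ (k s *ᵥ y + w) = p.closedLoop k s *ᵥ y + p.B s *ᵥ w := by
    rw [closedLoop, add_mulVec, mulVec_add, ← mulVec_mulVec, add_assoc]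
  have e2 : y ⬝ᵥ (((p.closedLoop k s)ᵀ * C) *ᵥ y) = (p.closedLoop k s *ᵥ y) ⬝ᵥ (C *ᵥ y) := by
    rw [← mulVec_mulVec, dotProduct_transpose_mulVec_eq]
  have e3 : y ⬝ᵥ (C *ᵥ (p.B s *ᵥ w)) = (p.B s *ᵥ w) ⬝ᵥ (C *ᵥ y) :=
    dotProduct_mulVec_comm_of_symm hC _ _
  have e4 : w ⬝ᵥ (((p.B s)ᵀ * C) *ᵥ y) = (p.B s *ᵥ w) ⬝ᵥ (C *ᵥ y) := by
    rw [← mulVec_mulVec, dotProduct_transpose_mulVec_eq]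
  have e5 := augment_quadratic (p := p) t s (k s) y
  have e6 : (k s *ᵥ y) ⬝ᵥ (p.M t s *ᵥ w) = w ⬝ᵥ (p.M t s *ᵥ (k s *ᵥ y)) :=
    dotProduct_mulVec_comm_of_symm hM _ _
  rw [e1]
  simp only [sub_mulVec, neg_mulVec, add_mulVec, dotProduct_add, dotProduct_sub, dotProduct_neg,
    add_dotProduct, mulVec_add, e2, e3, e4, e5]
  simp only [← mulVec_mulVec, e6]
  ring

include hk hZ

/-- Completion of squares. -/
theorem cost_eq {t : ℝ} (ht : t ∈ Icc 0 p.T) {x : Fin n → ℝ} {X : ℝ → Fin n → ℝ}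
    {u : ℝ → Fin m → ℝ} (hX : p.IsState t x u X) :
    IntegrableOn (fun s => p.costGap k Z W t s (u s - k s *ᵥ X s) (X s)) (Icc t p.T) ∧
    p.cost t X u = x ⬝ᵥ (p.costMat k Z W t t *ᵥ x) +
      ∫ s in t..p.T, p.costGap k Z W t s (u s - k s *ᵥ X s) (X s) := by
  obtain ⟨hu, hXp, h0⟩ := (h.isState_iff ht).1 hX
  have htm : t ∈ Icc t p.T := ⟨le_rfl, ht.2⟩
  have hTm : p.T ∈ Icc t p.T := ⟨ht.2, le_rfl⟩
  have hC := (h.costMat_primitive hk hZ ht).mono ht ⟨h.T_pos.le, le_rfl⟩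
  -- The form `⟨C(t,s) X(s), X(s)⟩` runs from `⟨C(t,t) x, x⟩` to the terminal cost, because `C(t,T)
  -- = G(t)`.
  have hf := hXp.dotProduct (hC.mulVec hXp)
  have hr := h.integrableOn_runningCost ht hXp.continuousOn hu
  have he : ∀ s ∈ Icc t p.T, _ := fun s hs => costGap_eq (k := k) (Z := Z) (W := W)
    (p := p) (t := t) (s := s) (h.h2.2 t ht s ⟨ht.1.trans hs.1, hs.2⟩).posSemidef.transpose_eq
    (h.costMat_transpose ht ⟨ht.1.trans hs.1, hs.2⟩) (X s) (u s)
  refine ⟨(hr.add hf.integrableOn).congr_fun (fun s hs => (he s hs).symm) measurableSet_Icc, ?_⟩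
  rw [intervalIntegral.integral_congr fun s hs => he s (by rwa [uIcc_of_le ht.2] at hs),
    intervalIntegral.integral_add (hr.intervalIntegrable_of_mem htm hTm)
      (hf.integrableOn.intervalIntegrable_of_mem htm hTm), hf.sub_eq htm hTm, h0,
    costMat_terminal hZ, cost]
  ring

end Gap

end Standing

theorem IsState.congr {t : ℝ} {x : Fin n → ℝ} {X : ℝ → Fin n → ℝ} {u u' : ℝ → Fin m → ℝ}
    (hX : p.IsState t x u X) (hu : EqOn u u' (Icc t p.T)) : p.IsState t x u' X := by
  obtain ⟨h1, h2, h3⟩ := hX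
  refine ⟨h1.ae_eq ?_, h2, fun s hs => ?_⟩
  · filter_upwards [ae_restrict_mem measurableSet_Icc] with s hs using hu hs
  · rw [h3 s hs]
    congr 1
    refine intervalIntegral.integral_congr fun τ hτ => ?_
    rw [uIcc_of_le hs.1] at hτ
    simp only [hu ⟨hτ.1, hτ.2.trans hs.2⟩]

theorem IsGain.zero : p.IsGain (fun _ => 0) := fun _ _ => MemLp.zero

theorem IsGain.memLp_mulVec {k : ℝ → Matrix (Fin m) (Fin n) ℝ} (hk : p.IsGain k) {t : ℝ}
    (ht : 0 ≤ t) {X : ℝ → Fin n → ℝ} (hX : ContinuousOn X (Icc t p.T)) :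
    MemLp (fun s => k s *ᵥ X s) 2 (volume.restrict (Icc t p.T)) := by
  refine memLp_pi_iff.2 fun i => ?_
  simp only [mulVec, dotProduct]
  refine memLp_finsetSum _ fun j _ => MemLp.mul' (p := 2) (q := ⊤) (r := 2)
    ((continuousOn_pi.1 hX j).memLp_Icc ⊤) ?_
  exact (hk i j).mono_measure (Measure.restrict_mono_set _ (Icc_subset_Icc_left ht))

/-- The perturbed feedback is affine in the state, so the linear theory provides its trajectory. -/
theorem perturb_linear {u : ℝ → (Fin n → ℝ) → Fin m → ℝ} {k : ℝ → Matrix (Fin m) (Fin n) ℝ}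
    (hu : ∀ s ∈ Icc 0 p.T, ∀ y, u s y = k s *ᵥ y) (t ε : ℝ) (v : Fin m → ℝ) {s : ℝ}
    (hs : s ∈ Icc 0 p.T) (y : Fin n → ℝ) : perturb u t ε v s y =
      (Ioi (t + ε)).indicator k s *ᵥ y + (Iic (t + ε)).indicator (fun _ => v) s := by
  by_cases hst : s ≤ t + ε
  · rw [perturb, if_pos hst, indicator_of_notMem (by simpa using hst), zero_mulVec,
      indicator_of_mem (show s ∈ Iic (t + ε) from hst), zero_add]
  · rw [perturb, if_neg hst, indicator_of_mem (by simpa using hst),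
      indicator_of_notMem (by simpa using hst), add_zero, hu s hs]

namespace Standing

variable (h : p.Standing)
include h

theorem exists_state {k : ℝ → Matrix (Fin m) (Fin n) ℝ} (hk : p.IsGain k) {c : ℝ → Fin m → ℝ}
    (hc : MemLp c 2 (volume.restrict (Icc 0 p.T))) {t : ℝ} (ht : t ∈ Icc 0 p.T)
    (x : Fin n → ℝ) : ∃ X, p.IsState t x (fun s => k s *ᵥ X s + c s) X := by
  obtain ⟨Z, W, hZ⟩ := h.exists_isFundamental_closedLoop hk
  have hc' : ∀ i, IntegrableOn (fun s => (p.B s *ᵥ c s) i) (Icc 0 p.T) := fun i => by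
    simp only [mulVec, dotProduct]
    exact integrable_finsetSum _ fun j _ => ((memLp_pi_iff.1 hc j).mul' (r := 2)
      (h.h1.2 i j)).integrable one_le_two
  obtain ⟨X, hX, h0⟩ := hZ.exists_affine hc' ht x
  refine ⟨X, (h.isState_iff ht).2 ⟨(hk.memLp_mulVec ht.1 hX.continuousOn).add
    (hc.mono_measure (Measure.restrict_mono_set _ (Icc_subset_Icc_left ht.1))),
    hX.congr (fun _ _ => rfl) (Eventually.of_forall fun s => ?_), h0⟩⟩
  simp only [closedLoop, add_mulVec, mulVec_add, mulVec_mulVec, add_assoc]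

/-- States driven by controls that agree on `[t,r]` agree there. -/
theorem state_unique {k : ℝ → Matrix (Fin m) (Fin n) ℝ} (hk : p.IsGain k) {t r : ℝ}
    (ht : t ∈ Icc 0 p.T) (hr : r ≤ p.T) {x : Fin n → ℝ} {X Y : ℝ → Fin n → ℝ}
    {u v c : ℝ → Fin m → ℝ} (hX : p.IsState t x u X) (hY : p.IsState t x v Y)
    (hu : ∀ s ∈ Icc t r, u s = k s *ᵥ X s + c s) (hv : ∀ s ∈ Icc t r, v s = k s *ᵥ Y s + c s) :
    EqOn X Y (Icc t r) := by
  intro s hs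
  obtain ⟨Z, W, hZ⟩ := h.exists_isFundamental_closedLoop hk
  obtain ⟨-, hX, hX0⟩ := (h.isState_iff ht).1 hX
  obtain ⟨-, hY, hY0⟩ := (h.isState_iff ht).1 hY
  have hD := ((hX.sub hY).mono ⟨le_rfl, ht.2⟩ ⟨hs.1.trans hs.2, hr⟩).congr (fun _ _ => rfl)
    (Y' := fun s => p.closedLoop k s *ᵥ (X s - Y s)) (by
      filter_upwards [ae_restrict_mem measurableSet_Icc] with s hs
      rw [hu s hs, hv s hs, closedLoop]
      simp only [add_mulVec, mulVec_add, mulVec_sub, mulVec_mulVec]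
      abel)
  have := hZ.vec_eq ht hr hD hs
  rwa [hX0, hY0, sub_self, mulVec_zero, sub_eq_zero] at this

section Linear

variable {k : ℝ → Matrix (Fin m) (Fin n) ℝ} (hk : p.IsGain k)
  {u : ℝ → (Fin n → ℝ) → Fin m → ℝ} (hu : ∀ s ∈ Icc 0 p.T, ∀ y, u s y = k s *ᵥ y)
include hk hu

theorem exists_trajectory {t : ℝ} (ht : t ∈ Icc 0 p.T) (x : Fin n → ℝ) :
    ∃ X, p.IsTrajectory u t x X := by
  obtain ⟨X, hX⟩ := h.exists_state hk (c := fun _ => 0) MemLp.zero ht x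
  exact ⟨X, hX.congr fun s hs => by
    simp only [hu s ⟨ht.1.trans hs.1, hs.2⟩, add_zero]⟩

theorem trajectory_unique {t : ℝ} (ht : t ∈ Icc 0 p.T) {x : Fin n → ℝ} {X Y : ℝ → Fin n → ℝ}
    (hX : p.IsTrajectory u t x X) (hY : p.IsTrajectory u t x Y) : EqOn X Y (Icc t p.T) :=
  h.state_unique hk ht le_rfl (c := fun _ => 0) hX hY
    (fun s hs => by rw [hu s ⟨ht.1.trans hs.1, hs.2⟩, add_zero])
    (fun s hs => by rw [hu s ⟨ht.1.trans hs.1, hs.2⟩, add_zero])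

variable {Z W : ℝ → Matrix (Fin n) (Fin n) ℝ} (hZ : IsFundamental (p.closedLoop k) Z W 0 p.T)
include hZ

theorem J_linear {t : ℝ} (ht : t ∈ Icc 0 p.T) (x : Fin n → ℝ) :
    p.J t x u = x ⬝ᵥ (p.costMat k Z W t t *ᵥ x) := by
  have hX : p.IsTrajectory u t x (p.trajectory u t x) :=
    Classical.epsilon_spec (h.exists_trajectory hk hu ht x)
  rw [J, (h.cost_eq hk hZ ht hX).2, intervalIntegral.integral_congr (g := fun _ => 0),
    intervalIntegral.integral_zero, add_zero]
  intro s hs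
  rw [uIcc_of_le ht.2] at hs
  simp only [hu s ⟨ht.1.trans hs.1, hs.2⟩, sub_self, costGap, zero_dotProduct, mul_zero, add_zero]

/-- After `t + ε` the perturbed control follows the feedback and the gap is zero. Before that, the
trajectory is the state `X` driven by the constant `v`, which does not depend on `ε`. -/
theorem J_perturb_sub {t : ℝ} (ht : t ∈ Icc 0 p.T) {x : Fin n → ℝ} {v : Fin m → ℝ}
    {X : ℝ → Fin n → ℝ} (hX : p.IsState t x (fun _ => v) X) {ε : ℝ} (hε : 0 ≤ ε)
    (hεT : t + ε ≤ p.T) : p.J t x (perturb u t ε v) - p.J t x u =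
      ∫ s in t..t + ε, p.costGap k Z W t s (v - k s *ᵥ X s) (X s) := by
  have hex : ∃ Y, p.IsTrajectory (perturb u t ε v) t x Y := by
    obtain ⟨Y, hY⟩ := h.exists_state (k := (Ioi (t + ε)).indicator k)
      (c := (Iic (t + ε)).indicator fun _ => v) (fun i j => by
        refine ((hk i j).indicator (measurableSet_Ioi (a := t + ε))).ae_eq
          (Eventually.of_forall fun s => ?_)
        by_cases hs : s ∈ Ioi (t + ε)
        · simp only [indicator_of_mem hs]
        · simp only [indicator_of_notMem hs, Matrix.zero_apply])
      ((memLp_const v).indicator measurableSet_Iic) ht x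
    exact ⟨Y, hY.congr fun s hs => (perturb_linear hu t ε v ⟨ht.1.trans hs.1, hs.2⟩ _).symm⟩
  have hY : p.IsTrajectory (perturb u t ε v) t x (p.trajectory (perturb u t ε v) t x) :=
    Classical.epsilon_spec hex
  set Y := p.trajectory (perturb u t ε v) t x with hYdef
  have hYX : EqOn Y X (Icc t (t + ε)) :=
    h.state_unique IsGain.zero ht hεT (c := fun _ => v) hY hX
      (fun s hs => by simp [perturb, hs.2]) (fun s hs => by simp)
  obtain ⟨hi, hc⟩ := h.cost_eq hk hZ ht hY
  have h1 : t ∈ Icc t p.T := ⟨le_rfl, ht.2⟩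
  have h2 : p.T ∈ Icc t p.T := ⟨ht.2, le_rfl⟩
  have h3 : t + ε ∈ Icc t p.T := ⟨by linarith, hεT⟩
  rw [h.J_linear hk hu hZ ht, J, ← hYdef, hc, add_sub_cancel_left,
    ← intervalIntegral.integral_add_adjacent_intervals (hi.intervalIntegrable_of_mem h1 h3)
      (hi.intervalIntegrable_of_mem h3 h2)]
  have e1 : ∫ s in (t + ε)..p.T, p.costGap k Z W t s (perturb u t ε v s (Y s) - k s *ᵥ Y s) (Y s) =
      0 := by
    rw [intervalIntegral.integral_of_le hεT]
    refine (setIntegral_congr_fun (g := fun _ => 0) measurableSet_Ioc fun s hs => ?_).trans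
      (by simp)
    simp only [perturb, if_neg (not_le.2 hs.1), hu s ⟨h3.1.trans' ht.1 |>.trans hs.1.le, hs.2⟩,
      sub_self, costGap, zero_dotProduct, mul_zero, add_zero]
  rw [e1, add_zero]
  refine intervalIntegral.integral_congr fun s hs => ?_
  rw [uIcc_of_le h3.1] at hs
  simp only [perturb, if_pos hs.2, hYX hs]

end Linear

end Standing

end LQProblem

/-! ### Right averages and square-integrable Lebesgue points. -/

/-- The averages of `f` over `[t,t+ε]` tend to `a` as `ε` tends to zero from the right. -/
structure HasRightMean (f : ℝ → ℝ) (t b a : ℝ) : Prop where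
  integrableOn : IntegrableOn f (Icc t b)
  tendsto : Tendsto (fun ε => ε⁻¹ * ∫ s in t..t + ε, f s) (𝓝[>] 0) (𝓝 a)

theorem eventually_add_le {t b : ℝ} (h : t < b) : ∀ᶠ ε in 𝓝[>] (0 : ℝ), 0 < ε ∧ t + ε ≤ b := by
  filter_upwards [Ioc_mem_nhdsGT (sub_pos.2 h)] with ε hε using ⟨hε.1, by linarith [hε.2]⟩

theorem MeasureTheory.IntegrableOn.intervalIntegrable_add {f : ℝ → ℝ} {t b ε : ℝ}
    (hf : IntegrableOn f (Icc t b)) (hε : 0 < ε) (hb : t + ε ≤ b) :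
    IntervalIntegrable f volume t (t + ε) :=
  hf.intervalIntegrable_of_mem ⟨le_rfl, by linarith⟩ ⟨by linarith, hb⟩

namespace HasRightMean

variable {f g ψ c : ℝ → ℝ} {t b a a' : ℝ}

theorem congr (hf : HasRightMean f t b a) (hfg : ∀ s, f s = g s) : HasRightMean g t b a := by
  rwa [← funext hfg]

theorem add (htb : t < b) (hf : HasRightMean f t b a) (hg : HasRightMean g t b a') :
    HasRightMean (fun s => f s + g s) t b (a + a') := by
  refine ⟨hf.integrableOn.add hg.integrableOn, (hf.tendsto.add hg.tendsto).congr' ?_⟩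
  filter_upwards [eventually_add_le htb] with ε ⟨h0, hε⟩
  rw [intervalIntegral.integral_add (hf.integrableOn.intervalIntegrable_add h0 hε)
    (hg.integrableOn.intervalIntegrable_add h0 hε), mul_add]

theorem const_mul (hf : HasRightMean f t b a) (r : ℝ) :
    HasRightMean (fun s => r * f s) t b (r * a) := by
  refine ⟨Integrable.const_mul hf.integrableOn r, (hf.tendsto.const_mul r).congr fun ε => ?_⟩
  rw [intervalIntegral.integral_const_mul]; ring

theorem zero : HasRightMean (fun _ => 0) t b 0 :=
  ⟨integrableOn_zero, by simp⟩

theorem sum (htb : t < b) {ι : Type*} {F : ι → ℝ → ℝ} {A : ι → ℝ} (u : Finset ι)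
    (hF : ∀ i, HasRightMean (F i) t b (A i)) :
    HasRightMean (fun s => ∑ i ∈ u, F i s) t b (∑ i ∈ u, A i) := by
  classical
  induction u using Finset.induction_on with
  | empty => simpa using zero
  | insert i u hi ih => simpa only [Finset.sum_insert hi] using (hF i).add htb ih

theorem squeeze (htb : t < b) (hf : IntegrableOn f (Icc t b)) (hψ : HasRightMean ψ t b 0)
    (h : ∀ s ∈ Icc t b, |f s| ≤ ψ s) : HasRightMean f t b 0 := by
  refine ⟨hf, squeeze_zero_norm' ?_ hψ.tendsto⟩
  filter_upwards [eventually_add_le htb] with ε ⟨h0, hε⟩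
  rw [Real.norm_eq_abs, abs_mul, abs_of_pos (inv_pos.2 h0)]
  refine mul_le_mul_of_nonneg_left ?_ (inv_pos.2 h0).le
  have hle : t ≤ t + ε := by linarith
  refine (intervalIntegral.abs_integral_le_integral_abs hle).trans
    (intervalIntegral.integral_mono_on hle (hf.intervalIntegrable_add h0 hε).abs
      (hψ.integrableOn.intervalIntegrable_add h0 hε) fun s hs => h s ⟨hs.1, hs.2.trans hε⟩)

theorem of_hasDerivWithinAt (hf : IntegrableOn f (Icc t b))
    (h : HasDerivWithinAt (fun x => ∫ s in t..x, f s) a (Ioi t) t) : HasRightMean f t b a := by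
  refine ⟨hf, ?_⟩
  have h1 := hasDerivWithinAt_iff_tendsto_slope' (lt_irrefl t) |>.1 h
  have h2 : Tendsto (fun ε : ℝ => t + ε) (𝓝[>] 0) (𝓝[>] t) := by
    refine tendsto_nhdsWithin_iff.2 ⟨?_, ?_⟩
    · have : Tendsto (fun ε : ℝ => t + ε) (𝓝 0) (𝓝 (t + 0)) := tendsto_const_nhds.add tendsto_id
      rw [add_zero] at this
      exact this.mono_left nhdsWithin_le_nhds
    · filter_upwards [self_mem_nhdsWithin] with ε hε
      have : 0 < ε := hε
      simpa using this
  refine (h1.comp h2).congr fun ε => ?_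
  simp [slope]

theorem of_continuousOn (htb : t < b) (hc : ContinuousOn c (Icc t b)) :
    HasRightMean c t b (c t) := by
  refine of_hasDerivWithinAt (hc.integrableOn_compact isCompact_Icc) ?_
  have hmem : Icc t b ∈ 𝓝[>] t := mem_of_superset (Ioc_mem_nhdsGT htb) Ioc_subset_Icc_self
  refine (intervalIntegral.integral_hasDerivWithinAt_right IntervalIntegrable.refl
    (s := Ici t) (t := Ioi t)
    ⟨Icc t b, hmem, hc.aestronglyMeasurable measurableSet_Icc⟩ ?_).mono Ioi_subset_Ici_self
  exact (hc t ⟨le_rfl, htb.le⟩).mono_of_mem_nhdsWithin hmem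

/-- Convergent averages of a signed `f` do not control those of `(c - c t) f`. The majorant `ψ` of
`|f|`, whose averages stay bounded, does. -/
theorem continuousOn_mul (htb : t < b) (hf : HasRightMean f t b a) (hψ : HasRightMean ψ t b a')
    (h : ∀ s, |f s| ≤ ψ s) (hc : ContinuousOn c (Icc t b)) :
    HasRightMean (fun s => c s * f s) t b (c t * a) := by
  have hi : IntegrableOn (fun s => (c s - c t) * f s) (Icc t b) :=
    hf.integrableOn.continuousOn_mul (hc.sub continuousOn_const) isCompact_Icc
  have h1 : HasRightMean (fun s => (c s - c t) * f s) t b 0 := by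
    refine ⟨hi, Metric.tendsto_nhds.2 fun δ hδ => ?_⟩
    -- The averages of `ψ` are eventually below `|a'| + 1`; the denominator is one larger to make
    -- the final inequality strict.
    set η := δ / (|a'| + 2) with hη
    have hη0 : 0 < η := div_pos hδ (by positivity)
    have hb1 : ∀ᶠ ε in 𝓝[>] (0 : ℝ), ε⁻¹ * ∫ s in t..t + ε, ψ s < |a'| + 1 :=
      hψ.tendsto.eventually (Iio_mem_nhds (by linarith [le_abs_self a']))
    have hcont := hc t ⟨le_rfl, htb.le⟩
    obtain ⟨r, hr, hr'⟩ := Metric.continuousWithinAt_iff.1 hcont η hη0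
    filter_upwards [hb1, eventually_add_le htb, Ioo_mem_nhdsGT hr] with ε h1 ⟨h0, hε⟩ h2
    have hle : t ≤ t + ε := by linarith
    rw [dist_zero_right, Real.norm_eq_abs, abs_mul, abs_of_pos (inv_pos.2 h0)]
    have h3 : |∫ s in t..t + ε, (c s - c t) * f s| ≤ ∫ s in t..t + ε, η * ψ s := by
      refine (intervalIntegral.abs_integral_le_integral_abs hle).trans
        (intervalIntegral.integral_mono_on hle (hi.intervalIntegrable_add h0 hε).abs
          ((hψ.integrableOn.intervalIntegrable_add h0 hε).const_mul _) fun s hs => ?_)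
      rw [abs_mul]
      refine mul_le_mul ?_ (h s) (abs_nonneg _) hη0.le
      have := hr' (x := s) ⟨hs.1, hs.2.trans hε⟩ (by
        rw [Real.dist_eq, abs_of_nonneg (by linarith [hs.1])]; linarith [hs.2, h2.2])
      exact this.le
    rw [intervalIntegral.integral_const_mul] at h3
    calc ε⁻¹ * |∫ s in t..t + ε, (c s - c t) * f s|
        ≤ ε⁻¹ * (η * ∫ s in t..t + ε, ψ s) := mul_le_mul_of_nonneg_left h3 (inv_pos.2 h0).le
      _ = η * (ε⁻¹ * ∫ s in t..t + ε, ψ s) := by ring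
      _ ≤ η * (|a'| + 1) := mul_le_mul_of_nonneg_left h1.le hη0.le
      _ < η * (|a'| + 2) := by nlinarith
      _ = δ := by rw [hη, div_mul_cancel₀ _ (by positivity)]
  have h2 := h1.add htb (hf.const_mul (c t))
  rw [zero_add] at h2
  exact h2.congr fun s => by ring

end HasRightMean

/-- `t` is a right Lebesgue point of `f` and of its square. -/
structure SqMean (f : ℝ → ℝ) (t b : ℝ) : Prop where
  memLp : MemLp f 2 (volume.restrict (Icc t b))
  mean : HasRightMean f t b (f t)
  sq : HasRightMean (fun s => f s ^ 2) t b (f t ^ 2)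

namespace SqMean

variable {f g c : ℝ → ℝ} {t b : ℝ}

theorem of_continuousOn (htb : t < b) (hc : ContinuousOn c (Icc t b)) : SqMean c t b := by
  exact ⟨hc.memLp_Icc 2, .of_continuousOn htb hc,
    .of_continuousOn (c := fun s => c s ^ 2) htb (hc.pow 2)⟩

theorem sub_sq (htb : t < b) (hf : SqMean f t b) :
    HasRightMean (fun s => (f s - f t) ^ 2) t b 0 := by
  have := (hf.sq.add htb (hf.mean.const_mul (-2 * f t))).add htb
    (HasRightMean.of_continuousOn (c := fun _ => f t ^ 2) htb continuousOn_const)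
  rw [show f t ^ 2 + -2 * f t * f t + f t ^ 2 = 0 by ring] at this
  exact this.congr fun s => by ring

/-- The product of the increments from `t` is dominated by the sum of their squares, whose averages
tend to zero by `sub_sq`. The rest of `f g` is linear in `f` and `g`. -/
theorem mul (htb : t < b) (hf : SqMean f t b) (hg : SqMean g t b) :
    HasRightMean (fun s => f s * g s) t b (f t * g t) := by
  have hc : ∀ r : ℝ, MemLp (fun _ : ℝ => r) 2 (volume.restrict (Icc t b)) := fun r =>
    memLp_const r
  have h1 : HasRightMean (fun s => (f s - f t) * (g s - g t)) t b 0 := by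
    refine HasRightMean.squeeze htb (integrableOn_mul_of_memLp (hf.memLp.sub (hc _))
      (hg.memLp.sub (hc _)))
      (ψ := fun s => (f s - f t) ^ 2 + (g s - g t) ^ 2) ?_ fun s _ => ?_
    · simpa using (hf.sub_sq htb).add htb (hg.sub_sq htb)
    · rw [abs_le]
      constructor <;> nlinarith [sq_nonneg (f s - f t + (g s - g t)),
        sq_nonneg (f s - f t - (g s - g t)), sq_nonneg (f s - f t), sq_nonneg (g s - g t)]
  have h2 := ((h1.add htb (hf.mean.const_mul (g t))).add htb (hg.mean.const_mul (f t))).add htb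
    (HasRightMean.of_continuousOn (c := fun _ => -(f t * g t)) htb continuousOn_const)
  rw [show 0 + g t * f t + f t * g t + -(f t * g t) = f t * g t by ring] at h2
  exact h2.congr fun s => by ring

theorem add (htb : t < b) (hf : SqMean f t b) (hg : SqMean g t b) :
    SqMean (fun s => f s + g s) t b := by
  refine ⟨hf.memLp.add hg.memLp, hf.mean.add htb hg.mean, ?_⟩
  have := (hf.sq.add htb hg.sq).add htb ((hf.mul htb hg).const_mul 2)
  rw [show f t ^ 2 + g t ^ 2 + 2 * (f t * g t) = (f t + g t) ^ 2 by ring] at this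
  exact this.congr fun s => by ring

theorem continuousOn_mul (htb : t < b) (hf : SqMean f t b) (hc : ContinuousOn c (Icc t b)) :
    SqMean (fun s => c s * f s) t b := by
  refine ⟨hf.memLp.mul' (hc.memLp_Icc ⊤), hf.mean.continuousOn_mul htb (ψ := fun s => 1 + f s ^ 2)
    ((HasRightMean.of_continuousOn (c := fun _ => 1) htb continuousOn_const).add htb hf.sq)
    (fun s => abs_le.2 ⟨by nlinarith [sq_nonneg (f s + 1)], by nlinarith [sq_nonneg (f s - 1)]⟩) hc,
    ?_⟩
  have := hf.sq.continuousOn_mul (c := fun s => c s ^ 2) htb hf.sq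
    (fun s => (abs_of_nonneg (sq_nonneg _)).le) (hc.pow 2)
  rw [← mul_pow] at this
  exact this.congr fun s => by simp only [mul_pow]

theorem sum (htb : t < b) {ι : Type*} {F : ι → ℝ → ℝ} (u : Finset ι)
    (hF : ∀ i, SqMean (F i) t b) : SqMean (fun s => ∑ i ∈ u, F i s) t b := by
  classical
  induction u using Finset.induction_on with
  | empty => simpa using of_continuousOn (c := fun _ => (0 : ℝ)) htb continuousOn_const
  | insert i u hi ih => simpa only [Finset.sum_insert hi] using (hF i).add htb ih

end SqMean

theorem MeasureTheory.IntegrableOn.ae_hasRightMean {f : ℝ → ℝ} {a b : ℝ}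
    (hf : IntegrableOn f (Icc a b)) :
    ∀ᵐ t ∂volume.restrict (Icc a b), HasRightMean f t b (f t) := by
  refine (ae_restrict_iff' measurableSet_Icc).2 ?_
  by_cases hab : a ≤ b
  swap
  · exact Eventually.of_forall fun t ht => absurd (ht.1.trans ht.2) hab
  have := (hf.intervalIntegrable_of_mem ⟨le_rfl, hab⟩ ⟨hab, le_rfl⟩).ae_hasDerivAt_integral
  filter_upwards [this] with t h ht
  rw [uIcc_of_le hab] at h
  exact HasRightMean.of_hasDerivWithinAt (hf.mono_set (Icc_subset_Icc_left ht.1))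
    (h ht t ht).hasDerivWithinAt

theorem MeasureTheory.MemLp.ae_sqMean {f : ℝ → ℝ} {a b : ℝ}
    (hf : MemLp f 2 (volume.restrict (Icc a b))) :
    ∀ᵐ t ∂volume.restrict (Icc a b), SqMean f t b := by
  have h1 : IntegrableOn f (Icc a b) := hf.integrable one_le_two
  have h2 : IntegrableOn (fun s => f s ^ 2) (Icc a b) := hf.integrable_sq
  filter_upwards [h1.ae_hasRightMean, h2.ae_hasRightMean, ae_restrict_mem measurableSet_Icc]
    with t h3 h4 ht
  exact ⟨hf.mono_measure (Measure.restrict_mono_set _ (Icc_subset_Icc_left ht.1)), h3, h4⟩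

/-- For small `w` in the direction `-b` the linear term would win. The step length is `|b|² / (|c| +
1)`, where `c` is the value of the quadratic form at `b`. -/
theorem eq_zero_of_quadratic_nonneg {ι : Type*} [Fintype ι] {A : Matrix ι ι ℝ} {b : ι → ℝ}
    (h : ∀ w, 0 ≤ w ⬝ᵥ (A *ᵥ w) + 2 * (w ⬝ᵥ b)) : b = 0 := by
  by_contra hb
  have hpos : 0 < b ⬝ᵥ b := lt_of_le_of_ne (Finset.sum_nonneg fun i _ => mul_self_nonneg _)
    fun h0 => hb (dotProduct_self_eq_zero.1 h0.symm)
  set c := b ⬝ᵥ (A *ᵥ b) with hc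
  have h1 := h (-(b ⬝ᵥ b / (|c| + 1)) • b)
  have h2 : 0 < |c| + 1 := by positivity
  set r := b ⬝ᵥ b / (|c| + 1) with hr
  have h3 : r * (|c| + 1) = b ⬝ᵥ b := div_mul_cancel₀ _ h2.ne'
  have h4 : 0 < r := div_pos hpos h2
  rw [mulVec_smul, smul_dotProduct, smul_dotProduct, dotProduct_smul, ← hc] at h1
  simp only [smul_eq_mul] at h1
  nlinarith [mul_le_mul_of_nonneg_left (le_abs_self c) (mul_nonneg h4.le h4.le),
    mul_pos h4 hpos, mul_pos h4 h4]

/-! ### The Riccati feedback is an equilibrium, and linear equilibria satisfy the Riccati gain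
formula. -/

namespace LQProblem

variable {n m : ℕ} {p : LQProblem n m}

namespace Standing

variable (h : p.Standing)
include h

theorem weight_slices {t : ℝ} (ht : t ∈ Icc 0 p.T) :
    ContinuousOn (p.M t) (Icc t p.T) ∧ ContinuousOn (p.S t) (Icc t p.T) :=
  ⟨continuousOn_matrix fun i j => (continuousOn_slice (f := fun t s => p.M t s i j)
      (h.h2.1 i j).continuousOn ht).mono (Icc_subset_Icc_left ht.1),
    continuousOn_matrix fun i j => (continuousOn_slice (f := fun t s => p.S t s i j)
      (h.h4 i j).continuousOn ht).mono (Icc_subset_Icc_left ht.1)⟩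

/-- Because `M(s,s) k(s) = -(BᵀP + S)`, the coefficient of the linear term is `(M(t,s) - M(s,s)) k +
(S(t,s) - S(s,s)) + Bᵀ (C(t,s) - P(s))`. The differences are continuous in `s` and vanish at `s =
t`, while `k` and `B` are merely essentially bounded factors. This is why the equilibrium inequality
holds at every `t` and not only at Lebesgue points. -/
theorem exists_costGap_ge {P : ℝ → Matrix (Fin n) (Fin n) ℝ} (hPc : ContinuousOn P (Icc 0 p.T))
    {Z W : ℝ → Matrix (Fin n) (Fin n) ℝ}
    (hZ : IsFundamental (p.closedLoop fun s => -p.Upsilon P s) Z W 0 p.T)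
    (hP : ∀ t ∈ Icc 0 p.T, P t = p.costMat (fun s => -p.Upsilon P s) Z W t t)
    {t : ℝ} (ht : t ∈ Icc 0 p.T) (v : Fin m → ℝ) {X : ℝ → Fin n → ℝ}
    (hX : ContinuousOn X (Icc t p.T)) :
    ∃ ρ : ℝ → ℝ, ContinuousOn ρ (Icc t p.T) ∧ ρ t = 0 ∧ ∀ᵐ s ∂volume.restrict (Icc t p.T),
      -ρ s ≤ p.costGap (fun s => -p.Upsilon P s) Z W t s (v - (-p.Upsilon P s) *ᵥ X s) (X s) := by
  have hsub : Icc t p.T ⊆ Icc 0 p.T := Icc_subset_Icc_left ht.1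
  have hk : MatEssBdd p.T fun s => -p.Upsilon P s := (h.upsilon_essBdd hPc).neg
  have hBb : MatEssBdd p.T fun s => (p.B s)ᵀ := MatEssBdd.transpose h.h1.2
  obtain ⟨κ, hκ0, hκ⟩ := hk.exists_absSum_le
  obtain ⟨β, hβ0, hβ⟩ := hBb.exists_absSum_le
  obtain ⟨C, hC⟩ := isCompact_Icc.exists_bound_of_continuousOn hX
  have hC0 : 0 ≤ C := (norm_nonneg _).trans (hC t ⟨le_rfl, ht.2⟩)
  set k : ℝ → Matrix (Fin m) (Fin n) ℝ := fun s => -p.Upsilon P s with hkdef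
  set D := 2 * ((‖v‖ + κ * C) * C) with hD
  have hD0 : 0 ≤ D := by positivity
  refine ⟨fun s => D * ((p.M t s - p.M s s).absSum * κ + (p.S t s - p.S s s).absSum +
    β * (p.costMat k Z W t s - P s).absSum), ?_, ?_, ?_⟩
  · have hM : ContinuousOn (fun s => p.M s s) (Icc 0 p.T) := continuousOn_matrix fun i j =>
      continuousOn_diag (f := fun t s => p.M t s i j) (h.h2.1 i j).continuousOn
    obtain ⟨h1, h2⟩ := h.weight_slices ht
    have h3 := (h.costMat_primitive (IsGain.of_essBdd hk) hZ ht).continuousOn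
    exact continuousOn_const.mul ((((h1.sub (hM.mono hsub)).matrix_absSum.mul
      continuousOn_const).add (h2.sub (h.S_diag_continuousOn.mono hsub)).matrix_absSum).add
        (continuousOn_const.mul ((h3.sub hPc).mono hsub).matrix_absSum))
  · simp [← hP t ht, Matrix.absSum]
  · filter_upwards [ae_restrict_of_ae_restrict_of_subset hsub hκ,
      ae_restrict_of_ae_restrict_of_subset hsub hβ, ae_restrict_mem measurableSet_Icc]
      with s h1 h2 hs
    have hs' := hsub hs
    set N := p.M t s * k s + p.S t s + (p.B s)ᵀ * p.costMat k Z W t s with hN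
    have hN' : N = (p.M t s - p.M s s) * k s + (p.S t s - p.S s s) +
        (p.B s)ᵀ * (p.costMat k Z W t s - P s) := by
      have h0 : p.M s s * k s = -((p.B s)ᵀ * P s + p.S s s) := by
        rw [hkdef]; simp only [Matrix.mul_neg, h.M_mul_upsilon P hs']
      rw [hN, Matrix.sub_mul, Matrix.mul_sub, h0]
      abel
    have h3 : N.absSum ≤ (p.M t s - p.M s s).absSum * κ + (p.S t s - p.S s s).absSum +
        β * (p.costMat k Z W t s - P s).absSum := by
      rw [hN']
      refine (Matrix.absSum_add_le _ _).trans (add_le_add ((Matrix.absSum_add_le _ _).trans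
        (add_le_add_left ((Matrix.absSum_mul_le _ _).trans ?_) _))
          ((Matrix.absSum_mul_le _ _).trans ?_))
      · exact mul_le_mul_of_nonneg_left h1 (Matrix.absSum_nonneg _)
      · exact mul_le_mul_of_nonneg_right h2 (Matrix.absSum_nonneg _)
    set w := v - k s *ᵥ X s with hw
    have h4 : ‖w‖ ≤ ‖v‖ + κ * C := by
      refine (norm_sub_le _ _).trans (add_le_add_right ?_ _)
      exact (norm_mulVec_le_absSum _ _).trans (mul_le_mul h1 (hC s hs) (norm_nonneg _) hκ0)
    have h5 := (abs_le.1 (Matrix.abs_dotProduct_mulVec_le N w (X s))).1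
    have h6 : N.absSum * (‖w‖ * ‖X s‖) ≤ ((p.M t s - p.M s s).absSum * κ +
        (p.S t s - p.S s s).absSum + β * (p.costMat k Z W t s - P s).absSum) *
          ((‖v‖ + κ * C) * C) :=
      mul_le_mul h3 (mul_le_mul h4 (hC s hs) (norm_nonneg _) (by positivity)) (by positivity)
        ((Matrix.absSum_nonneg _).trans h3)
    have h7 := (h.h2.2 t ht s hs').posSemidef.quadratic_nonneg w
    change _ ≤ w ⬝ᵥ (p.M t s *ᵥ w) + 2 * (w ⬝ᵥ (N *ᵥ X s))
    rw [hD]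
    linarith

theorem riccatiFeedback_isLinearEquilibrium {P : ℝ → Matrix (Fin n) (Fin n) ℝ}
    (hPc : ContinuousOn P (Icc 0 p.T)) (hP : p.HasCost (fun s => -p.Upsilon P s) P) :
    p.IsLinearEquilibrium (p.riccatiFeedback P) := by
  have hk : p.IsGain fun s => -p.Upsilon P s := IsGain.of_essBdd (h.upsilon_essBdd hPc).neg
  have hu : ∀ s ∈ Icc 0 p.T, ∀ y, p.riccatiFeedback P s y = (-p.Upsilon P s) *ᵥ y :=
    fun s _ y => by rw [riccatiFeedback, Upsilon, neg_mulVec]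
  obtain ⟨Z, W, hZ, hZP⟩ := hP
  refine ⟨⟨⟨?_, fun t ht x => ?_⟩, fun t ht x v => ?_⟩, _, hk, hu⟩
  · have : AEMeasurable (fun q : ℝ × (Fin n → ℝ) => (-p.Upsilon P q.1) *ᵥ q.2)
        (volume.restrict (Icc 0 p.T ×ˢ (univ : Set (Fin n → ℝ)))) := by
      rw [Measure.volume_eq_prod, ← Measure.prod_restrict]
      refine aemeasurable_pi_iff.2 fun i => ?_
      simp only [mulVec, dotProduct]
      exact Finset.aemeasurable_fun_sum _ fun j _ => (hk i j).1.aemeasurable.comp_fst.mul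
        ((measurable_pi_apply j).comp measurable_snd).aemeasurable
    refine this.congr (Eventually.of_forall fun q => ?_)
    simp only [riccatiFeedback, Upsilon, neg_mulVec]
  · have ht' := Ico_subset_Icc_self ht
    exact ⟨h.exists_trajectory hk hu ht' x, fun X Y hX hY => h.trajectory_unique hk hu ht' hX hY⟩
  · have ht' := Ico_subset_Icc_self ht
    -- One state, driven by the constant `v` up to the horizon, serves all `ε` at once.
    obtain ⟨X, hX⟩ := h.exists_state IsGain.zero (c := fun _ => v) (memLp_const v) ht' x
    simp only [zero_mulVec, zero_add] at hX
    obtain ⟨ρ, hρ, hρ0, hge⟩ := h.exists_costGap_ge hPc hZ hZP ht' v hX.2.1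
    have hi := (h.cost_eq hk hZ ht' hX).1
    have h1 := (HasRightMean.of_continuousOn ht.2 hρ).const_mul (-1)
    rw [hρ0, mul_zero] at h1
    have h2 : Tendsto (fun ε : ℝ => ((ε⁻¹ * ∫ s in t..t + ε, -1 * ρ s : ℝ) : EReal)) (𝓝[>] 0)
        (𝓝 (0 : ℝ)) := continuous_coe_real_ereal.continuousAt.tendsto.comp h1.tendsto
    rw [← EReal.coe_zero, ← h2.liminf_eq]
    refine liminf_le_liminf ?_
    filter_upwards [eventually_add_le ht.2] with ε ⟨h0, hε⟩
    rw [h.J_perturb_sub hk hu hZ ht' hX h0.le hε, EReal.coe_le_coe_iff, div_eq_inv_mul]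
    refine mul_le_mul_of_nonneg_left ?_ (inv_pos.2 h0).le
    refine intervalIntegral.integral_mono_ae_restrict (by linarith)
      (h1.integrableOn.intervalIntegrable_add h0 hε) (hi.intervalIntegrable_add h0 hε) ?_
    filter_upwards [ae_restrict_of_ae_restrict_of_subset (Icc_subset_Icc_right hε) hge] with s hs
    rwa [neg_one_mul]

/-- The gap is a polynomial of degree at most two in the entries of `k` and `B`, with coefficients
continuous in `s`. Lebesgue points of these entries and of their squares therefore suffice. -/
theorem hasRightMean_costGap {k : ℝ → Matrix (Fin m) (Fin n) ℝ} (hk : p.IsGain k)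
    {Z W : ℝ → Matrix (Fin n) (Fin n) ℝ} (hZ : IsFundamental (p.closedLoop k) Z W 0 p.T)
    {t : ℝ} (ht : t ∈ Ico 0 p.T) (hkt : ∀ i j, SqMean (fun s => k s i j) t p.T)
    (hBt : ∀ i j, SqMean (fun s => p.B s i j) t p.T) (v : Fin m → ℝ) {X : ℝ → Fin n → ℝ}
    (hX : ContinuousOn X (Icc t p.T)) :
    HasRightMean (fun s => p.costGap k Z W t s (v - k s *ᵥ X s) (X s)) t p.T
      (p.costGap k Z W t t (v - k t *ᵥ X t) (X t)) := by
  have ht' := Ico_subset_Icc_self ht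
  have hX' := continuousOn_pi.1 hX
  obtain ⟨hM, hS⟩ := h.weight_slices ht'
  have hC := ((h.costMat_primitive hk hZ ht').mono ht' ⟨h.T_pos.le, le_rfl⟩).continuousOn
  have hw : ∀ i, SqMean (fun s => (v - k s *ᵥ X s) i) t p.T := fun i => by
    have h1 : SqMean (fun s => v i + ∑ j, -X s j * k s i j) t p.T :=
      (SqMean.of_continuousOn (c := fun _ => v i) ht.2 continuousOn_const).add ht.2
        (SqMean.sum ht.2 _ fun j => (hkt i j).continuousOn_mul ht.2 (hX' j).neg)
    convert h1 using 2 with s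
    simp only [Pi.sub_apply, mulVec, dotProduct, mul_neg, Finset.sum_neg_distrib, sub_eq_add_neg,
      mul_comm]
  have hMw : ∀ i, SqMean (fun s => (p.M t s *ᵥ (v - k s *ᵥ X s)) i) t p.T := fun i =>
    SqMean.sum ht.2 Finset.univ fun j => (hw j).continuousOn_mul ht.2 (hM.matrix_entry i j)
  have hN : ∀ i j, SqMean (fun s =>
      (p.M t s * k s + p.S t s + (p.B s)ᵀ * p.costMat k Z W t s) i j) t p.T := fun i j => by
    refine ((SqMean.sum ht.2 Finset.univ fun l => (hkt l j).continuousOn_mul ht.2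
      (hM.matrix_entry i l)).add ht.2
        (SqMean.of_continuousOn ht.2 (hS.matrix_entry i j))).add ht.2 ?_
    have h1 := SqMean.sum ht.2 Finset.univ fun l =>
      (hBt l i).continuousOn_mul ht.2 (hC.matrix_entry l j)
    convert h1 using 2 with s
    simp only [mul_apply, transpose_apply, mul_comm]
  have hNX : ∀ i, SqMean (fun s =>
      ((p.M t s * k s + p.S t s + (p.B s)ᵀ * p.costMat k Z W t s) *ᵥ X s) i) t p.T := fun i => by
    have h1 := SqMean.sum ht.2 Finset.univ fun j => (hN i j).continuousOn_mul ht.2 (hX' j)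
    convert h1 using 2 with s
    simp only [mulVec, dotProduct, mul_comm]
  exact (HasRightMean.sum ht.2 Finset.univ fun i => (hw i).mul ht.2 (hMw i)).add ht.2
    ((HasRightMean.sum ht.2 Finset.univ fun i => (hw i).mul ht.2 (hNX i)).const_mul 2)

/-- At almost every `t` the equilibrium condition becomes nonnegativity of the gap at `s = t` for
all states and deviations. The coefficient of its linear part must then vanish, and solving for `k
t` gives the formula. -/
theorem ae_eq_upsilon {u : ℝ → (Fin n → ℝ) → Fin m → ℝ} (he : p.IsEquilibrium u)
    {k : ℝ → Matrix (Fin m) (Fin n) ℝ} (hk : p.IsGain k)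
    (hu : ∀ s ∈ Icc 0 p.T, ∀ y, u s y = k s *ᵥ y)
    {Z W : ℝ → Matrix (Fin n) (Fin n) ℝ} (hZ : IsFundamental (p.closedLoop k) Z W 0 p.T) :
    ∀ᵐ t ∂volume.restrict (Icc 0 p.T), k t = -p.Upsilon (fun t => p.costMat k Z W t t) t := by
  have hk' : ∀ᵐ t ∂volume.restrict (Icc 0 p.T), ∀ i j, SqMean (fun s => k s i j) t p.T :=
    ae_all_iff.2 fun i => ae_all_iff.2 fun j => (hk i j).ae_sqMean
  have hB' : ∀ᵐ t ∂volume.restrict (Icc 0 p.T), ∀ i j, SqMean (fun s => p.B s i j) t p.T :=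
    ae_all_iff.2 fun i => ae_all_iff.2 fun j =>
      ((h.h1.2 i j).mono_exponent le_top).ae_sqMean
  have hne : ∀ᵐ t ∂volume.restrict (Icc 0 p.T), t ≠ p.T :=
    ae_restrict_of_ae (compl_mem_ae_iff.2 (measure_singleton p.T))
  filter_upwards [hk', hB', hne, ae_restrict_mem measurableSet_Icc] with t hkt hBt hnt ht'
  have ht : t ∈ Ico 0 p.T := ⟨ht'.1, lt_of_le_of_ne ht'.2 hnt⟩
  have key : ∀ (x : Fin n → ℝ) (w : Fin m → ℝ), 0 ≤ p.costGap k Z W t t w x := by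
    intro x w
    -- The constant control is shifted by `k t *ᵥ x`, so that its deviation from the feedback at
    -- time `t` is the prescribed `w`.
    obtain ⟨X, hX⟩ := h.exists_state IsGain.zero (c := fun _ => w + k t *ᵥ x) (memLp_const _) ht' x
    simp only [zero_mulVec, zero_add] at hX
    have h0 : X t = x := ((h.isState_iff ht').1 hX).2.2
    have h1 := h.hasRightMean_costGap hk hZ ht hkt hBt (w + k t *ᵥ x) hX.2.1
    rw [h0, add_sub_cancel_right] at h1
    have h2 : Tendsto (fun ε : ℝ => (((p.J t x (perturb u t ε (w + k t *ᵥ x)) - p.J t x u) / ε : ℝ)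
        : EReal)) (𝓝[>] 0) (𝓝 (p.costGap k Z W t t w x : ℝ)) := by
      refine (continuous_coe_real_ereal.continuousAt.tendsto.comp h1.tendsto).congr' ?_
      filter_upwards [eventually_add_le ht.2] with ε ⟨h0, hε⟩
      rw [h.J_perturb_sub hk hu hZ ht' hX h0.le hε, div_eq_inv_mul, Function.comp_apply]
    have h3 := he.2 t ht x (w + k t *ᵥ x)
    rw [h2.liminf_eq] at h3
    exact EReal.coe_nonneg.1 h3
  have h0 : p.M t t * k t + p.S t t + (p.B t)ᵀ * p.costMat k Z W t t = 0 := by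
    refine Matrix.ext_of_mulVec_single fun j => ?_
    rw [eq_zero_of_quadratic_nonneg fun w => key (Pi.single j 1) w, zero_mulVec]
  have h1 : p.M t t * k t = -((p.B t)ᵀ * p.costMat k Z W t t + p.S t t) := by
    rw [eq_neg_iff_add_eq_zero, ← h0]; abel
  rw [Upsilon, ← Matrix.mul_neg, ← h1, ← Matrix.mul_assoc, h.M_inv_mul ht' ht', Matrix.one_mul]

end Standing

end LQProblem

end

theorem mainTheorem3 {n m : ℕ} (p : LQProblem n m) (hT : 0 < p.T)
    (h1 : p.H1) (h2 : p.H2) (h3 : p.H3) (h4 : p.H4) (h5 : p.H5) :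
    ∃ P : ℝ → Matrix (Fin n) (Fin n) ℝ,
      -- `P` is the unique symmetric solution of the equilibrium Riccati equation,
      p.IsRiccatiSolution P ∧
      (∀ P', p.IsRiccatiSolution P' → EqOn P' P (Icc 0 p.T)) ∧
      -- its feedback is a linear equilibrium,
      p.IsLinearEquilibrium (p.riccatiFeedback P) ∧
      -- every linear equilibrium is that feedback, up to a null set of times, and the quadratic
      -- form of its cost is given by the solution of the Riccati equation.
      ∀ u, p.IsLinearEquilibrium u →
        (∀ᵐ t ∂(volume.restrict (Icc 0 p.T)), ∀ x, u t x = p.riccatiFeedback P t x) ∧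
        ∀ t ∈ Ico 0 p.T, ∀ x, p.J t x u = x ⬝ᵥ (P t *ᵥ x) := by
  have h : p.Standing := ⟨hT, h1, h2, h3, h4, h5⟩
  obtain ⟨P, hPc, hP, huniq⟩ := h.exists_unique_hasCost
  refine ⟨P, h.isRiccatiSolution_of_hasCost hPc hP,
    fun P' hP' => huniq P' hP'.1 (h.hasCost_of_isRiccatiSolution hP'),
    h.riccatiFeedback_isLinearEquilibrium hPc hP, fun u ⟨he, k, hk, hu⟩ => ?_⟩
  obtain ⟨Z, W, hZ⟩ := h.exists_isFundamental_closedLoop hk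
  have hcost : p.HasCost k fun t => p.costMat k Z W t t := ⟨Z, W, hZ, fun _ _ => rfl⟩
  have hae := h.ae_eq_upsilon he hk hu hZ
  -- The gain `k` agrees almost everywhere with the one generated by its own diagonal cost matrix.
  -- That matrix is therefore self-consistent and equals `P` on all of `[0,T]`, so the cost formula
  -- has no exceptional times.
  have heq := huniq _ (h.hasCost_continuousOn hk hcost) (hcost.congr hae)
  refine ⟨?_, fun t ht x => ?_⟩
  · filter_upwards [hae, ae_restrict_mem measurableSet_Icc] with t hkt ht x
    have hPt : p.costMat k Z W t t = P t := heq ht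
    rw [hu t ht, hkt, LQProblem.riccatiFeedback, LQProblem.Upsilon, hPt, neg_mulVec]
  · rw [h.J_linear hk hu hZ (Ico_subset_Icc_self ht)]
    exact congrArg (fun A => x ⬝ᵥ (A *ᵥ x)) (heq (Ico_subset_Icc_self ht))
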